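/- Consider the following randomized procedure ChordalGen with the GrowingSubtree method, whose input is a pair of integers $1 \le k \le n$. (1) Generate a random host tree $T$ on $n$ nodes: start with a single node and, $n-1$ times, pick a uniformly random node of the current tree and add a new node adjacent to it. (2) Independently for $i = 1, \dots, n$, generate a subtree $T_i$ of $T$: let $T_i$ consist of a uniformly random node of $T$; choose $k_i$ uniformly in $\{1, \dots, k\}$; then, $k_i - 1$ times, choose a uniformly random node $y$ of $T_i$ that has neighbours in $T$ outside of $T_i$, choose a uniformly random neighbour $z$ of $y$ outside of $T_i$, and add $z$ to $T_i$. (3) Output the intersection graph $G$ of $V(T_1), \dots, V(T_n)$: its vertices are $1, \dots, n$, and distinct $i, j$ are adjacent if and only if $V(T_i) \cap V(T_j) \ne \emptyset$. This procedure can be implemented in total time $O(\sum_{i=1}^n |V(T_i)|)$. Precisely: on a unit-cost random access machine with addition, subtraction, comparison, indirect addressing and the drawing of a uniformly random integer from an interval as elementary operations, and with words holding the numbers $0, \dots, Cn^2$, there are a program and an absolute constant $C$ such that for all $1 \le k \le n$ the program halts for every outcome of its random choices, the pair $(T, (V(T_i))_{i})$ that it outputs has exactly the distribution described above, and for every outcome: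 it makes at most $C \sum_{i=1}^n |V(T_i)|$ steps; $T$ is a tree, every $T_i$ is a nonempty subtree of it, and $G$ is chordal; and the output represents $G$ by the host tree $T$, the list of the nodes of each $T_i$, and a clique tree of $G$ together with the list of all maximal cliques of $G$, each listed exactly once. If explicit adjacency lists of $G$ are desired too, a second program computes them from this output in at most $C(\sum_{i=1}^n |V(T_i)| + m)$ further steps, where $m$ is the number of edges of $G$. -/

import Mathlib

/-! ## The random process: Algorithm ChordalGen with the GrowingSubtree method -/

namespace ChordalGen

/-- Growing a host tree on the nodes `0, …, m`: start with the single node `0`; for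
`v = 1, …, m` pick a uniformly random node among the existing nodes `0, …, v - 1` and add the new
node `v` adjacent to it. -/
noncomputable def growHost : ℕ → PMF (SimpleGraph ℕ)
  | 0 => PMF.pure ⊥
  | m + 1 => (growHost m).bind fun T =>
      (PMF.uniformOfFinset (Finset.range (m + 1)) Finset.nonempty_range_add_one).map fun x =>
        T ⊔ SimpleGraph.edge x (m + 1)

/-- Step 1: the law of the random host tree on `n` nodes. -/
noncomputable def hostTreeLaw (n : ℕ) : PMF (SimpleGraph (Fin n)) :=
  (growHost (n - 1)).map fun T => T.comap Fin.val

open Classical in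
/-- The neighbours of `y` in `T` outside of `S`. -/
noncomputable def outside {n : ℕ} (T : SimpleGraph (Fin n)) (S : Finset (Fin n)) (y : Fin n) :
    Finset (Fin n) :=
  Finset.univ.filter fun z => T.Adj y z ∧ z ∉ S

open Classical in
/-- The nodes of `S` that have neighbours in `T` outside of `S`. -/
noncomputable def boundary {n : ℕ} (T : SimpleGraph (Fin n)) (S : Finset (Fin n)) :
    Finset (Fin n) :=
  S.filter fun y => (outside T S y).Nonempty

open Classical in
/-- One growing step: select a uniformly random node `y` of `S` that has neighbours outside of
`S`, then a uniformly random neighbour `z` of `y` outside of `S`, and add `z` to `S`.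
(The set is left alone when there is no such `y`; this does not happen when `T` is a tree and `S`
is a nonempty proper subset of its nodes.) -/
noncomputable def growStep {n : ℕ} (T : SimpleGraph (Fin n)) (S : Finset (Fin n)) :
    PMF (Finset (Fin n)) :=
  if h : (boundary T S).Nonempty then
    (PMF.uniformOfFinset (boundary T S) h).bind fun y =>
      if h' : (outside T S y).Nonempty then
        (PMF.uniformOfFinset (outside T S y) h').map fun z => insert z S
      else PMF.pure S
  else PMF.pure S

/-- `j` growing steps in a row. -/
noncomputable def growSteps {n : ℕ} (T : SimpleGraph (Fin n)) :
    ℕ → Finset (Fin n) → PMF (Finset (Fin n))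
  | 0, S => PMF.pure S
  | j + 1, S => (growStep T S).bind fun S' => growSteps T j S'

/-- One subtree: a uniformly random start node `x`, a uniformly random size `k'` in `[1, k]`, and
`k' - 1` growing steps. -/
noncomputable def oneSubtree {n : ℕ} [NeZero n] (T : SimpleGraph (Fin n)) (k : ℕ) (hk : 1 ≤ k) :
    PMF (Finset (Fin n)) :=
  (PMF.uniformOfFintype (Fin n)).bind fun x =>
    (PMF.uniformOfFinset (Finset.Icc 1 k) (Finset.nonempty_Icc.2 hk)).bind fun k' =>
      growSteps T (k' - 1) {x}

/-- `m` independent repetitions of the subtree generation. -/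
noncomputable def growingSubtree {n : ℕ} [NeZero n] (T : SimpleGraph (Fin n)) (k : ℕ)
    (hk : 1 ≤ k) : (m : ℕ) → PMF (Fin m → Finset (Fin n))
  | 0 => PMF.pure Fin.elim0
  | m + 1 => (growingSubtree T k hk m).bind fun F =>
      (oneSubtree T k hk).map fun S => Fin.snoc (α := fun _ => Finset (Fin n)) F S

/-- Steps 1 and 2 of ChordalGen with GrowingSubtree: the joint law of the host tree `T` and of the
node sets `V(T_1), …, V(T_n)` of the `n` subtrees. -/
noncomputable def law (n k : ℕ) [NeZero n] (hk : 1 ≤ k) :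
    PMF (SimpleGraph (Fin n) × (Fin n → Finset (Fin n))) :=
  (hostTreeLaw n).bind fun T => (growingSubtree T k hk n).map fun F => (T, F)

/-- The intersection graph of a family of sets. -/
def intersectionGraph {n : ℕ} (F : Fin n → Finset (Fin n)) : SimpleGraph (Fin n) where
  Adj i j := i ≠ j ∧ ∃ x, x ∈ F i ∧ x ∈ F j
  symm := ⟨fun _ _ h => ⟨h.1.symm, h.2.imp fun _ hx => ⟨hx.2, hx.1⟩⟩⟩
  loopless := ⟨fun _ h => h.1 rfl⟩

/-- A graph is chordal if it contains no induced cycle of length 4 or more. -/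
def IsChordal {V : Type*} (G : SimpleGraph V) : Prop :=
  ∀ m : ℕ, 4 ≤ m → IsEmpty (SimpleGraph.cycleGraph m ↪g G)

/-- `H`, whose node `a` carries the set `K a`, is a clique tree of `G`: `H` is a tree, `K` is a
bijection from its nodes to the maximal cliques of `G`, and for every vertex `v` of `G` the nodes
whose cliques contain `v` induce a connected subtree of `H`. -/
structure IsCliqueTree {V ι : Type*} (G : SimpleGraph V) (H : SimpleGraph ι) (K : ι → Set V) :
    Prop where
  isTree : H.IsTree
  injective : Function.Injective K
  isMaximalClique_iff : ∀ S : Set V, Maximal G.IsClique S ↔ ∃ a, K a = S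
  connected : ∀ v, (H.induce {a | v ∈ K a}).Connected

end ChordalGen

/-! ## A randomized random access machine with unit costs

The memory consists of registers and of arrays (memory banks) that are addressed indirectly. A
program is a fixed piece of text, so it uses a fixed number of registers and of arrays. Every
elementary operation and every evaluation of a test costs one step. Words hold the
numbers `0, …, W`. -/

namespace RAM

structure State where
  reg : ℕ → ℕ
  arr : ℕ → ℕ → ℕ

/-- Write `v` into register `x`. -/
def State.setReg (s : State) (x v : ℕ) : State :=
  { s with reg := Function.update s.reg x v }

/-- Write `v` into cell `i` of array `a`. -/
def State.setArr (s : State) (a i v : ℕ) : State :=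
  { s with arr := Function.update s.arr a (Function.update (s.arr a) i v) }

/-- Comparison of two registers. -/
inductive Test where
  | lt (x y : ℕ)
  | eq (x y : ℕ)

def Test.Holds : Test → State → Prop
  | .lt x y, s => s.reg x < s.reg y
  | .eq x y, s => s.reg x = s.reg y

/-- Programs; `x`, `y`, `z` are names of registers and `a` is the name of an array. -/
inductive Cmd where
  | skip
  | const (x c : ℕ)
  | add (x y z : ℕ)
  | sub (x y z : ℕ)
  | load (x a y : ℕ)
  | store (a x y : ℕ)
  | rand (x y z : ℕ)
  | seq (c d : Cmd)
  | branch (b : Test) (c d : Cmd)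
  | loop (b : Test) (c : Cmd)

/-- Sequencing of random results: run `ν` on the state reached under `μ`; the costs add up,
with `e` extra steps. -/
noncomputable def andThen (μ : PMF (State × ℕ)) (ν : State × ℕ → PMF (State × ℕ)) (e : ℕ) :
    PMF (State × ℕ) :=
  μ.bind fun p => (ν p).map fun q => (q.1, p.2 + q.2 + e)

/-- `Exec W c s μ`: with words that hold the numbers up to `W`, the program `c`, started in the
state `s`, halts for every outcome of its random choices without ever producing a number
above `W`, and `μ` is the joint law of its final state and of its number of steps. -/
inductive Exec (W : ℕ) : Cmd → State → PMF (State × ℕ) → Prop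
  | skip (s) : Exec W .skip s (PMF.pure (s, 1))
  | const (s x c) (h : c ≤ W) : Exec W (.const x c) s (PMF.pure (s.setReg x c, 1))
  | add (s x y z) (h : s.reg y + s.reg z ≤ W) :
      Exec W (.add x y z) s (PMF.pure (s.setReg x (s.reg y + s.reg z), 1))
  | sub (s x y z) :
      Exec W (.sub x y z) s (PMF.pure (s.setReg x (s.reg y - s.reg z), 1))
  | load (s x a y) :
      Exec W (.load x a y) s (PMF.pure (s.setReg x (s.arr a (s.reg y)), 1))
  | store (s a x y) :
      Exec W (.store a x y) s (PMF.pure (s.setArr a (s.reg x) (s.reg y), 1))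
  /-- a uniformly random integer of the interval from `s.reg y` to `s.reg z` -/
  | rand (s x y z) (h : s.reg y ≤ s.reg z) :
      Exec W (.rand x y z) s
        ((PMF.uniformOfFinset (Finset.Icc (s.reg y) (s.reg z)) (Finset.nonempty_Icc.2 h)).map
          fun v => (s.setReg x v, 1))
  | seq (c d s μ ν) (h : Exec W c s μ) (h' : ∀ p ∈ μ.support, Exec W d p.1 (ν p)) :
      Exec W (.seq c d) s (andThen μ ν 0)
  | branchTrue (b c d s μ) (hb : b.Holds s) (h : Exec W c s μ) :
      Exec W (.branch b c d) s (μ.map fun p => (p.1, p.2 + 1))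
  | branchFalse (b c d s μ) (hb : ¬ b.Holds s) (h : Exec W d s μ) :
      Exec W (.branch b c d) s (μ.map fun p => (p.1, p.2 + 1))
  | loopFalse (b c s) (hb : ¬ b.Holds s) : Exec W (.loop b c) s (PMF.pure (s, 1))
  | loopTrue (b c s μ ν) (hb : b.Holds s) (h : Exec W c s μ)
      (h' : ∀ p ∈ μ.support, Exec W (.loop b c) p.1 (ν p)) :
      Exec W (.loop b c) s (andThen μ ν 1)

/-- The initial state: the two input numbers in registers `0` and `1`, zeros elsewhere. -/
def State.input (n k : ℕ) : State where
  reg x := if x = 0 then n else if x = 1 then k else 0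
  arr _ _ := 0

/-! ### How graphs and sets are stored -/

/-- The tree on `0, …, m - 1` with root `0` that is given by an array of parents. -/
def parentGraph (m : ℕ) (par : ℕ → ℕ) : SimpleGraph (Fin m) :=
  SimpleGraph.fromRel fun u v => 0 < (v : ℕ) ∧ par v = (u : ℕ)

/-- The `i`-th list of an array `dat` of consecutive lists: the entries at the positions from
`off i` up to, and not including, `off (i + 1)`. -/
def segment (off dat : ℕ → ℕ) (i : ℕ) : List ℕ :=
  (List.range' (off i) (off (i + 1) - off i)).map dat

/-- The set of elements of the `i`-th list. -/
def segmentSet (n : ℕ) (off dat : ℕ → ℕ) (i : ℕ) : Finset (Fin n) :=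
  Finset.univ.filter fun v => (v : ℕ) ∈ segment off dat i

/-- The arrays store the family `F`: the `i`-th list contains each element of `F i` exactly once
and nothing else. -/
def StoresSets {m n : ℕ} (off dat : ℕ → ℕ) (F : Fin m → Set (Fin n)) : Prop :=
  ∀ i : Fin m, (segment off dat i).Nodup ∧
    ∀ v : ℕ, v ∈ segment off dat i ↔ ∃ x ∈ F i, (x : ℕ) = v

/-- The host tree, stored as the array of parents `0`. -/
def State.host (s : State) (n : ℕ) : SimpleGraph (Fin n) := parentGraph n (s.arr 0)

/-- The node sets of the `n` subtrees, stored as lists in the arrays `1` and `2`. -/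
def State.subtrees (s : State) (n : ℕ) : Fin n → Finset (Fin n) :=
  fun i => segmentSet n (s.arr 1) (s.arr 2) i

/-- The cliques, stored as lists in the arrays `3` and `4`; register `0` holds their number. -/
def State.cliques (s : State) (n : ℕ) : Fin (s.reg 0) → Finset (Fin n) :=
  fun a => segmentSet n (s.arr 3) (s.arr 4) a

/-- The tree on the cliques, stored as the array of parents `5`. -/
def State.cliqueTree (s : State) : SimpleGraph (Fin (s.reg 0)) :=
  parentGraph (s.reg 0) (s.arr 5)

end RAM

/-!
The random choices of the program are exactly those of the procedure, made through data structures
that allow each of them, and all of the bookkeeping after it, to take a bounded number of steps.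

**Growing a subtree in constant time per node.** The list of neighbours of a node `y` of the host
tree is kept in row `y` of a matrix, and a second matrix holds the place of each neighbour in that
list. While a subtree `S` grows, the neighbours of `y ∈ S` that lie outside of `S` form a prefix of
row `y`, and the nodes of `S` with a nonempty prefix form a list. So both random choices of a step
are a random position in a prefix. When `z` joins `S` through `y`, it has no neighbour in `S` other
than `y` (`RootedAt.joined_unique`), so that only the rows of `y` and `z` change, by one exchange of
two entries each (`Rows.swap`, `Growth.step`). After the subtree is complete its nodes get back
their full rows.

**Cliques.** Every node has a smaller number than its children, so the topmost node of a subtree is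
its least node. Two subtrees meet if and only if one of them contains the topmost node of the other
(`SubtreeFamily.adj_iff_top`). This gives chordality, by looking at the greatest topmost node on a
cycle, the Helly property (`SubtreeFamily.exists_common`), and the adjacency lists: the neighbours
of `i` are the other elements of the bag of its topmost node, and the subtrees whose topmost node is
one of the other nodes of `i` (`SubtreeFamily.mem_neighborList`). By the Helly property the maximal
cliques are the maximal bags, where the bag of a node is the set of the subtrees that contain it.
The host tree with its bags is contracted to a clique tree in a single pass from the root downwards:
the bag of the next node `v` is contained in the clique that covers its parent, or contains that
clique and replaces it, or becomes a new clique that is attached to it (`Contraction.skip`,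
`Contraction.replace`, `Contraction.extend`). Which case applies is read off from the sizes of the
bags (`Generated.size_sub_tcnt`). The total size of all bags is the total size of the subtrees,
which is at least `n`, and this bounds the time for all parts.

**The law of the output.** `Sim` couples the outcome of a program with a random experiment, in such
a way that the result of the experiment can be read off from the final state; its rules for
sequences and loops turn a program into the corresponding sequence of random experiments. Parts
without random choices are treated with `Runs` and the weakest precondition `wp`. Both keep track of
the number of steps, and `Agree` says which part of the memory is left alone.

**The memory.** Matrices have `n` columns and are stored row by row. The arrays hold
* `0`: the parents in the host tree; `1`, `2`: the lists of the nodes of the subtrees; `3`, `4`: the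
  cliques; `5`: the parents in the clique tree; `6`, `7`: the adjacency lists;
* `8`: the degrees in the host tree; `9`: the lengths of the prefixes of outside neighbours; `10`:
  the matrix of neighbours; `11`: the matrix of their places; `12`: the list of the nodes of the
  current subtree that have outside neighbours (its length is in register `16`);
* `13`, `14`: sizes of the bags, and the matrix of the bags; `15`: topmost nodes; `16`, `17`: for
  each node the number and the list of the subtrees with that topmost node;
* `18`: the clique that covers the bag of a node; `19`: the node whose bag is a given clique; `20`:
  the multiples of `n`, since there is no multiplication.

Registers `2`, `30` and `31` hold `n`, `0` and `1`; register `10` is the number of complete subtrees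
and register `11` the number of used cells of array `2`.
-/

namespace RAM

/-! ### Reasoning about programs -/

theorem bind_congr_support {α β : Type*} {μ : PMF α} {f g : α → PMF β}
    (h : ∀ a ∈ μ.support, f a = g a) : μ.bind f = μ.bind g := by
  ext b
  simp only [PMF.bind_apply]
  refine tsum_congr fun a => ?_
  by_cases ha : a ∈ μ.support
  · rw [h a ha]
  · rw [(PMF.apply_eq_zero_iff μ a).2 ha, zero_mul, zero_mul]

/-- The law of the outcome of a program is determined by the start state. -/
theorem Exec.unique {W : ℕ} {c : Cmd} {s : State} {μ ν : PMF (State × ℕ)} (h : Exec W c s μ)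
    (h' : Exec W c s ν) : μ = ν := by
  induction h generalizing ν with
  | skip | const | add | sub | load | store | rand => cases h'; rfl
  | seq c d s μ ρ h k ih ihk =>
    cases h' with
    | seq _ _ _ μ' ρ' h' k' =>
      obtain rfl := ih h'
      refine bind_congr_support fun p hp => ?_
      rw [ihk p hp (k' p hp)]
  | branchTrue b c d s μ hb h ih =>
    cases h' with
    | branchTrue _ _ _ _ _ _ h' => rw [ih h']
    | branchFalse _ _ _ _ _ hb' => exact absurd hb hb'
  | branchFalse b c d s μ hb h ih =>
    cases h' with
    | branchTrue _ _ _ _ _ hb' => exact absurd hb' hb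
    | branchFalse _ _ _ _ _ _ h' => rw [ih h']
  | loopFalse b c s hb =>
    cases h' with
    | loopFalse => rfl
    | loopTrue _ _ _ _ _ hb' => exact absurd hb' hb
  | loopTrue b c s μ ρ hb h k ih ihk =>
    cases h' with
    | loopFalse _ _ _ hb' => exact absurd hb hb'
    | loopTrue _ _ _ μ' ρ' _ h' k' =>
      obtain rfl := ih h'
      refine bind_congr_support fun p hp => ?_
      rw [ihk p hp (k' p hp)]

/-- Whether the text of a program has an instruction that writes to register `x`. -/
def Cmd.writesReg (x : ℕ) : Cmd → Bool
  | .skip => false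
  | .const y _ => y == x
  | .add y _ _ => y == x
  | .sub y _ _ => y == x
  | .load y _ _ => y == x
  | .store _ _ _ => false
  | .rand y _ _ => y == x
  | .seq c d => c.writesReg x || d.writesReg x
  | .branch _ c d => c.writesReg x || d.writesReg x
  | .loop _ c => c.writesReg x

/-- Whether the text of a program has an instruction that writes to array `a`. -/
def Cmd.writesArr (a : ℕ) : Cmd → Bool
  | .store b _ _ => b == a
  | .seq c d => c.writesArr a || d.writesArr a
  | .branch _ c d => c.writesArr a || d.writesArr a
  | .loop _ c => c.writesArr a
  | _ => false

/-- The states `s` and `s'` agree on all registers and arrays that the program `c` never writes. -/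
def Agree (c : Cmd) (s s' : State) : Prop :=
  (∀ x, c.writesReg x = false → s'.reg x = s.reg x) ∧
    ∀ a, c.writesArr a = false → s'.arr a = s.arr a

theorem Agree.refl (c : Cmd) (s : State) : Agree c s s := ⟨fun _ _ => rfl, fun _ _ => rfl⟩

theorem Agree.trans {c : Cmd} {s s' s'' : State} (h : Agree c s s') (h' : Agree c s' s'') :
    Agree c s s'' :=
  ⟨fun x hx => (h'.1 x hx).trans (h.1 x hx), fun a ha => (h'.2 a ha).trans (h.2 a ha)⟩

theorem Exec.agree {W : ℕ} {c : Cmd} {s : State} {μ : PMF (State × ℕ)} (h : Exec W c s μ) :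
    ∀ p ∈ μ.support, Agree c s p.1 := by
  induction h with
  | skip => simp [Agree]
  | const | add | sub | load =>
    simp only [PMF.support_pure, Set.mem_singleton_iff, forall_eq]
    refine ⟨fun x hx => ?_, fun _ _ => rfl⟩
    simp only [Cmd.writesReg, beq_eq_false_iff_ne] at hx
    simp [State.setReg, Function.update, hx.symm]
  | store =>
    simp only [PMF.support_pure, Set.mem_singleton_iff, forall_eq]
    refine ⟨fun _ _ => rfl, fun x hx => ?_⟩
    simp only [Cmd.writesArr, beq_eq_false_iff_ne] at hx
    simp [State.setArr, Function.update, hx.symm]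
  | rand s x y z h =>
    intro p hp
    simp only [PMF.support_map, Set.mem_image] at hp
    obtain ⟨v, -, rfl⟩ := hp
    refine ⟨fun x hx => ?_, fun _ _ => rfl⟩
    simp only [Cmd.writesReg, beq_eq_false_iff_ne] at hx
    simp [State.setReg, Function.update, hx.symm]
  | seq c d s μ ν h k ih ihk =>
    intro p hp
    simp only [andThen, PMF.mem_support_bind_iff, PMF.support_map, Set.mem_image] at hp
    obtain ⟨q, hq, r, hr, rfl⟩ := hp
    have h1 := ih q hq
    have h2 := ihk q hq r hr
    simp only [Agree, Cmd.writesReg, Cmd.writesArr, Bool.or_eq_false_iff] at h1 h2 ⊢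
    exact ⟨fun x hx => (h2.1 x hx.2).trans (h1.1 x hx.1),
      fun x hx => (h2.2 x hx.2).trans (h1.2 x hx.1)⟩
  | branchTrue b c d s μ hb h ih =>
    intro p hp
    simp only [PMF.support_map, Set.mem_image] at hp
    obtain ⟨q, hq, rfl⟩ := hp
    have h1 := ih q hq
    simp only [Agree, Cmd.writesReg, Cmd.writesArr, Bool.or_eq_false_iff] at h1 ⊢
    exact ⟨fun x hx => h1.1 x hx.1, fun x hx => h1.2 x hx.1⟩
  | branchFalse b c d s μ hb h ih =>
    intro p hp
    simp only [PMF.support_map, Set.mem_image] at hp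
    obtain ⟨q, hq, rfl⟩ := hp
    have h1 := ih q hq
    simp only [Agree, Cmd.writesReg, Cmd.writesArr, Bool.or_eq_false_iff] at h1 ⊢
    exact ⟨fun x hx => h1.1 x hx.2, fun x hx => h1.2 x hx.2⟩
  | loopFalse => simp [Agree]
  | loopTrue b c s μ ν hb h k ih ihk =>
    intro p hp
    simp only [andThen, PMF.mem_support_bind_iff, PMF.support_map, Set.mem_image] at hp
    obtain ⟨q, hq, r, hr, rfl⟩ := hp
    exact (ih q hq).trans (ihk q hq r hr)

/-- Total correctness of a run without random choices: `c` started in `s` has a single outcome,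
and its final state and number of steps satisfy `Q`. -/
def Runs (W : ℕ) (c : Cmd) (s : State) (Q : State → ℕ → Prop) : Prop :=
  ∃ s' t, Exec W c s (PMF.pure (s', t)) ∧ Q s' t

theorem Runs.mono {W : ℕ} {c : Cmd} {s : State} {Q R : State → ℕ → Prop} (h : Runs W c s Q)
    (hQR : ∀ s' t, Agree c s s' → Q s' t → R s' t) : Runs W c s R := by
  obtain ⟨s', t, h, hQ⟩ := h
  exact ⟨s', t, h, hQR _ _ (h.agree (s', t) (by simp)) hQ⟩

theorem Runs.seq {W : ℕ} {c d : Cmd} {s : State} {Q : State → ℕ → Prop}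
    (h : Runs W c s fun s' t => Runs W d s' fun s'' t' => Q s'' (t + t')) :
    Runs W (.seq c d) s Q := by
  obtain ⟨s', t, h, s'', t', h', hQ⟩ := h
  refine ⟨s'', t + t', ?_, hQ⟩
  have := Exec.seq c d s _ (fun _ => PMF.pure (s'', t')) h (by
    rintro p hp
    obtain rfl : p = (s', t) := by simpa using hp
    exact h')
  simpa [andThen, PMF.pure_bind, PMF.pure_map] using this

/-- Weakest preconditions for straight-line code; loops (and random choices) are left to the rules
for `Runs`. -/
def wp (W : ℕ) : Cmd → (State → ℕ → Prop) → State → Prop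
  | .skip, Q, s => Q s 1
  | .const x c, Q, s => c ≤ W ∧ Q (s.setReg x c) 1
  | .add x y z, Q, s => s.reg y + s.reg z ≤ W ∧ Q (s.setReg x (s.reg y + s.reg z)) 1
  | .sub x y z, Q, s => Q (s.setReg x (s.reg y - s.reg z)) 1
  | .load x a y, Q, s => Q (s.setReg x (s.arr a (s.reg y))) 1
  | .store a x y, Q, s => Q (s.setArr a (s.reg x) (s.reg y)) 1
  | .seq c d, Q, s => wp W c (fun s' t => wp W d (fun s'' t' => Q s'' (t + t')) s') s
  | .branch b c d, Q, s =>
      (b.Holds s → wp W c (fun s' t => Q s' (t + 1)) s) ∧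
        (¬ b.Holds s → wp W d (fun s' t => Q s' (t + 1)) s)
  | c, Q, s => Runs W c s Q

theorem Runs.of_wp {W : ℕ} {c : Cmd} {s : State} {Q : State → ℕ → Prop} (h : wp W c Q s) :
    Runs W c s Q := by
  induction c generalizing s Q with
  | skip => exact ⟨_, _, .skip _, h⟩
  | const x c => exact ⟨_, _, .const _ _ _ h.1, h.2⟩
  | add x y z => exact ⟨_, _, .add _ _ _ _ h.1, h.2⟩
  | sub x y z => exact ⟨_, _, .sub _ _ _ _, h⟩
  | load x a y => exact ⟨_, _, .load _ _ _ _, h⟩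
  | store a x y => exact ⟨_, _, .store _ _ _ _, h⟩
  | rand => exact h
  | loop => exact h
  | seq c d ihc ihd => exact Runs.seq ((ihc h).mono fun s' t _ h' => ihd h')
  | branch b c d ihc ihd =>
    by_cases hb : b.Holds s
    · obtain ⟨s', t, h', hQ⟩ := ihc (h.1 hb)
      exact ⟨s', t + 1, by simpa [PMF.pure_map] using Exec.branchTrue b c d s _ hb h', hQ⟩
    · obtain ⟨s', t, h', hQ⟩ := ihd (h.2 hb)
      exact ⟨s', t + 1, by simpa [PMF.pure_map] using Exec.branchFalse b c d s _ hb h', hQ⟩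

/-- Loop rule for runs without random choices. The invariant `I j s T` speaks about the state `s`
before the `j`-th round and about the number `T` of steps made so far; there are `m` rounds. -/
theorem Runs.loop {W : ℕ} {b : Test} {c : Cmd} {s : State} (m : ℕ) (I : ℕ → State → ℕ → Prop)
    (h0 : I 0 s 0)
    (hstep : ∀ j s' T, j < m → Agree c s s' → I j s' T →
      b.Holds s' ∧ Runs W c s' fun s'' t => I (j + 1) s'' (T + t + 1))
    (hend : ∀ s' T, Agree c s s' → I m s' T → ¬ b.Holds s') :
    Runs W (.loop b c) s fun s' t => ∃ T, t = T + 1 ∧ I m s' T := by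
  suffices H : ∀ d j s' T, j + d = m → Agree c s s' → I j s' T →
      Runs W (.loop b c) s' fun s'' t => ∃ T', t = T' + 1 ∧ I m s'' (T + T') by
    simpa using H m 0 s 0 (by simp) (.refl _ _) h0
  intro d
  induction d with
  | zero =>
    rintro j s' T rfl hA hI
    exact ⟨s', 1, .loopFalse _ _ _ (hend _ _ hA hI), 0, rfl, hI⟩
  | succ d ih =>
    rintro j s' T hj hA hI
    obtain ⟨hb, s1, t1, h1, hI1⟩ := hstep j s' T (by omega) hA hI
    obtain ⟨s2, t2, h2, T', rfl, hI2⟩ :=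
      ih (j + 1) s1 _ (by omega) (hA.trans (h1.agree (s1, t1) (by simp))) hI1
    refine ⟨s2, t1 + (T' + 1) + 1, ?_, t1 + T' + 1, by omega, ?_⟩
    · have := Exec.loopTrue b c s' _ (fun _ => PMF.pure (s2, T' + 1)) hb h1 (by
        rintro p hp
        obtain rfl : p = (s1, t1) := by simpa using hp
        exact h2)
      simpa [andThen, PMF.pure_bind, PMF.pure_map] using this
    · convert hI2 using 1; omega

/-- `Sim W c s ν Q`: the program `c`, started in `s`, simulates a random experiment with law `ν`.
There is a coupling of `ν` with the outcome of `c` under which the result of the experiment, the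
final state and the number of steps always satisfy `Q`. -/
def Sim {α : Type} (W : ℕ) (c : Cmd) (s : State) (ν : PMF α) (Q : α → State → ℕ → Prop) : Prop :=
  ∃ κ : PMF (α × State × ℕ), Exec W c s (κ.map Prod.snd) ∧ κ.map Prod.fst = ν ∧
    ∀ p ∈ κ.support, Q p.1 p.2.1 p.2.2

theorem Sim.mono {α : Type} {W : ℕ} {c : Cmd} {s : State} {ν : PMF α}
    {Q R : α → State → ℕ → Prop} (h : Sim W c s ν Q)
    (hQR : ∀ a s' t, a ∈ ν.support → Agree c s s' → Q a s' t → R a s' t) : Sim W c s ν R := by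
  obtain ⟨κ, h, rfl, hQ⟩ := h
  refine ⟨κ, h, rfl, fun p hp => hQR _ _ _ ?_ ?_ (hQ p hp)⟩
  · rw [PMF.support_map]; exact ⟨p, hp, rfl⟩
  · exact h.agree p.2 (by rw [PMF.support_map]; exact ⟨p, hp, rfl⟩)

theorem Sim.map {α β : Type} {W : ℕ} {c : Cmd} {s : State} {ν : PMF α} (f : α → β)
    {Q : α → State → ℕ → Prop} {R : β → State → ℕ → Prop} (h : Sim W c s ν Q)
    (hQR : ∀ a s' t, Agree c s s' → Q a s' t → R (f a) s' t) : Sim W c s (ν.map f) R := by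
  obtain ⟨κ, h, rfl, hQ⟩ := h
  refine ⟨κ.map fun p => (f p.1, p.2), ?_, ?_, ?_⟩
  · rw [PMF.map_comp]; exact h
  · rw [PMF.map_comp, PMF.map_comp]; rfl
  · intro p hp
    rw [PMF.support_map] at hp
    obtain ⟨q, hq, rfl⟩ := hp
    exact hQR _ _ _ (h.agree q.2 (by rw [PMF.support_map]; exact ⟨q, hq, rfl⟩)) (hQ q hq)

theorem Runs.sim {α : Type} {W : ℕ} {c : Cmd} {s : State} {a : α} {Q : α → State → ℕ → Prop}
    (h : Runs W c s (Q a)) : Sim W c s (PMF.pure a) Q := by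
  obtain ⟨s', t, h, hQ⟩ := h
  refine ⟨PMF.pure (a, s', t), by rwa [PMF.pure_map], by rw [PMF.pure_map], ?_⟩
  simpa using hQ

/-- Couplings for two programs in a row give a coupling for their composition. Since the law of the
second program depends on the intermediate state only, `Exec.unique` is needed here. -/
theorem Sim.exists_andThen {α β : Type} {W : ℕ} {c d : Cmd} {s : State} {ν : PMF α}
    {ν' : α → PMF β} {Q : α → State → ℕ → Prop} {R : β → State → ℕ → Prop} (e : ℕ)
    (h : Sim W c s ν Q)
    (h' : ∀ a s' t, Q a s' t → Agree c s s' →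
      Sim W d s' (ν' a) fun b s'' t' => R b s'' (t + t' + e)) :
    ∃ μ ρ, Exec W c s μ ∧ (∀ p ∈ μ.support, Exec W d p.1 (ρ p)) ∧
      ∃ κ : PMF (β × State × ℕ), κ.map Prod.snd = andThen μ ρ e ∧ κ.map Prod.fst = ν.bind ν' ∧
        ∀ p ∈ κ.support, R p.1 p.2.1 p.2.2 := by
  classical
  obtain ⟨κ, hE, rfl, hQ⟩ := h
  have hA : ∀ p ∈ κ.support, Agree c s p.2.1 := fun p hp =>
    hE.agree p.2 (by rw [PMF.support_map]; exact ⟨p, hp, rfl⟩)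
  have key : ∀ p : α × State × ℕ, ∃ κ' : PMF (β × State × ℕ), p ∈ κ.support →
      (Exec W d p.2.1 (κ'.map Prod.snd) ∧ κ'.map Prod.fst = ν' p.1 ∧
        ∀ q ∈ κ'.support, R q.1 q.2.1 (p.2.2 + q.2.2 + e)) := by
    intro p
    by_cases hp : p ∈ κ.support
    · obtain ⟨κ', h1, h2, h3⟩ := h' p.1 p.2.1 p.2.2 (hQ p hp) (hA p hp)
      exact ⟨κ', fun _ => ⟨h1, h2, h3⟩⟩
    · exact ⟨(ν' p.1).map fun b => (b, p.2), fun hp' => absurd hp' hp⟩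
  choose κ' hκ' using key
  let ρ : State × ℕ → PMF (State × ℕ) := fun q =>
    if h : ∃ a, (a, q) ∈ κ.support then (κ' (h.choose, q)).map Prod.snd else PMF.pure q
  have hρ : ∀ p ∈ κ.support, ρ p.2 = (κ' p).map Prod.snd := by
    intro p hp
    have hex : ∃ a, (a, p.2) ∈ κ.support := ⟨p.1, hp⟩
    simp only [ρ, dif_pos hex]
    exact (hκ' _ hex.choose_spec).1.unique (hκ' p hp).1
  refine ⟨_, ρ, hE, ?_, κ.bind fun p => (κ' p).map fun r => (r.1, r.2.1, p.2.2 + r.2.2 + e),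
    ?_, ?_, ?_⟩
  · intro q hq
    rw [PMF.support_map] at hq
    obtain ⟨p, hp, rfl⟩ := hq
    rw [hρ p hp]
    exact (hκ' p hp).1
  · rw [andThen, PMF.map_bind, PMF.bind_map]
    refine bind_congr_support fun p hp => ?_
    simp only [Function.comp_apply]
    rw [hρ p hp, PMF.map_comp, PMF.map_comp]
    rfl
  · rw [PMF.map_bind, PMF.bind_map]
    refine bind_congr_support fun p hp => ?_
    rw [PMF.map_comp, Function.comp_apply, ← (hκ' p hp).2.1]
    rfl
  · intro q hq
    simp only [PMF.mem_support_bind_iff, PMF.support_map, Set.mem_image] at hq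
    obtain ⟨p, hp, r, hr, rfl⟩ := hq
    exact (hκ' p hp).2.2 r hr

theorem Sim.seq {α β : Type} {W : ℕ} {c d : Cmd} {s : State} {ν : PMF α}
    {ν' : α → PMF β} {Q : α → State → ℕ → Prop} {R : β → State → ℕ → Prop}
    (h : Sim W c s ν Q)
    (h' : ∀ a s' t, Q a s' t → Agree c s s' →
      Sim W d s' (ν' a) fun b s'' t' => R b s'' (t + t')) :
    Sim W (.seq c d) s (ν.bind ν') R := by
  obtain ⟨μ, ρ, h1, h2, κ, h3, h4, h5⟩ := Sim.exists_andThen 0 h h'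
  exact ⟨κ, h3 ▸ .seq _ _ _ _ _ h1 h2, h4, h5⟩

theorem Runs.seq_sim {β : Type} {W : ℕ} {c d : Cmd} {s : State} {ν : PMF β}
    {R : β → State → ℕ → Prop}
    (h : Runs W c s fun s' t => Sim W d s' ν fun b s'' t' => R b s'' (t + t')) :
    Sim W (.seq c d) s ν R := by
  have := Sim.seq (ν' := fun _ : Unit => ν) (R := R)
    (Runs.sim (a := ()) (Q := fun _ s' t => Sim W d s' ν fun b s'' t' => R b s'' (t + t')) h)
    (fun _ _ _ h _ => h)
  rwa [PMF.pure_bind] at this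

theorem Sim.seq_runs {β : Type} {W : ℕ} {c d : Cmd} {s : State} {ν : PMF β}
    {R : β → State → ℕ → Prop}
    (h : Sim W c s ν fun b s' t => Runs W d s' fun s'' t' => R b s'' (t + t')) :
    Sim W (.seq c d) s ν R := by
  have := Sim.seq (ν' := PMF.pure) (R := R) h (fun b _ _ h _ => h.sim)
  rwa [PMF.bind_pure] at this

theorem map_uniformOfFinset {α β : Type*} {A : Finset α} {B : Finset β} (hA : A.Nonempty)
    (hB : B.Nonempty) (f : α → β) (hf : Set.BijOn f A B) :
    (PMF.uniformOfFinset A hA).map f = PMF.uniformOfFinset B hB := by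
  classical
  have hcard : A.card = B.card := by
    rw [← Finset.card_image_of_injOn hf.injOn]
    congr 1
    exact_mod_cast hf.image_eq
  ext b
  rw [PMF.map_apply]
  by_cases hb : b ∈ B
  · obtain ⟨a, ha, rfl⟩ := hf.surjOn hb
    rw [tsum_eq_single a, if_pos rfl, PMF.uniformOfFinset_apply_of_mem hA ha,
      PMF.uniformOfFinset_apply_of_mem hB hb, hcard]
    intro a' ha'
    split_ifs with h
    · refine PMF.uniformOfFinset_apply_of_notMem hA fun h' => ha' ?_
      exact hf.injOn h' ha h.symm
    · rfl
  · rw [PMF.uniformOfFinset_apply_of_notMem hB hb, ENNReal.tsum_eq_zero]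
    intro a
    split_ifs with h
    · refine PMF.uniformOfFinset_apply_of_notMem hA fun h' => hb ?_
      rw [h]; exact hf.mapsTo h'
    · rfl

theorem Sim.rand {α : Type} {W : ℕ} {s : State} {x y z : ℕ} {A : Finset α} (hA : A.Nonempty)
    (f : ℕ → α) (h : s.reg y ≤ s.reg z) (hf : Set.BijOn f (Set.Icc (s.reg y) (s.reg z)) A) :
    Sim W (.rand x y z) s (PMF.uniformOfFinset A hA) fun a s' t =>
      t = 1 ∧ ∃ v, s.reg y ≤ v ∧ v ≤ s.reg z ∧ f v = a ∧ s' = s.setReg x v := by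
  refine ⟨(PMF.uniformOfFinset (Finset.Icc (s.reg y) (s.reg z)) (Finset.nonempty_Icc.2 h)).map
    fun v => (f v, s.setReg x v, 1), ?_, ?_, ?_⟩
  · rw [PMF.map_comp]; exact .rand s x y z h
  · rw [PMF.map_comp]
    exact map_uniformOfFinset _ hA f (by simpa using hf)
  · intro p hp
    simp only [PMF.support_map, Set.mem_image, PMF.mem_support_uniformOfFinset_iff,
      Finset.mem_Icc] at hp
    obtain ⟨v, hv, rfl⟩ := hp
    exact ⟨rfl, v, hv.1, hv.2, rfl, rfl⟩

/-- The law of the result of the random steps `step j`, …, `step (j + d - 1)` in a row. -/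
noncomputable def iterLaw {α : Type} (step : ℕ → α → PMF α) : ℕ → ℕ → α → PMF α
  | _, 0, a => PMF.pure a
  | j, d + 1, a => (step j a).bind (iterLaw step (j + 1) d)

theorem iterLaw_succ {α : Type} (step : ℕ → α → PMF α) (j d : ℕ) (a : α) :
    iterLaw step j (d + 1) a = (iterLaw step j d a).bind (step (j + d)) := by
  induction d generalizing j a with
  | zero =>
    show (step j a).bind (fun a => PMF.pure a) = (PMF.pure a).bind _
    rw [PMF.bind_pure, PMF.pure_bind]; rfl
  | succ d ih =>
    rw [iterLaw]
    conv_rhs => rw [iterLaw]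
    rw [PMF.bind_bind]
    congr 1
    funext b
    rw [ih, show j + 1 + d = j + (d + 1) by omega]

/-- Loop rule for programs with random choices; compare `Runs.loop`. -/
theorem Sim.loop {α : Type} {W : ℕ} {b : Test} {c : Cmd} {s : State} (step : ℕ → α → PMF α)
    (m : ℕ) (a₀ : α) (I : ℕ → α → State → ℕ → Prop) (h0 : I 0 a₀ s 0)
    (hstep : ∀ j a s' T, j < m → Agree c s s' → I j a s' T →
      b.Holds s' ∧ Sim W c s' (step j a) fun a' s'' t => I (j + 1) a' s'' (T + t + 1))
    (hend : ∀ a s' T, Agree c s s' → I m a s' T → ¬ b.Holds s') :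
    Sim W (.loop b c) s (iterLaw step 0 m a₀) fun a s' t => ∃ T, t = T + 1 ∧ I m a s' T := by
  suffices H : ∀ d j a s' T, j + d = m → Agree c s s' → I j a s' T →
      Sim W (.loop b c) s' (iterLaw step j d a) fun a s'' t => ∃ T', t = T' + 1 ∧
        I m a s'' (T + T') by
    simpa using H m 0 a₀ s 0 (by simp) (.refl _ _) h0
  intro d
  induction d with
  | zero =>
    rintro j a s' T rfl hA hI
    exact Runs.sim ⟨s', 1, .loopFalse _ _ _ (hend _ _ _ hA hI), 0, rfl, hI⟩
  | succ d ih =>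
    rintro j a s' T hj hA hI
    obtain ⟨hb, h⟩ := hstep j a s' T (by omega) hA hI
    obtain ⟨μ, ρ, h1, h2, κ, h3, h4, h5⟩ := Sim.exists_andThen (d := .loop b c)
      (ν' := iterLaw step (j + 1) d)
      (R := fun a s'' t => ∃ T', t = T' + 1 ∧ I m a s'' (T + T')) 1 h (by
        intro a' s'' t hI' hA'
        refine (ih (j + 1) a' s'' _ (by omega) (hA.trans hA') hI').mono ?_
        rintro a'' s3 t3 - - ⟨T', rfl, hI3⟩
        exact ⟨t + T' + 1, by omega, by convert hI3 using 1; omega⟩)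
    exact ⟨κ, h3 ▸ .loopTrue _ _ _ _ _ hb h1 h2, h4, h5⟩

/-- The commands of a list, one after the other. -/
def block : List Cmd → Cmd
  | [] => .skip
  | c :: l => .seq c (block l)

@[simp] theorem State.setReg_reg (s : State) (x v y : ℕ) :
    (s.setReg x v).reg y = if y = x then v else s.reg y := by
  simp [State.setReg, Function.update_apply]

@[simp] theorem State.setReg_arr (s : State) (x v : ℕ) : (s.setReg x v).arr = s.arr := rfl

@[simp] theorem State.setArr_reg (s : State) (a i v : ℕ) : (s.setArr a i v).reg = s.reg := rfl

@[simp] theorem State.setArr_arr (s : State) (a i v b : ℕ) :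
    (s.setArr a i v).arr b = if b = a then Function.update (s.arr a) i v else s.arr b := by
  by_cases h : b = a
  · subst h; simp [State.setArr]
  · simp [State.setArr, h]

/-! ### Trees given by parents -/

/-- `par` is an array of parents for a tree on the nodes `0, …, m - 1` with root `0`. -/
def IsParent (m : ℕ) (par : ℕ → ℕ) : Prop := ∀ v, 0 < v → v < m → par v < v

/-- Adjacency in the tree with the parents `par`. -/
def Joined (par : ℕ → ℕ) (u v : ℕ) : Prop := (0 < v ∧ par v = u) ∨ (0 < u ∧ par u = v)

/-- The node set `S` is a subtree with topmost node `t`: it is closed under taking parents, except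
at `t`. -/
def RootedAt (par : ℕ → ℕ) (S : Set ℕ) (t : ℕ) : Prop :=
  t ∈ S ∧ ∀ a ∈ S, a ≠ t → 0 < a ∧ par a ∈ S

theorem Joined.symm {par : ℕ → ℕ} {u v : ℕ} (h : Joined par u v) : Joined par v u := Or.symm h

theorem RootedAt.le {m : ℕ} {par : ℕ → ℕ} {S : Set ℕ} {t : ℕ} (h : RootedAt par S t)
    (hp : IsParent m par) (hS : ∀ a ∈ S, a < m) : ∀ a ∈ S, t ≤ a := by
  intro a
  induction a using Nat.strong_induction_on with
  | _ a ih =>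
    intro ha
    by_cases hat : a = t
    · omega
    · obtain ⟨h0, h1⟩ := h.2 a ha hat
      have h2 := hp a h0 (hS a ha)
      have := ih _ h2 h1
      omega

theorem parentGraph_adj {m : ℕ} {par : ℕ → ℕ} (hp : IsParent m par) {u v : Fin m} :
    (parentGraph m par).Adj u v ↔ Joined par u v := by
  simp only [parentGraph, SimpleGraph.fromRel_adj, Joined]
  constructor
  · exact fun h => h.2
  · intro h
    refine ⟨?_, h⟩
    rintro rfl
    rcases h with h | h <;> have := hp u h.1 u.2 <;> omega

theorem RootedAt.connected {m : ℕ} {par : ℕ → ℕ} (hp : IsParent m par) {S : Set (Fin m)} {t : ℕ}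
    (h : RootedAt par (Fin.val '' S) t) : ((parentGraph m par).induce S).Connected := by
  obtain ⟨⟨t', ht', rfl⟩, h2⟩ := h
  have key : ∀ d : ℕ, ∀ a : S, (a : Fin m).val = d →
      ((parentGraph m par).induce S).Reachable a ⟨t', ht'⟩ := by
    intro d
    induction d using Nat.strong_induction_on with
    | _ d ih =>
      rintro ⟨a, ha⟩ rfl
      by_cases hat : (a : ℕ) = t'
      · obtain rfl := Fin.ext hat
        exact .refl _
      · obtain ⟨h0, b, hb, hbp⟩ := h2 a ⟨a, ha, rfl⟩ hat
        have hlt := hp a h0 a.2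
        refine SimpleGraph.Reachable.trans ?_ (ih b (by simp; omega) ⟨b, hb⟩ rfl)
        refine SimpleGraph.Adj.reachable ?_
        rw [SimpleGraph.induce_adj]
        exact (parentGraph_adj hp).2 (Or.inr ⟨h0, hbp.symm⟩)
  have : Nonempty S := ⟨⟨t', ht'⟩⟩
  exact ⟨fun a b => (key _ a rfl).trans (key _ b rfl).symm⟩

theorem parentGraph_isTree {m : ℕ} {par : ℕ → ℕ} (hm : 0 < m) (hp : IsParent m par) :
    (parentGraph m par).IsTree := by
  classical
  rw [SimpleGraph.isTree_iff_connected_and_card]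
  constructor
  · have h : RootedAt par (Fin.val '' (Set.univ : Set (Fin m))) 0 := by
      refine ⟨⟨⟨0, hm⟩, trivial, rfl⟩, ?_⟩
      rintro _ ⟨a, -, rfl⟩ ha
      have h0 : 0 < (a : ℕ) := by omega
      exact ⟨h0, ⟨par a, (hp a h0 a.2).trans a.2⟩, trivial, rfl⟩
    have h' := h.connected hp
    exact (SimpleGraph.induceUnivIso _).connected_iff.1 h'
  · let f : Fin (m - 1) → Sym2 (Fin m) := fun i =>
      s(⟨i + 1, by omega⟩, ⟨par (i + 1), by have := hp (i + 1) (by omega) (by omega); omega⟩)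
    have hf : Function.Injective f := by
      intro i j hij
      have hi := hp (i + 1) (by omega) (by omega)
      have hj := hp (j + 1) (by omega) (by omega)
      simp only [f, Sym2.eq_iff, Fin.mk.injEq] at hij
      ext
      omega
    have hr : Set.range f = (parentGraph m par).edgeSet := by
      ext e
      induction e with
      | _ u v =>
        rw [SimpleGraph.mem_edgeSet, parentGraph_adj hp]
        constructor
        · rintro ⟨i, hi⟩
          simp only [f, Sym2.eq_iff] at hi
          rcases hi with ⟨rfl, rfl⟩ | ⟨rfl, rfl⟩
          · exact Or.inr ⟨by simp, rfl⟩
          · exact Or.inl ⟨by simp, rfl⟩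
        · rintro (⟨h0, h1⟩ | ⟨h0, h1⟩)
          · refine ⟨⟨v - 1, by omega⟩, ?_⟩
            simp only [f, Sym2.eq_iff]
            right
            have : (v : ℕ) - 1 + 1 = v := by omega
            constructor <;> ext <;> simp [this, h1]
          · refine ⟨⟨u - 1, by omega⟩, ?_⟩
            simp only [f, Sym2.eq_iff]
            left
            have : (u : ℕ) - 1 + 1 = u := by omega
            constructor <;> ext <;> simp [this, h1]
    rw [← hr, Nat.card_range_of_injective hf]
    simp
    omega

theorem RootedAt.insert {par : ℕ → ℕ} {S : Set ℕ} {t y z : ℕ}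
    (h : RootedAt par S t) (hy : y ∈ S) (hz : z ∉ S)
    (hj : Joined par y z) : ∃ t', RootedAt par (insert z S) t' := by
  rcases hj with ⟨h0, h1⟩ | ⟨h0, h1⟩
  · refine ⟨t, Or.inr h.1, ?_⟩
    rintro a (rfl | ha) hat
    · exact ⟨h0, Or.inr (h1 ▸ hy)⟩
    · exact ⟨(h.2 a ha hat).1, Or.inr (h.2 a ha hat).2⟩
  · have hyt : y = t := by
      by_contra hyt
      exact hz (h1 ▸ (h.2 y hy hyt).2)
    refine ⟨z, Or.inl rfl, ?_⟩
    rintro a (rfl | ha) haz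
    · exact absurd rfl haz
    · by_cases hat : a = t
      · subst hat; subst hyt
        exact ⟨h0, Or.inl h1⟩
      · exact ⟨(h.2 a ha hat).1, Or.inr (h.2 a ha hat).2⟩

/-- A node outside of a subtree has at most one neighbour in it. -/
theorem RootedAt.joined_unique {m : ℕ} {par : ℕ → ℕ} (hp : IsParent m par) {S : Set ℕ}
    {t y y' z : ℕ} (h : RootedAt par S t) (hS : ∀ a ∈ S, a < m) (hzm : z < m) (hy : y ∈ S)
    (hy' : y' ∈ S) (hz : z ∉ S) (hj : Joined par y z) (hj' : Joined par y' z) : y = y' := by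
  have key : ∀ a ∈ S, par a = z → a = t := fun a ha haz => by
    by_contra hat
    exact hz (haz ▸ (h.2 a ha hat).2)
  have hle := h.le hp hS
  rcases hj with ⟨h0, h1⟩ | ⟨h0, h1⟩ <;> rcases hj' with ⟨h0', h1'⟩ | ⟨h0', h1'⟩
  · omega
  · have := key y' hy' h1'
    have := hle y hy
    have := hp y' h0' (hS y' hy')
    have := hp z h0 hzm
    omega
  · have := key y hy h1
    have := hle y' hy'
    have := hp y h0 (hS y hy)
    have := hp z h0' hzm
    omega
  · rw [key y hy h1, key y' hy' h1']

theorem RootedAt.exists_joined {m : ℕ} {par : ℕ → ℕ} (hp : IsParent m par) {S : Set ℕ} {t : ℕ}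
    (h : RootedAt par S t) (hS : ∀ a ∈ S, a < m) (hne : ∃ z < m, z ∉ S) :
    ∃ y ∈ S, ∃ z < m, z ∉ S ∧ Joined par y z := by
  classical
  by_cases ht : t = 0
  · subst ht
    have hz := Nat.find_spec hne
    have hmin := fun k => Nat.find_min hne (m := k)
    set z := Nat.find hne
    have hz0 : 0 < z := by
      rcases Nat.eq_zero_or_pos z with h0 | h0
      · exact absurd (h0 ▸ h.1) hz.2
      · exact h0
    have hlt := hp z hz0 hz.1
    refine ⟨par z, ?_, z, hz.1, hz.2, Or.inl ⟨hz0, rfl⟩⟩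
    by_contra hc
    exact hmin _ hlt ⟨by omega, hc⟩
  · have hlt := hp t (by omega) (hS t h.1)
    have htm := hS t h.1
    refine ⟨t, h.1, par t, by omega, fun hc => ?_, Or.inr ⟨by omega, rfl⟩⟩
    have := h.le hp hS _ hc
    omega

/-! ### Families of subtrees -/

/-- `M 0, …, M (n - 1)` are subtrees of the tree on `0, …, n - 1` with parents `par`, with topmost
nodes `top 0, …, top (n - 1)`. -/
structure SubtreeFamily (n : ℕ) (par : ℕ → ℕ) (M : ℕ → ℕ → Prop) (top : ℕ → ℕ) : Prop where
  pos : 0 < n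
  isParent : IsParent n par
  lt : ∀ i < n, ∀ x, M i x → x < n
  rooted : ∀ i < n, RootedAt par {x | M i x} (top i)

namespace SubtreeFamily

variable {n : ℕ} {par : ℕ → ℕ} {M : ℕ → ℕ → Prop} {top : ℕ → ℕ}

theorem top_le (h : SubtreeFamily n par M top) {i x : ℕ} (hi : i < n) (hx : M i x) :
    top i ≤ x :=
  (h.rooted i hi).le h.isParent (h.lt i hi) x hx

theorem par_mem (h : SubtreeFamily n par M top) {i x : ℕ} (hi : i < n) (hx : M i x)
    (hne : x ≠ top i) : 0 < x ∧ M i (par x) :=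
  (h.rooted i hi).2 x hx hne

theorem top_mem (h : SubtreeFamily n par M top) {i : ℕ} (hi : i < n) : M i (top i) :=
  (h.rooted i hi).1

/-- Of two intersecting subtrees, the one whose topmost node is smaller contains the topmost node of
the other one. -/
theorem mem_top (h : SubtreeFamily n par M top) {i j : ℕ} (hi : i < n) (hj : j < n)
    (hij : top i ≤ top j) (hx : ∃ x, M i x ∧ M j x) : M i (top j) := by
  classical
  have hx1 := Nat.find_spec hx
  have hmin := fun k => Nat.find_min hx (m := k)
  set x := Nat.find hx
  by_cases hxj : x = top j
  · rw [← hxj]; exact hx1.1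
  · have h1 := h.top_le hj hx1.2
    obtain ⟨h0, h2⟩ := h.par_mem hj hx1.2 hxj
    obtain ⟨-, h3⟩ := h.par_mem hi hx1.1 (by omega)
    exact absurd ⟨h3, h2⟩ (hmin _ (h.isParent x h0 (h.lt j hj x hx1.2)))

theorem adj_iff (h : SubtreeFamily n par M top) {F : Fin n → Finset (Fin n)}
    (hF : ∀ i x : Fin n, x ∈ F i ↔ M i x) {i j : Fin n} :
    (ChordalGen.intersectionGraph F).Adj i j ↔ i ≠ j ∧ ∃ x, M i x ∧ M j x := by
  simp only [ChordalGen.intersectionGraph, hF]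
  refine and_congr_right fun _ => ⟨fun ⟨x, hx⟩ => ⟨x, hx⟩, fun ⟨x, hx⟩ => ?_⟩
  exact ⟨⟨x, h.lt i i.2 x hx.1⟩, hx⟩

/-- Adjacency of subtrees can be tested at the topmost nodes. -/
theorem adj_iff_top (h : SubtreeFamily n par M top) {F : Fin n → Finset (Fin n)}
    (hF : ∀ i x : Fin n, x ∈ F i ↔ M i x) {i j : Fin n} :
    (ChordalGen.intersectionGraph F).Adj i j ↔ i ≠ j ∧ (M j (top i) ∨ M i (top j)) := by
  rw [h.adj_iff hF]
  refine and_congr_right fun _ => ⟨fun hx => ?_, ?_⟩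
  · rcases le_total (top i) (top j) with hij | hij
    · exact Or.inr (h.mem_top i.2 j.2 hij hx)
    · exact Or.inl (h.mem_top j.2 i.2 hij (hx.imp fun x hx => hx.symm))
  · rintro (hx | hx)
    · exact ⟨_, h.top_mem i.2, hx⟩
    · exact ⟨_, hx, h.top_mem j.2⟩

/-- In a cycle of the intersection graph, the two neighbours of a vertex whose subtree has the
greatest topmost node both contain that node, so they span a chord. -/
theorem isChordal (h : SubtreeFamily n par M top) {F : Fin n → Finset (Fin n)}
    (hF : ∀ i x : Fin n, x ∈ F i ↔ M i x) :
    ChordalGen.IsChordal (ChordalGen.intersectionGraph F) := by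
  intro m hm
  refine ⟨fun φ => ?_⟩
  obtain ⟨m, rfl⟩ : ∃ m', m = m' + 4 := ⟨m - 4, by omega⟩
  obtain ⟨a, -, ha⟩ := Finset.exists_max_image Finset.univ (fun a : Fin (m + 4) => top (φ a))
    ⟨0, Finset.mem_univ _⟩
  have key : ∀ b, (SimpleGraph.cycleGraph (m + 4)).Adj a b → M (φ b) (top (φ a)) := by
    intro b hb
    have h1 := (h.adj_iff hF).1 (φ.map_rel_iff.2 hb)
    exact h.mem_top (φ b).2 (φ a).2 (ha b (Finset.mem_univ _))
      (h1.2.imp fun x hx => hx.symm)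
  have h1 := key (a + 1) (by simp [SimpleGraph.cycleGraph_adj])
  have h2 := key (a - 1) (by simp [SimpleGraph.cycleGraph_adj])
  have hne : a + 1 ≠ a - 1 := by
    intro hc
    have h3 : (1 : Fin (m + 4)) + 1 = 0 := by
      have : a + 1 - (a - 1) = 0 := by rw [hc, sub_self]
      rw [← this]; abel
    have h4 := congrArg Fin.val h3
    simp only [Fin.val_add, Fin.val_one, Fin.val_zero] at h4
    rw [Nat.mod_eq_of_lt (by omega)] at h4
    omega
  have h5 : (ChordalGen.intersectionGraph F).Adj (φ (a + 1)) (φ (a - 1)) :=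
    (h.adj_iff hF).2 ⟨fun hc => hne (φ.injective hc), _, h1, h2⟩
  have h6 := φ.map_rel_iff.1 h5
  rw [SimpleGraph.cycleGraph_adj] at h6
  rcases h6 with h6 | h6
  · have h7 : (1 : Fin (m + 4)) = 0 := by
      have h8 : a + 1 - (a - 1) = 1 + 1 := by abel
      rw [h8] at h6
      exact add_eq_left.1 h6
    have := congrArg Fin.val h7
    simp at this
  · have h7 : (1 : Fin (m + 4)) + 1 + 1 = 0 := by
      have h8 : a - 1 - (a + 1) = - (1 + 1) := by abel
      rw [h8] at h6
      rw [add_assoc]; exact eq_neg_iff_add_eq_zero.1 h6.symm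
    have := congrArg Fin.val h7
    simp [Fin.val_add] at this
    rw [Nat.mod_eq_of_lt (by omega)] at this
    omega

/-- The Helly property: the subtrees of a clique have a common node. -/
theorem exists_common (h : SubtreeFamily n par M top) {F : Fin n → Finset (Fin n)}
    (hF : ∀ i x : Fin n, x ∈ F i ↔ M i x) {S : Set (Fin n)}
    (hS : (ChordalGen.intersectionGraph F).IsClique S) : ∃ x < n, ∀ i ∈ S, M i x := by
  classical
  rcases S.eq_empty_or_nonempty with rfl | hne
  · exact ⟨0, h.pos, by simp⟩
  obtain ⟨j, hj, hmax⟩ := Set.exists_max_image S (fun i : Fin n => top i) S.toFinite hne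
  refine ⟨top j, h.lt j j.2 _ (h.top_mem j.2), fun i hi => ?_⟩
  by_cases hij : i = j
  · subst hij; exact h.top_mem i.2
  · exact h.mem_top i.2 j.2 (hmax i hi) ((h.adj_iff hF).1 (hS hi hj hij)).2

theorem isClique_bag (h : SubtreeFamily n par M top) {F : Fin n → Finset (Fin n)}
    (hF : ∀ i x : Fin n, x ∈ F i ↔ M i x) (x : ℕ) :
    (ChordalGen.intersectionGraph F).IsClique {i : Fin n | M i x} :=
  fun _ hi _ hj hij => (h.adj_iff hF).2 ⟨hij, x, hi, hj⟩

end SubtreeFamily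

/-! ### The clique tree -/

/-- The state of the contraction of the host tree to a clique tree when its nodes `0, …, m - 1` have
been visited. The bag of a node `x` is `{i | M i x}`. There are `c` cliques; clique `a` is the bag
of the node `hold a`, and the bag of `x` is contained in the clique `rep x`. The cliques form a tree
with the parents `cpar`; by `conn`, those that contain a given `i` have a unique topmost one, so
they are connected. -/
structure Contraction (n : ℕ) (M : ℕ → ℕ → Prop) (m c : ℕ) (rep hold cpar : ℕ → ℕ) : Prop where
  one_le : 1 ≤ c
  le : c ≤ m
  hold_lt : ∀ a < c, hold a < m
  rep_lt : ∀ x < m, rep x < c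
  sub : ∀ x < m, ∀ i < n, M i x → M i (hold (rep x))
  anti : ∀ a < c, ∀ b < c, (∀ i < n, M i (hold a) → M i (hold b)) → a = b
  isParent : IsParent c cpar
  conn : ∀ i < n, ∀ a < c, ∀ b < c, M i (hold a) → M i (hold b) →
    (a = 0 ∨ ¬ M i (hold (cpar a))) → (b = 0 ∨ ¬ M i (hold (cpar b))) → a = b

theorem Contraction.isCliqueTree {n : ℕ} {par : ℕ → ℕ} {M : ℕ → ℕ → Prop} {top : ℕ → ℕ}
    (h : SubtreeFamily n par M top) {F : Fin n → Finset (Fin n)}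
    (hF : ∀ i x : Fin n, x ∈ F i ↔ M i x) {c : ℕ} {rep hold cpar : ℕ → ℕ}
    (hc : Contraction n M n c rep hold cpar) {K : Fin c → Set (Fin n)}
    (hK : ∀ a i, i ∈ K a ↔ M i (hold a)) :
    ChordalGen.IsCliqueTree (ChordalGen.intersectionGraph F) (parentGraph c cpar) K := by
  classical
  have hanti : ∀ a b, K a ≤ K b → a = b := fun a b hab => Fin.ext <|
    hc.anti a a.2 b b.2 fun i hi hM => (hK b ⟨i, hi⟩).1 (hab ((hK a ⟨i, hi⟩).2 hM))
  have hcl : ∀ a, (ChordalGen.intersectionGraph F).IsClique (K a) := fun a => by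
    have : K a = {i : Fin n | M i (hold a)} := by ext i; exact hK a i
    rw [this]; exact h.isClique_bag hF _
  have hsub : ∀ S, (ChordalGen.intersectionGraph F).IsClique S → ∃ a, S ≤ K a := by
    intro S hS
    obtain ⟨x, hx, hxS⟩ := h.exists_common hF hS
    exact ⟨⟨rep x, hc.rep_lt x hx⟩, fun i hi => (hK _ i).2 (hc.sub x hx i i.2 (hxS i hi))⟩
  refine ⟨parentGraph_isTree hc.one_le hc.isParent, fun a b hab => hanti a b hab.le, ?_, ?_⟩
  · intro S
    constructor
    · intro hS
      obtain ⟨a, ha⟩ := hsub S hS.1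
      exact ⟨a, le_antisymm (hS.2 (hcl a) ha) ha⟩
    · rintro ⟨a, rfl⟩
      refine ⟨hcl a, fun S hS hle => ?_⟩
      obtain ⟨b, hb⟩ := hsub S hS
      obtain rfl := hanti a b (hle.trans hb)
      exact hb
  · intro v
    have hex : ∃ a, a < c ∧ M v (hold a) := by
      have h1 := h.top_mem v.2
      have h2 := h.lt v v.2 _ h1
      exact ⟨_, hc.rep_lt _ h2, hc.sub _ h2 v v.2 h1⟩
    have hmin := fun k => Nat.find_min hex (m := k)
    obtain ⟨ht, htM⟩ := Nat.find_spec hex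
    set t := Nat.find hex
    refine RootedAt.connected (t := t) hc.isParent ⟨⟨⟨t, ht⟩, (hK _ _).2 htM, rfl⟩, ?_⟩
    rintro _ ⟨a, ha, rfl⟩ hat
    have haM := (hK a v).1 ha
    have htop : t = 0 ∨ ¬ M v (hold (cpar t)) := by
      rcases Nat.eq_zero_or_pos t with h0 | h0
      · exact Or.inl h0
      · have hlt := hc.isParent t h0 ht
        exact Or.inr fun hM => hmin _ hlt ⟨by omega, hM⟩
    have h1 : ¬ ((a : ℕ) = 0 ∨ ¬ M v (hold (cpar a))) := fun h2 =>
      hat (hc.conn v v.2 a a.2 t ht haM htM h2 htop)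
    push Not at h1
    have h0 : 0 < (a : ℕ) := by omega
    have hlt := hc.isParent a h0 a.2
    exact ⟨h0, ⟨cpar a, by omega⟩, (hK _ _).2 h1.2, rfl⟩

theorem Contraction.start (n : ℕ) (M : ℕ → ℕ → Prop) {rep hold : ℕ → ℕ} (cpar : ℕ → ℕ)
    (hr : rep 0 = 0) (hh : hold 0 = 0) : Contraction n M 1 1 rep hold cpar where
  one_le := le_rfl
  le := le_rfl
  hold_lt a ha := by obtain rfl : a = 0 := by omega
                     omega
  rep_lt x hx := by obtain rfl : x = 0 := by omega
                    omega
  sub x hx i hi hM := by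
    obtain rfl : x = 0 := by omega
    rwa [hr, hh]
  anti a ha b hb _ := by omega
  isParent v hv hv' := by omega
  conn i hi a ha b hb _ _ _ _ := by omega

section step

variable {n : ℕ} {par : ℕ → ℕ} {M : ℕ → ℕ → Prop} {top : ℕ → ℕ} {v c : ℕ} {rep hold cpar : ℕ → ℕ}

/-- A subtree that contains `v` and a node visited before `v` contains the parent of `v`. -/
theorem SubtreeFamily.mem_par_of_lt (h : SubtreeFamily n par M top) {i x : ℕ} (hi : i < n)
    (hv : M i v) (hx : M i x) (hlt : x < v) : M i (par v) := by
  have := h.top_le hi hx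
  exact (h.par_mem hi hv (by omega)).2

/-- If no subtree has `v` as its topmost node, the bag of `v` is contained in that of its parent. -/
theorem Contraction.skip (h : SubtreeFamily n par M top)
    (hc : Contraction n M v c rep hold cpar) (hv0 : 0 < v) (hvn : v < n)
    (hnew : ∀ i < n, top i ≠ v) :
    Contraction n M (v + 1) c (Function.update rep v (rep (par v))) hold cpar := by
  have hlt := h.isParent v hv0 hvn
  refine ⟨hc.one_le, by have := hc.le; omega, fun a ha => by have := hc.hold_lt a ha; omega,
    ?_, ?_, hc.anti, hc.isParent, hc.conn⟩
  · intro x hx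
    by_cases hxv : x = v
    · subst hxv
      simpa using hc.rep_lt _ hlt
    · simpa [hxv] using hc.rep_lt x (by omega)
  · intro x hx i hi hM
    by_cases hxv : x = v
    · subst hxv
      simpa using hc.sub _ hlt i hi (h.par_mem hi hM (hnew i hi).symm).2
    · simpa [hxv] using hc.sub x (by omega) i hi hM

/-- If the bag of `v` contains the clique that covers the parent of `v`, it replaces that clique. -/
theorem Contraction.replace (h : SubtreeFamily n par M top)
    (hc : Contraction n M v c rep hold cpar) (hv0 : 0 < v) (hvn : v < n)
    (hnew : ∃ i < n, top i = v) (hsub : ∀ i < n, M i (hold (rep (par v))) → M i v) :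
    Contraction n M (v + 1) c (Function.update rep v (rep (par v)))
      (Function.update hold (rep (par v)) v) cpar := by
  have hlt := h.isParent v hv0 hvn
  have hq := hc.rep_lt _ hlt
  have hpq := hc.sub _ hlt
  set q := rep (par v)
  obtain ⟨i₀, hi₀, htop⟩ := hnew
  have hold₀ : ∀ a < c, ¬ M i₀ (hold a) := fun a ha hM => by
    have := h.top_le hi₀ hM
    have := hc.hold_lt a ha
    omega
  have hM₀ : M i₀ v := htop ▸ h.top_mem hi₀
  -- an element of the bag of `v` that is in some old clique is in the clique `q`
  have hback : ∀ i < n, M i v → ∀ a < c, M i (hold a) → M i (hold q) := fun i hi hM a ha hMa =>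
    hpq i hi (h.mem_par_of_lt hi hM hMa (hc.hold_lt a ha))
  have hold' : ∀ a, Function.update hold q v a = if a = q then v else hold a := fun a => by
    rw [Function.update_apply]
  refine ⟨hc.one_le, by have := hc.le; omega, ?_, ?_, ?_, ?_, hc.isParent, ?_⟩
  · intro a ha
    have := hc.hold_lt a ha
    rw [hold']; split_ifs <;> omega
  · intro x hx
    by_cases hxv : x = v
    · subst hxv; simpa using hq
    · simpa [hxv] using hc.rep_lt x (by omega)
  · intro x hx i hi hM
    by_cases hxv : x = v
    · subst hxv; simpa using hM
    · have := hc.sub x (by omega) i hi hM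
      rw [Function.update_of_ne hxv, hold']
      split_ifs with hxq
      · rw [hxq] at this; exact hsub i hi this
      · exact this
  · intro a ha b hb hab
    rw [hold', hold'] at hab
    split_ifs at hab with h1 h2 h2
    · omega
    · exact absurd (hab i₀ hi₀ hM₀) (hold₀ b hb)
    · rw [h2]
      exact hc.anti a ha q hq fun i hi hM => hback i hi (hab i hi hM) a ha hM
    · exact hc.anti a ha b hb hab
  · intro i hi
    by_cases hiv : M i v
    · by_cases hiq : M i (hold q)
      · have : ∀ a, M i (Function.update hold q v a) ↔ M i (hold a) := fun a => by
          rw [hold']; split_ifs with h1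
          · rw [h1]; tauto
          · rfl
        simp only [this]
        exact hc.conn i hi
      · have : ∀ a < c, M i (Function.update hold q v a) → a = q := fun a ha hM => by
          rw [hold'] at hM; split_ifs at hM with h1
          · exact h1
          · exact absurd (hback i hi hiv a ha hM) hiq
        intro a ha b hb hMa hMb _ _
        rw [this a ha hMa, this b hb hMb]
    · have hiq : ¬ M i (hold q) := fun hM => hiv (hsub i hi hM)
      have : ∀ a, M i (Function.update hold q v a) ↔ M i (hold a) := fun a => by
        rw [hold']; split_ifs with h1
        · rw [h1]; tauto
        · rfl
      simp only [this]
      exact hc.conn i hi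

/-- Otherwise the bag of `v` is a new clique, a child of the clique that covers the parent of `v`.
-/
theorem Contraction.extend (h : SubtreeFamily n par M top)
    (hc : Contraction n M v c rep hold cpar) (hv0 : 0 < v) (hvn : v < n)
    (hnew : ∃ i < n, top i = v) (hsub : ¬ ∀ i < n, M i (hold (rep (par v))) → M i v) :
    Contraction n M (v + 1) (c + 1) (Function.update rep v c) (Function.update hold c v)
      (Function.update cpar c (rep (par v))) := by
  have hlt := h.isParent v hv0 hvn
  have hq := hc.rep_lt _ hlt
  have hpq := hc.sub _ hlt
  set q := rep (par v)
  obtain ⟨i₀, hi₀, htop⟩ := hnew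
  have hold₀ : ∀ a < c, ¬ M i₀ (hold a) := fun a ha hM => by
    have := h.top_le hi₀ hM
    have := hc.hold_lt a ha
    omega
  have hM₀ : M i₀ v := htop ▸ h.top_mem hi₀
  have hback : ∀ i < n, M i v → ∀ a < c, M i (hold a) → M i (hold q) := fun i hi hM a ha hMa =>
    hpq i hi (h.mem_par_of_lt hi hM hMa (hc.hold_lt a ha))
  have hold' : ∀ a, Function.update hold c v a = if a = c then v else hold a := fun a => by
    rw [Function.update_apply]
  have cpar' : ∀ a, Function.update cpar c q a = if a = c then q else cpar a := fun a => by
    rw [Function.update_apply]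
  refine ⟨by omega, by have := hc.le; omega, ?_, ?_, ?_, ?_, ?_, ?_⟩
  · intro a ha
    rw [hold']; split_ifs with h1
    · omega
    · have := hc.hold_lt a (by omega); omega
  · intro x hx
    by_cases hxv : x = v
    · subst hxv; simp
    · have := hc.rep_lt x (by omega)
      rw [Function.update_of_ne hxv]; omega
  · intro x hx i hi hM
    by_cases hxv : x = v
    · subst hxv; simpa using hM
    · have := hc.rep_lt x (by omega)
      rw [Function.update_of_ne hxv, hold', if_neg (by omega)]
      exact hc.sub x (by omega) i hi hM
  · intro a ha b hb hab
    rw [hold', hold'] at hab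
    split_ifs at hab with h1 h2 h2
    · omega
    · exact absurd (hab i₀ hi₀ hM₀) (hold₀ b (by omega))
    · exfalso
      have haq : a = q := hc.anti a (by omega) q hq fun i hi hM =>
        hback i hi (hab i hi hM) a (by omega) hM
      exact hsub (haq ▸ hab)
    · exact hc.anti a (by omega) b (by omega) hab
  · intro a h0 ha
    rw [cpar']; split_ifs with h1
    · omega
    · exact hc.isParent a h0 (by omega)
  · intro i hi
    -- the only case with a change: `c` is a new node of the subtree of `i`
    have hold_q : Function.update hold c v q = hold q := by rw [hold', if_neg (by omega)]
    have hold_c : Function.update hold c v c = v := by simp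
    have cpar_c : Function.update cpar c q c = q := by simp
    have hpar : ∀ a < c, a = 0 ∨
        Function.update hold c v (Function.update cpar c q a) = hold (cpar a) := by
      intro a ha
      rcases Nat.eq_zero_or_pos a with h0 | h0
      · exact Or.inl h0
      · have := hc.isParent a h0 ha
        rw [cpar', if_neg (by omega), hold', if_neg (by omega)]
        exact Or.inr rfl
    have hhold : ∀ a < c, Function.update hold c v a = hold a := fun a ha => by
      rw [hold', if_neg (by omega)]
    have hmix : ∀ a < c, M i (hold a) → M i v → c = 0 ∨ ¬ M i (hold q) → False := by
      intro a ha hMa hMv hor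
      rcases hor with h0 | h0
      · omega
      · exact h0 (hback i hi hMv a ha hMa)
    intro a ha b hb hMa hMb hta htb
    by_cases hac : a = c <;> by_cases hbc : b = c
    · omega
    · subst hac
      rw [hold_c] at hMa
      rw [hhold b (by omega)] at hMb
      rw [cpar_c, hold_q] at hta
      exact (hmix b (by omega) hMb hMa hta).elim
    · subst hbc
      rw [hold_c] at hMb
      rw [hhold a (by omega)] at hMa
      rw [cpar_c, hold_q] at htb
      exact (hmix a (by omega) hMa hMb htb).elim
    · rw [hhold a (by omega)] at hMa
      rw [hhold b (by omega)] at hMb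
      refine hc.conn i hi a (by omega) b (by omega) hMa hMb ?_ ?_
      · rcases hpar a (by omega) with h0 | h0
        · exact Or.inl h0
        · rwa [h0] at hta
      · rcases hpar b (by omega) with h0 | h0
        · exact Or.inl h0
        · rwa [h0] at htb

end step

/-! ### Lists in arrays -/

/-- The list of the `k` entries of an array from position `a` on. -/
def seg (f : ℕ → ℕ) (a k : ℕ) : List ℕ := (List.range' a k).map f

theorem segment_eq (off dat : ℕ → ℕ) (i : ℕ) :
    segment off dat i = seg dat (off i) (off (i + 1) - off i) := rfl

@[simp] theorem seg_zero (f : ℕ → ℕ) (a : ℕ) : seg f a 0 = [] := rfl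

@[simp] theorem length_seg (f : ℕ → ℕ) (a k : ℕ) : (seg f a k).length = k := by simp [seg]

theorem seg_succ (f : ℕ → ℕ) (a k : ℕ) : seg f a (k + 1) = seg f a k ++ [f (a + k)] := by
  simp [seg, List.range'_1_concat]

theorem seg_add (f : ℕ → ℕ) (a k l : ℕ) : seg f a (k + l) = seg f a k ++ seg f (a + k) l := by
  rw [seg, seg, seg, ← List.map_append, List.range'_append_1]

theorem seg_congr {f g : ℕ → ℕ} {a k : ℕ} (h : ∀ j < k, f (a + j) = g (a + j)) :
    seg f a k = seg g a k := by
  refine List.map_congr_left fun i hi => ?_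
  rw [List.mem_range'_1] at hi
  have := h (i - a) (by omega)
  rwa [show a + (i - a) = i by omega] at this

theorem seg_update_of_notMem (f : ℕ → ℕ) {a k i : ℕ} (v : ℕ) (h : i < a ∨ a + k ≤ i) :
    seg (Function.update f i v) a k = seg f a k :=
  seg_congr fun j hj => Function.update_of_ne (by omega) _ _

theorem seg_update_succ (f : ℕ → ℕ) (a k v : ℕ) :
    seg (Function.update f (a + k) v) a (k + 1) = seg f a k ++ [v] := by
  rw [seg_succ, seg_update_of_notMem _ _ (by omega), Function.update_self]

theorem mem_seg {f : ℕ → ℕ} {a k x : ℕ} : x ∈ seg f a k ↔ ∃ j < k, f (a + j) = x := by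
  simp only [seg, List.mem_map, List.mem_range'_1]
  constructor
  · rintro ⟨i, hi, rfl⟩
    exact ⟨i - a, by omega, by rw [show a + (i - a) = i by omega]⟩
  · rintro ⟨j, hj, rfl⟩
    exact ⟨a + j, by omega, rfl⟩

/-- The array `f'` arises from `f` by writing the list `L` from position `e` on; what comes after
that list is left open. -/
def Appended (f f' : ℕ → ℕ) (e : ℕ) (L : List ℕ) : Prop :=
  seg f' e L.length = L ∧ ∀ i < e, f' i = f i

theorem Appended.nil (f : ℕ → ℕ) (e : ℕ) : Appended f f e [] := ⟨rfl, fun _ _ => rfl⟩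

theorem Appended.snoc {f f' : ℕ → ℕ} {e : ℕ} {L : List ℕ} (h : Appended f f' e L) (v : ℕ) :
    Appended f (Function.update f' (e + L.length) v) e (L ++ [v]) := by
  refine ⟨?_, fun i hi => ?_⟩
  · rw [List.length_append, List.length_singleton, seg_update_succ, h.1]
  · rw [Function.update_of_ne (by omega), h.2 i hi]

theorem Appended.trans {f f' f'' : ℕ → ℕ} {e : ℕ} {L L' : List ℕ} (h : Appended f f' e L)
    (h' : Appended f' f'' (e + L.length) L') : Appended f f'' e (L ++ L') := by
  refine ⟨?_, fun i hi => by rw [h'.2 i (by omega), h.2 i hi]⟩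
  rw [List.length_append, seg_add, h'.1, seg_congr (g := f') fun j hj => h'.2 _ (by omega), h.1]

/-- Append the entries of array `src` at the positions from `reg 40` up to `reg 41` to array `dst`
at position `reg 43`, but leave out those that equal `reg 44`. -/
def copyExcept (src dst : ℕ) : Cmd :=
  .loop (.lt 40 41) (block
    [.load 42 src 40, .add 40 40 31,
     .branch (.eq 42 44) .skip (block [.store dst 43 42, .add 43 43 31])])

theorem runs_copyExcept {W src dst : ℕ} (hne : src ≠ dst) {s : State} {β k ε u : ℕ}
    (h1 : s.reg 31 = 1) (hβ : s.reg 40 = β) (hk : s.reg 41 = β + k) (hε : s.reg 43 = ε)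
    (hu : s.reg 44 = u) (hW : β + k ≤ W) (hW' : ε + k ≤ W) :
    Runs W (copyExcept src dst) s fun s' t =>
      t ≤ 8 * k + 1 ∧ s'.reg 43 = ε + ((seg (s.arr src) β k).filter (· ≠ u)).length ∧
      Appended (s.arr dst) (s'.arr dst) ε ((seg (s.arr src) β k).filter (· ≠ u)) := by
  refine (Runs.loop k (fun j s' T => T ≤ 8 * j ∧ s'.reg 40 = β + j ∧
    s'.reg 43 = ε + ((seg (s.arr src) β j).filter (· ≠ u)).length ∧
      Appended (s.arr dst) (s'.arr dst) ε ((seg (s.arr src) β j).filter (· ≠ u)))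
      ⟨by simp, by simp [hβ], by simp [hε], .nil _ _⟩ ?_ ?_).mono ?_
  · rintro j s' T hj hA ⟨hT, h40, h43, happ⟩
    have e31 := (hA.1 31 rfl).trans h1
    have e41 := (hA.1 41 rfl).trans hk
    have e44 := (hA.1 44 rfl).trans hu
    have esrc := hA.2 src (by simp [block, Cmd.writesArr, hne.symm])
    have hlen := (List.length_filter_le (· ≠ u) (seg (s.arr src) β j))
    rw [length_seg] at hlen
    rw [seg_succ, List.filter_append]
    generalize (seg (s.arr src) β j).filter (· ≠ u) = L at *
    refine ⟨by simp only [Test.Holds]; omega, Runs.of_wp ?_⟩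
    simp only [block, wp, State.setReg_reg, State.setReg_arr, State.setArr_reg, State.setArr_arr,
      Test.Holds, h40, h43, e31, e44, esrc]
    refine ⟨by simp; omega, fun hw => ?_, fun hw => ⟨by simp; omega, ?_⟩⟩
    · replace hw : s.arr src (β + j) = u := by simpa using hw
      simp [hw, happ]
      omega
    · replace hw : s.arr src (β + j) ≠ u := by simpa using hw
      have := happ.snoc (s.arr src (β + j))
      simp [hw, this]
      omega
  · rintro s' T hA ⟨hT, h40, -⟩
    have e41 := hA.1 41 rfl
    simp only [Test.Holds]; omega
  · rintro s' t - ⟨T, rfl, hT, -, h⟩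
    exact ⟨by omega, h⟩

/-- The first `a` lists of an array of consecutive lists are `L 0, …, L (a - 1)`, and they end at
position `e`. -/
def Stored (off dat : ℕ → ℕ) (L : ℕ → List ℕ) (a e : ℕ) : Prop :=
  off a = e ∧ ∀ b < a, segment off dat b = L b ∧ off (b + 1) ≤ e

theorem Stored.succ {off dat dat' : ℕ → ℕ} {L : ℕ → List ℕ} {a e : ℕ} (h : Stored off dat L a e)
    (h' : Appended dat dat' e (L a)) :
    Stored (Function.update off (a + 1) (e + (L a).length)) dat' L (a + 1)
      (e + (L a).length) := by
  refine ⟨by simp, fun b hb => ?_⟩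
  by_cases hba : b = a
  · subst hba
    rw [segment_eq, Function.update_self, Function.update_of_ne (by omega), h.1]
    refine ⟨?_, le_rfl⟩
    rw [Nat.add_sub_cancel_left]
    exact h'.1
  · obtain ⟨h1, h2⟩ := h.2 b (by omega)
    rw [segment_eq, Function.update_of_ne (by omega), Function.update_of_ne (by omega), ← h1]
    refine ⟨seg_congr fun j hj => h'.2 _ (by omega), by omega⟩

/-- The data that is available when the host tree and its `n` subtrees have been generated: next to
the required arrays `0`, `1`, `2` these are the topmost nodes of the subtrees in array `15`, and for
each node `x`, in row `x` of the arrays `14` and `17`, the list of the subtrees that contain `x` and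
the list of those with topmost node `x`; the lengths of these lists are in the arrays `13` and `16`.
Row `x` of an array consists of its cells from position `x * n` on. -/
structure Generated (n : ℕ) (s : State) : Prop where
  reg_n : s.reg 2 = n
  reg_zero : s.reg 30 = 0
  reg_one : s.reg 31 = 1
  fam : SubtreeFamily n (s.arr 0) (fun i x => x ∈ segment (s.arr 1) (s.arr 2) i) (s.arr 15)
  nodup : ∀ i < n, (segment (s.arr 1) (s.arr 2) i).Nodup
  off_zero : s.arr 1 0 = 0
  off_le : ∀ i < n, s.arr 1 i ≤ s.arr 1 (i + 1)
  base : ∀ x < n, s.arr 20 x = x * n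
  bag : ∀ x < n, seg (s.arr 14) (x * n) (s.arr 13 x) =
    (List.range n).filter fun i => x ∈ segment (s.arr 1) (s.arr 2) i
  tops : ∀ x < n, seg (s.arr 17) (x * n) (s.arr 16 x) =
    (List.range n).filter fun i => s.arr 15 i = x

theorem length_filter_range (n : ℕ) (p : ℕ → Prop) [DecidablePred p] :
    ((List.range n).filter fun i => p i).length = ((Finset.range n).filter p).card := rfl

namespace Generated

variable {n : ℕ} {s : State}

theorem of_agree {c : Cmd} {s' : State} (h : Generated n s) (hA : Agree c s s')
    (hr : (c.writesReg 2 || c.writesReg 30 || c.writesReg 31) = false)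
    (ha : (c.writesArr 0 || c.writesArr 1 || c.writesArr 2 || c.writesArr 13 || c.writesArr 14 ||
      c.writesArr 15 || c.writesArr 16 || c.writesArr 17 || c.writesArr 20) = false) :
    Generated n s' := by
  simp only [Bool.or_eq_false_iff] at hr ha
  obtain ⟨⟨r2, r30⟩, r31⟩ := hr
  obtain ⟨⟨⟨⟨⟨⟨⟨⟨a0, a1⟩, a2⟩, a13⟩, a14⟩, a15⟩, a16⟩, a17⟩, a20⟩ := ha
  constructor
  · rw [hA.1 2 r2]; exact h.reg_n
  · rw [hA.1 30 r30]; exact h.reg_zero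
  · rw [hA.1 31 r31]; exact h.reg_one
  all_goals simp only [hA.2 0, hA.2 1, hA.2 2, hA.2 13, hA.2 14, hA.2 15, hA.2 16, hA.2 17,
    hA.2 20, a0, a1, a2, a13, a14, a15, a16, a17, a20]
  exacts [h.fam, h.nodup, h.off_zero, h.off_le, h.base, h.bag, h.tops]

theorem size_eq (h : Generated n s) {x : ℕ} (hx : x < n) : s.arr 13 x =
    ((Finset.range n).filter fun i => x ∈ segment (s.arr 1) (s.arr 2) i).card := by
  rw [← length_filter_range, ← h.bag x hx, length_seg]

theorem tcnt_eq (h : Generated n s) {x : ℕ} (hx : x < n) : s.arr 16 x =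
    ((Finset.range n).filter fun i => s.arr 15 i = x).card := by
  rw [← length_filter_range, ← h.tops x hx, length_seg]

theorem size_le (h : Generated n s) {x : ℕ} (hx : x < n) : s.arr 13 x ≤ n := by
  rw [h.size_eq hx]
  exact (Finset.card_filter_le _ _).trans (by simp)

theorem tcnt_le (h : Generated n s) {x : ℕ} (hx : x < n) : s.arr 16 x ≤ n := by
  rw [h.tcnt_eq hx]
  exact (Finset.card_filter_le _ _).trans (by simp)

theorem tcnt_eq_zero (h : Generated n s) {x : ℕ} (hx : x < n) :
    s.arr 16 x = 0 ↔ ∀ i < n, s.arr 15 i ≠ x := by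
  rw [h.tcnt_eq hx, Finset.card_eq_zero, Finset.filter_eq_empty_iff]
  simp

theorem length_segment (h : Generated n s) {i : ℕ} (hi : i < n) :
    (segment (s.arr 1) (s.arr 2) i).length =
      ((Finset.range n).filter fun x => x ∈ segment (s.arr 1) (s.arr 2) i).card := by
  rw [← List.toFinset_card_of_nodup (h.nodup i hi)]
  congr 1
  ext x
  simpa using h.fam.lt i hi x

theorem off_eq_sum (h : Generated n s) {i : ℕ} (hi : i ≤ n) :
    s.arr 1 i = ∑ j ∈ Finset.range i, (segment (s.arr 1) (s.arr 2) j).length := by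
  induction i with
  | zero => simpa using h.off_zero
  | succ i ih =>
    rw [Finset.sum_range_succ, ← ih (by omega), segment_eq, length_seg]
    have := h.off_le i (by omega)
    omega

theorem off_le_mul (h : Generated n s) {i : ℕ} (hi : i ≤ n) : s.arr 1 i ≤ i * n := by
  rw [h.off_eq_sum hi]
  refine (Finset.sum_le_card_nsmul _ _ n fun j hj => ?_).trans (by simp)
  rw [h.length_segment (by simp at hj; omega)]
  exact (Finset.card_filter_le _ _).trans (by simp)

/-- The total size of the bags is the total size of the subtrees. -/
theorem sum_size (h : Generated n s) : ∑ x ∈ Finset.range n, s.arr 13 x = s.arr 1 n := by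
  rw [h.off_eq_sum le_rfl, Finset.sum_congr rfl fun x hx => h.size_eq (Finset.mem_range.1 hx),
    Finset.sum_congr rfl fun x hx => h.length_segment (Finset.mem_range.1 hx)]
  simp only [Finset.card_filter]
  rw [Finset.sum_comm]

theorem le_total (h : Generated n s) : n ≤ s.arr 1 n := by
  rw [h.off_eq_sum le_rfl]
  calc n = ∑ j ∈ Finset.range n, 1 := by simp
    _ ≤ _ := Finset.sum_le_sum fun i hi => by
        have := h.fam.top_mem (Finset.mem_range.1 hi)
        exact List.length_pos_iff.2 (List.ne_nil_of_mem this)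

/-- The comparison that decides whether a clique, the bag of `x`, is contained in the bag of the
next node `v`: the bag of `v` without the subtrees that have their topmost node there is the part of
it that is shared with the parent of `v`, whose bag is contained in that clique. -/
theorem size_sub_tcnt (h : Generated n s) {v x : ℕ} (hv : v < n) (hx : x < v)
    (hsub : ∀ i < n, s.arr 0 v ∈ segment (s.arr 1) (s.arr 2) i →
      x ∈ segment (s.arr 1) (s.arr 2) i) :
    s.arr 13 v - s.arr 16 v = s.arr 13 x ↔
      ∀ i < n, x ∈ segment (s.arr 1) (s.arr 2) i → v ∈ segment (s.arr 1) (s.arr 2) i := by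
  classical
  set B : ℕ → Finset ℕ := fun x =>
    (Finset.range n).filter fun i => x ∈ segment (s.arr 1) (s.arr 2) i
  have h1 : s.arr 13 v - s.arr 16 v = (B v ∩ B x).card := by
    rw [h.size_eq hv, h.tcnt_eq hv, ← Finset.card_sdiff_of_subset]
    · congr 1
      ext i
      simp only [B, Finset.mem_sdiff, Finset.mem_filter, Finset.mem_range, Finset.mem_inter]
      constructor
      · rintro ⟨⟨hi, hM⟩, hne⟩
        exact ⟨⟨hi, hM⟩, hi, hsub i hi (h.fam.par_mem hi hM fun hc => hne ⟨hi, hc.symm⟩).2⟩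
      · rintro ⟨⟨hi, hM⟩, -, hMx⟩
        refine ⟨⟨hi, hM⟩, fun hc => ?_⟩
        have := h.fam.top_le hi hMx
        omega
    · intro i hi
      simp only [Finset.mem_filter, Finset.mem_range] at hi ⊢
      exact ⟨hi.1, hi.2 ▸ h.fam.top_mem hi.1⟩
  rw [h1, h.size_eq (by omega : x < n)]
  constructor
  · intro heq i hi hM
    have := Finset.eq_of_subset_of_card_le (Finset.inter_subset_right (s₁ := B v) (s₂ := B x))
      heq.ge
    have hmem : i ∈ B v ∩ B x := by
      rw [this]; simp [B, hi, hM]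
    simp only [B, Finset.mem_inter, Finset.mem_filter] at hmem
    exact hmem.1.2
  · intro hall
    congr 1
    refine Finset.inter_eq_right.2 fun i hi => ?_
    simp only [B, Finset.mem_filter, Finset.mem_range] at hi ⊢
    exact ⟨hi.1, hall i hi.1 hi.2⟩

end Generated

/-! ### The program for the clique tree -/

/-- Contract the host tree to a clique tree, visiting the nodes in the order of their numbers. -/
def contractProg : Cmd := block
  [.const 3 1, .const 45 1,
   .loop (.lt 3 2) (block
    [.load 46 0 3, .load 47 18 46, .load 48 13 3, .load 49 16 3,
     .branch (.eq 49 30) (.store 18 3 47) (block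
      [.load 50 19 47, .load 51 13 50, .sub 52 48 49,
       .branch (.eq 52 51) (block [.store 19 47 3, .store 18 3 47])
        (block [.store 19 45 3, .store 18 3 45, .store 5 45 47, .add 45 45 31])]),
     .add 3 3 31])]

theorem runs_contractProg {W n : ℕ} {s : State} (h : Generated n s) (hW : n + 1 ≤ W)
    (h18 : s.arr 18 0 = 0) (h19 : s.arr 19 0 = 0) :
    Runs W contractProg s fun s' t => t ≤ 30 * n ∧
      Contraction n (fun i x => x ∈ segment (s.arr 1) (s.arr 2) i) n (s'.reg 45) (s'.arr 18)
        (s'.arr 19) (s'.arr 5) := by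
  have hn := h.fam.pos
  refine Runs.of_wp ?_
  simp only [contractProg, block, wp]
  refine ⟨by omega, by omega, ?_⟩
  refine (Runs.loop (n - 1) (fun j s' T => T ≤ 22 * j ∧ s'.reg 3 = j + 1 ∧
    Contraction n (fun i x => x ∈ segment (s.arr 1) (s.arr 2) i) (j + 1) (s'.reg 45) (s'.arr 18)
        (s'.arr 19) (s'.arr 5)) ?_ ?_ ?_).mono ?_
  · simp only [State.setReg_reg, State.setReg_arr]
    exact ⟨by simp, by simp, .start _ _ _ h18 h19⟩
  · rintro j s' T hj hA ⟨hT, h3, hc⟩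
    have hg₀ : Generated n ((s.setReg 3 1).setReg 45 1) :=
      ⟨h.reg_n, h.reg_zero, h.reg_one, h.fam, h.nodup, h.off_zero, h.off_le, h.base, h.bag, h.tops⟩
    have hg : Generated n s' := hg₀.of_agree hA rfl rfl
    have a1 : s'.arr 1 = s.arr 1 := hA.2 1 rfl
    have a2 : s'.arr 2 = s.arr 2 := hA.2 2 rfl
    have a15 : s'.arr 15 = s.arr 15 := hA.2 15 rfl
    have a0 : s'.arr 0 = s.arr 0 := hA.2 0 rfl
    have hv : j + 1 < n := by omega
    have hlt := h.fam.isParent (j + 1) (by omega) hv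
    have hq := hc.rep_lt _ hlt
    have hhold := hc.hold_lt _ hq
    have hcle := hc.le
    have htc := hg.tcnt_eq_zero hv
    have hcmp := hg.size_sub_tcnt hv hhold fun i hi => by
      rw [a0, a1, a2]; exact hc.sub _ hlt i hi
    rw [a1, a2] at hcmp
    rw [a15] at htc
    refine ⟨by simp [Test.Holds, h3, hg.reg_n]; omega, Runs.of_wp ?_⟩
    simp only [wp, State.setReg_reg, State.setReg_arr, State.setArr_reg, State.setArr_arr,
      Test.Holds, h3, hg.reg_zero, hg.reg_one, a0]
    refine ⟨fun ht => ?_, fun ht => ⟨fun hs => ?_, fun hs => ?_⟩⟩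
    · replace ht : s'.arr 16 (j + 1) = 0 := by simpa using ht
      refine ⟨by simp; omega, by simp; omega, by simp, ?_⟩
      simpa using hc.skip h.fam (by omega) hv (htc.1 ht)
    · replace ht : s'.arr 16 (j + 1) ≠ 0 := by simpa using ht
      replace hs : s'.arr 13 (j + 1) - s'.arr 16 (j + 1) =
        s'.arr 13 (s'.arr 19 (s'.arr 18 (s.arr 0 (j + 1)))) := by simpa using hs
      have hnew : ∃ i < n, s.arr 15 i = j + 1 := by
        by_contra hcon; push Not at hcon; exact ht (htc.2 hcon)
      refine ⟨by simp; omega, by simp; omega, by simp, ?_⟩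
      simpa using hc.replace h.fam (by omega) hv hnew (hcmp.1 hs)
    · replace ht : s'.arr 16 (j + 1) ≠ 0 := by simpa using ht
      replace hs : s'.arr 13 (j + 1) - s'.arr 16 (j + 1) ≠
        s'.arr 13 (s'.arr 19 (s'.arr 18 (s.arr 0 (j + 1)))) := by simpa using hs
      have hnew : ∃ i < n, s.arr 15 i = j + 1 := by
        by_contra hcon; push Not at hcon; exact ht (htc.2 hcon)
      refine ⟨by simp; omega, by simp; omega, by simp; omega, by simp, ?_⟩
      simpa using hc.extend h.fam (by omega) hv hnew (fun hcon => hs (hcmp.2 hcon))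
  · rintro s' T hA ⟨hT, h3, -⟩
    have e2 := (hA.1 2 rfl).trans h.reg_n
    simp only [Test.Holds]; omega
  · rintro s' t - ⟨T, rfl, hT, h3, hc⟩
    rw [Nat.sub_add_cancel hn] at hc
    exact ⟨by omega, hc⟩

/-- Write the list of the cliques, and their number to register `0`. The bags are copied in full:
register `44` holds `n`, which is not an entry of them. -/
def emitProg : Cmd := block
  [.const 43 0, .const 53 0, .add 44 2 30, .store 3 30 30,
   .loop (.lt 53 45) (block
    [.load 50 19 53, .load 40 20 50, .load 48 13 50, .add 41 40 48, copyExcept 14 4,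
     .add 53 53 31, .store 3 53 43]),
   .add 0 45 30]

theorem filter_range_filter_ne (n : ℕ) (p : ℕ → Bool) :
    ((List.range n).filter p).filter (· ≠ n) = (List.range n).filter p := by
  refine List.filter_eq_self.2 fun i hi => ?_
  have := (List.mem_filter.1 hi).1
  rw [List.mem_range] at this
  simp; omega

theorem mul_add_le {n x k : ℕ} (hx : x < n) (hk : k ≤ n) : x * n + k ≤ n * n := by
  have : (x + 1) * n ≤ n * n := Nat.mul_le_mul_right n hx
  rw [Nat.add_one_mul] at this
  omega

theorem Generated.sum_hold_le {n c a : ℕ} {s : State} {rep hold cpar : ℕ → ℕ} (h : Generated n s)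
    (hc : Contraction n (fun i x => x ∈ segment (s.arr 1) (s.arr 2) i) n c rep hold cpar)
    (ha : a ≤ c) : ∑ b ∈ Finset.range a, s.arr 13 (hold b) ≤ s.arr 1 n := by
  classical
  have hinj : Set.InjOn hold (Finset.range a) := by
    intro b hb b' hb' heq
    simp only [Finset.coe_range, Set.mem_Iio] at hb hb'
    exact hc.anti b (by omega) b' (by omega) fun i _ hM => heq ▸ hM
  rw [← Finset.sum_image (f := s.arr 13) hinj, ← h.sum_size]
  refine Finset.sum_le_sum_of_subset fun x hx => ?_
  simp only [Finset.mem_image, Finset.mem_range] at hx ⊢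
  obtain ⟨b, hb, rfl⟩ := hx
  exact hc.hold_lt b (by omega)

theorem runs_emitProg {W n c : ℕ} {s : State} {rep cpar : ℕ → ℕ} (h : Generated n s)
    (hW : n * n + n ≤ W) (hcreg : s.reg 45 = c)
    (hc : Contraction n (fun i x => x ∈ segment (s.arr 1) (s.arr 2) i) n c rep (s.arr 19) cpar) :
    Runs W emitProg s fun s' t => t ≤ 60 * s.arr 1 n ∧ s'.reg 0 = c ∧
      ∃ e, Stored (s'.arr 3) (s'.arr 4) (fun a => (List.range n).filter fun i =>
        s.arr 19 a ∈ segment (s.arr 1) (s.arr 2) i) c e := by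
  have hn := h.fam.pos
  have hcn := hc.le
  have htot := h.le_total
  have hnn : s.arr 1 n ≤ n * n := h.off_le_mul le_rfl
  refine Runs.of_wp ?_
  simp only [emitProg, block, wp, State.setReg_reg, State.setReg_arr, h.reg_n, h.reg_zero]
  refine ⟨by omega, by omega, by simp; omega, ?_⟩
  refine (Runs.loop c (fun a s' T => s'.reg 53 = a ∧
      s'.reg 43 = ∑ b ∈ Finset.range a, s.arr 13 (s.arr 19 b) ∧
      T ≤ 8 * s'.reg 43 + 25 * a ∧
      Stored (s'.arr 3) (s'.arr 4) (fun a => (List.range n).filter fun i =>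
        s.arr 19 a ∈ segment (s.arr 1) (s.arr 2) i) a (s'.reg 43)) ?_ ?_ ?_).mono ?_
  · simp [Stored]
  · rintro a s' T ha hA ⟨h53, h43, hT, hst⟩
    have e31 : s'.reg 31 = 1 := (hA.1 31 rfl).trans h.reg_one
    have e44 : s'.reg 44 = n := (hA.1 44 rfl).trans (by simp [State.setReg_reg, State.setArr_reg])
    have e45 : s'.reg 45 = c := (hA.1 45 rfl).trans hcreg
    have a13 : s'.arr 13 = s.arr 13 := hA.2 13 rfl
    have a14 : s'.arr 14 = s.arr 14 := hA.2 14 rfl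
    have a19 : s'.arr 19 = s.arr 19 := hA.2 19 rfl
    have a20 : s'.arr 20 = s.arr 20 := hA.2 20 rfl
    have hx := hc.hold_lt a ha
    have hsz := h.size_le hx
    have hb := mul_add_le hx hsz
    have hsum := h.sum_hold_le hc (a := a + 1) ha
    rw [Finset.sum_range_succ] at hsum
    refine ⟨by simp only [Test.Holds]; omega, Runs.of_wp ?_⟩
    simp only [wp, State.setReg_reg, State.setReg_arr, h53, a13, a19, a20]
    simp only [reduceIte, Nat.reduceEqDiff, h.base _ hx]
    refine ⟨by omega, (runs_copyExcept (W := W) (by decide) (β := s.arr 19 a * n)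
      (k := s.arr 13 (s.arr 19 a)) (ε := s'.reg 43) (u := n) ?_ ?_ ?_ ?_ ?_ (by omega)
      (by omega)).mono ?_⟩
    · simpa [State.setReg_reg] using e31
    · simp [State.setReg_reg]
    · simp [State.setReg_reg]
    · simp [State.setReg_reg]
    · simpa [State.setReg_reg] using e44
    · simp only [State.setReg_arr, a14, h.bag _ hx, filter_range_filter_ne]
      rintro s'' t hA' ⟨ht, h43', happ⟩
      have e31' : s''.reg 31 = 1 := (hA'.1 31 rfl).trans e31
      have e53' : s''.reg 53 = a := (hA'.1 53 rfl).trans h53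
      have a3' : s''.arr 3 = s'.arr 3 := hA'.2 3 rfl
      have hlen := congrArg List.length (h.bag _ hx)
      rw [length_seg] at hlen
      simp only [State.setReg_reg, State.setReg_arr, State.setArr_reg, State.setArr_arr, e31', e53',
        a3', reduceIte, Nat.reduceEqDiff]
      have hst' := hst.succ happ
      have hhn := hc.le
      refine ⟨by omega, trivial, ?_, by omega, ?_⟩
      · rw [h43', Finset.sum_range_succ, ← h43, ← hlen]
      · rw [h43']
        exact hst'
  · rintro s' T hA ⟨h53, -⟩
    have e45 : s'.reg 45 = c := (hA.1 45 rfl).trans hcreg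
    simp only [Test.Holds]; omega
  · rintro s' t hA ⟨T, rfl, h53, h43, hT, hst⟩
    have e45 : s'.reg 45 = c := (hA.1 45 rfl).trans hcreg
    have e30 : s'.reg 30 = 0 := (hA.1 30 rfl).trans h.reg_zero
    have hsum := h.sum_hold_le hc (a := c) le_rfl
    simp only [e45, e30, reduceIte]
    exact ⟨by omega, by omega, by omega, _, hst⟩

/-! ### The program for the adjacency lists -/

section adjacency

variable {n : ℕ} {par : ℕ → ℕ} {L : ℕ → List ℕ} {top : ℕ → ℕ}

/-- The subtrees, other than the one with number `i`, that contain the topmost node of the latter.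
-/
def upperNeighbors (n : ℕ) (L : ℕ → List ℕ) (top : ℕ → ℕ) (i : ℕ) : List ℕ :=
  ((List.range n).filter fun j => top i ∈ L j).filter (· ≠ i)

/-- The subtrees whose topmost node is `y`, unless `y` is the topmost node of subtree `i`. -/
def lowerNeighbors (n : ℕ) (top : ℕ → ℕ) (i y : ℕ) : List ℕ :=
  if y = top i then [] else (List.range n).filter fun j => top j = y

/-- The list of the neighbours of `i` in the intersection graph of the lists `L`. -/
def neighborList (n : ℕ) (L : ℕ → List ℕ) (top : ℕ → ℕ) (i : ℕ) : List ℕ :=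
  upperNeighbors n L top i ++ (L i).flatMap (lowerNeighbors n top i)

theorem SubtreeFamily.mem_neighborList
    (h : SubtreeFamily n par (fun i x => x ∈ L i) top) {i j : ℕ} :
    j ∈ neighborList n L top i ↔ j < n ∧ j ≠ i ∧ (top i ∈ L j ∨ top j ∈ L i) := by
  simp only [neighborList, upperNeighbors, lowerNeighbors, List.mem_append, List.mem_filter,
    List.mem_range, List.mem_flatMap, decide_eq_true_eq]
  constructor
  · rintro (⟨⟨hj, hm⟩, hne⟩ | ⟨y, hy, hj⟩)
    · exact ⟨hj, hne, Or.inl hm⟩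
    · split_ifs at hj with hyi
      · simp at hj
      · simp only [List.mem_filter, List.mem_range, decide_eq_true_eq] at hj
        obtain ⟨hj, rfl⟩ := hj
        exact ⟨hj, fun hc => hyi (congrArg top hc), Or.inr hy⟩
  · rintro ⟨hj, hne, hm⟩
    by_cases hup : top i ∈ L j
    · exact Or.inl ⟨⟨hj, hup⟩, hne⟩
    · have hm := hm.resolve_left hup
      refine Or.inr ⟨top j, hm, ?_⟩
      have hne' : top j ≠ top i := fun hc => hup (hc ▸ h.top_mem hj)
      rw [if_neg hne']
      simp [hj]

theorem SubtreeFamily.nodup_neighborList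
    (h : SubtreeFamily n par (fun i x => x ∈ L i) top) {i : ℕ} (hi : i < n) (hL : (L i).Nodup) :
    (neighborList n L top i).Nodup := by
  have hr := List.nodup_range (n := n)
  refine List.nodup_append.2 ⟨(hr.filter _).filter _, ?_, ?_⟩
  · rw [List.nodup_flatMap]
    constructor
    · intro y _
      unfold lowerNeighbors
      split_ifs
      · exact List.nodup_nil
      · exact hr.filter _
    · refine hL.imp fun {y y'} hne j hj hj' => ?_
      unfold lowerNeighbors at hj hj'
      split_ifs at hj hj' <;> simp at hj hj'
      exact hne (hj.2 ▸ hj'.2)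
  · rintro j hj j' hj' rfl
    simp only [upperNeighbors, List.mem_filter, List.mem_range, decide_eq_true_eq] at hj
    obtain ⟨y, hy, hj'⟩ := List.mem_flatMap.1 hj'
    unfold lowerNeighbors at hj'
    split_ifs at hj' with hyi
    · simp at hj'
    · simp only [List.mem_filter, List.mem_range, decide_eq_true_eq] at hj'
      have h1 := h.top_le hj'.1 hj.1.2
      have h2 := h.top_le hi hy
      omega

theorem SubtreeFamily.length_neighborList
    (h : SubtreeFamily n par (fun i x => x ∈ L i) top) {F : Fin n → Finset (Fin n)}
    (hF : ∀ i x : Fin n, x ∈ F i ↔ (x : ℕ) ∈ L i) (i : Fin n) (hL : (L i).Nodup) :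
    (neighborList n L top i).length =
      ((ChordalGen.intersectionGraph F).neighborSet i).ncard := by
  classical
  rw [← List.toFinset_card_of_nodup (h.nodup_neighborList i.2 hL), ← Set.ncard_coe_finset,
    ← Set.ncard_image_of_injective _ Fin.val_injective]
  congr 1
  ext j
  simp only [List.coe_toFinset, Set.mem_ofPred_eq, h.mem_neighborList, Set.mem_image,
    SimpleGraph.mem_neighborSet]
  constructor
  · rintro ⟨hj, hne, hm⟩
    exact ⟨⟨j, hj⟩, (h.adj_iff_top hF).2 ⟨fun hc => hne (hc ▸ rfl), hm⟩, rfl⟩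
  · rintro ⟨j, hadj, rfl⟩
    obtain ⟨hne, hm⟩ := (h.adj_iff_top hF).1 hadj
    exact ⟨j.2, fun hc => hne (Fin.ext hc.symm), hm⟩

theorem SubtreeFamily.length_neighborList_le
    (h : SubtreeFamily n par (fun i x => x ∈ L i) top) {i : ℕ} (hi : i < n) (hL : (L i).Nodup) :
    (neighborList n L top i).length ≤ n := by
  rw [← List.toFinset_card_of_nodup (h.nodup_neighborList hi hL)]
  refine (Finset.card_le_card (t := Finset.range n) fun j hj => ?_).trans (by simp)
  rw [List.mem_toFinset, h.mem_neighborList] at hj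
  simpa using hj.1

/-- The bag of the topmost node of subtree `i` has one element more than the list of its upper
neighbours, namely `i`. -/
theorem SubtreeFamily.length_upperNeighbors
    (h : SubtreeFamily n par (fun i x => x ∈ L i) top) {i : ℕ} (hi : i < n) :
    ((List.range n).filter fun j => top i ∈ L j).length =
      (upperNeighbors n L top i).length + 1 := by
  have hmem : i ∈ (List.range n).filter fun j => top i ∈ L j := by
    simpa [hi] using h.top_mem hi
  have hnd : ((List.range n).filter fun j => top i ∈ L j).Nodup := List.nodup_range.filter _
  have := hnd.erase_eq_filter i
  have hlen := List.length_erase_of_mem hmem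
  have hpos := List.length_pos_of_mem hmem
  have heq : upperNeighbors n L top i =
      ((List.range n).filter fun j => top i ∈ L j).erase i := by
    rw [this, upperNeighbors]
    refine List.filter_congr fun j _ => ?_
    rw [bne_eq, decide_not]
    rfl
  rw [heq]
  omega

end adjacency

/-- Part of `adjacencyProg`: append the lists of the subtrees with topmost node `y` to array `7`,
for all nodes `y` of a subtree other than its own topmost node. -/
def lowerProg : Cmd :=
  .loop (.lt 56 57) (.seq
    (block [.load 58 2 56, .load 40 20 58, .load 48 16 58,
      .branch (.eq 58 55) (.const 48 0) .skip])
    (block [.add 41 40 48, copyExcept 17 7, .add 56 56 31]))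

/-- Write the adjacency lists of the intersection graph: for each `i`, the bag of its topmost node
without `i`, followed by the lists that `lowerProg` appends. Setting register `44` to `n` makes
`copyExcept` copy the latter in full. -/
def adjacencyProg : Cmd := block
  [.const 43 0, .const 54 0, .store 6 30 30,
   .loop (.lt 54 2) (block
    [.load 55 15 54, .load 40 20 55, .load 48 13 55, .add 41 40 48, .add 44 54 30,
     copyExcept 14 7,
     .add 44 2 30, .load 56 1 54, .add 57 54 31, .load 57 1 57, lowerProg,
     .add 54 54 31, .store 6 54 43])]

theorem runs_lowerProg {W n i ε : ℕ} {s : State} (h : Generated n s) (hi : i < n)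
    (hW : n * n + n ≤ W) (h44 : s.reg 44 = n) (h55 : s.reg 55 = s.arr 15 i)
    (h56 : s.reg 56 = s.arr 1 i) (h57 : s.reg 57 = s.arr 1 (i + 1)) (h43 : s.reg 43 = ε)
    (hε : ε + ((segment (s.arr 1) (s.arr 2) i).flatMap
      (lowerNeighbors n (s.arr 15) i)).length ≤ n * n) :
    Runs W lowerProg s fun s' t =>
      t ≤ 8 * ((segment (s.arr 1) (s.arr 2) i).flatMap
          (lowerNeighbors n (s.arr 15) i)).length +
        25 * (segment (s.arr 1) (s.arr 2) i).length + 1 ∧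
      s'.reg 43 = ε + ((segment (s.arr 1) (s.arr 2) i).flatMap
          (lowerNeighbors n (s.arr 15) i)).length ∧
      Appended (s.arr 7) (s'.arr 7) ε ((segment (s.arr 1) (s.arr 2) i).flatMap
          (lowerNeighbors n (s.arr 15) i)) := by
  have hoff := h.off_le i hi
  have htot := h.off_le_mul (i := i + 1) hi
  have hin : (i + 1) * n ≤ n * n := Nat.mul_le_mul_right n hi
  set f := lowerNeighbors n (s.arr 15) i with hf
  set o := s.arr 1 i with ho
  set m := s.arr 1 (i + 1) - o with hm
  have hseg : segment (s.arr 1) (s.arr 2) i = seg (s.arr 2) o m := rfl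
  rw [hseg] at hε ⊢
  refine (Runs.loop m (fun j s' T => T ≤ 8 * ((seg (s.arr 2) o j).flatMap f).length + 25 * j ∧
      s'.reg 56 = o + j ∧ s'.reg 43 = ε + ((seg (s.arr 2) o j).flatMap f).length ∧
      Appended (s.arr 7) (s'.arr 7) ε ((seg (s.arr 2) o j).flatMap f)) ?_ ?_ ?_).mono ?_
  · exact ⟨by simp, by simp [h56], by simp [h43], .nil _ _⟩
  · rintro j s' T hj hA ⟨hT, h56', h43', happ⟩
    have hg : Generated n s' := h.of_agree hA rfl rfl
    have e44 : s'.reg 44 = n := (hA.1 44 rfl).trans h44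
    have e55 : s'.reg 55 = s.arr 15 i := (hA.1 55 rfl).trans h55
    have e57 : s'.reg 57 = o + m := (hA.1 57 rfl).trans (by omega)
    have a2 : s'.arr 2 = s.arr 2 := hA.2 2 rfl
    have a15 : s'.arr 15 = s.arr 15 := hA.2 15 rfl
    have a16 : s'.arr 16 = s.arr 16 := hA.2 16 rfl
    have a17 : s'.arr 17 = s.arr 17 := hA.2 17 rfl
    have a20 : s'.arr 20 = s.arr 20 := hA.2 20 rfl
    set y := s.arr 2 (o + j) with hy
    have hyn : y < n := h.fam.lt i hi y (by rw [hseg, mem_seg]; exact ⟨j, hj, rfl⟩)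
    have htc := h.tcnt_le hyn
    have hb := mul_add_le hyn htc
    have hsplit : seg (s.arr 2) o m = seg (s.arr 2) o (j + 1) ++
        seg (s.arr 2) (o + (j + 1)) (m - (j + 1)) := by
      rw [← seg_add]; congr 1; omega
    rw [hsplit, List.flatMap_append, List.length_append, seg_succ, List.flatMap_append,
      List.length_append, List.flatMap_singleton] at hε
    rw [seg_succ, List.flatMap_append, List.flatMap_singleton, ← hy]
    rw [← hy] at hε
    have hfy : seg (s.arr 17) (y * n) (if y = s.arr 15 i then 0 else s.arr 16 y) = f y := by
      rw [hf, lowerNeighbors]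
      split_ifs
      · rfl
      · exact h.tops y hyn
    have hfy' : (f y).filter (· ≠ n) = f y := by
      rw [hf, lowerNeighbors]
      split_ifs
      · rfl
      · exact filter_range_filter_ne _ _
    have hlen := congrArg List.length hfy
    rw [length_seg] at hlen
    have hk : (if y = s.arr 15 i then 0 else s.arr 16 y) ≤ n := by split_ifs <;> omega
    set k := if y = s.arr 15 i then 0 else s.arr 16 y with hkdef
    set L := (seg (s.arr 2) o j).flatMap f
    -- the rest of the round, after the branch has put the length of the list to register 48
    have hrest : ∀ s₁ : State, Agree (block [.load 58 2 56, .load 40 20 58, .load 48 16 58,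
        .branch (.eq 58 55) (.const 48 0) .skip]) s' s₁ → s₁.reg 48 = k → s₁.reg 40 = y * n →
        Runs W (block [.add 41 40 48, copyExcept 17 7, .add 56 56 31]) s₁ fun s'' t =>
          t ≤ 8 * k + 6 ∧ s''.reg 56 = o + (j + 1) ∧ s''.reg 43 = ε + (L ++ f y).length ∧
          Appended (s.arr 7) (s''.arr 7) ε (L ++ f y) := by
      intro s₁ hA₁ h48 h40
      have f31 : s₁.reg 31 = 1 := (hA₁.1 31 rfl).trans hg.reg_one
      have f43 : s₁.reg 43 = ε + L.length := (hA₁.1 43 rfl).trans h43'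
      have f44 : s₁.reg 44 = n := (hA₁.1 44 rfl).trans e44
      have f56 : s₁.reg 56 = o + j := (hA₁.1 56 rfl).trans h56'
      have g7 : s₁.arr 7 = s'.arr 7 := hA₁.2 7 rfl
      have g17 : s₁.arr 17 = s.arr 17 := (hA₁.2 17 rfl).trans a17
      refine Runs.of_wp ?_
      simp only [block, wp]
      refine ⟨by omega, (runs_copyExcept (W := W) (by decide) (β := y * n) (k := k)
        (ε := ε + L.length) (u := n) ?_ ?_ ?_ ?_ ?_ (by omega) (by omega)).mono ?_⟩
      · simpa using f31
      · simpa using h40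
      · simp [h40, h48]
      · simpa using f43
      · simpa using f44
      · simp only [State.setReg_arr, g17, hfy, hfy', g7]
        rintro s'' t hA' ⟨ht, h43'', happ'⟩
        have e31' : s''.reg 31 = 1 := (hA'.1 31 rfl).trans (by simpa using f31)
        have e56' : s''.reg 56 = o + j := (hA'.1 56 rfl).trans (by simpa using f56)
        simp only [e31', e56']
        refine ⟨by omega, by omega, by simp; omega, ?_, ?_⟩
        · simp [h43'', List.length_append]; omega
        · simpa using happ.trans happ'
    refine ⟨by simp only [Test.Holds]; omega, Runs.seq ?_⟩
    refine (Runs.of_wp (Q := fun s₁ t => t ≤ 8 ∧ s₁.reg 48 = k ∧ s₁.reg 40 = y * n) ?_).mono ?_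
    · simp [block, wp, Test.Holds, h56', a2, a16, a20, e55, ← hy, h.base _ hyn]
      simp +contextual [hkdef]
    · rintro s₁ t₁ hA₁ ⟨ht₁, h48, h40⟩
      refine (hrest s₁ hA₁ h48 h40).mono ?_
      rintro s₂ t₂ - ⟨ht₂, h⟩
      refine ⟨?_, h⟩
      rw [List.length_append]; omega
  · rintro s' T hA ⟨hT, h56', -⟩
    have e57 : s'.reg 57 = o + m := (hA.1 57 rfl).trans (by omega)
    simp only [Test.Holds]; omega
  · rintro s' t - ⟨T, rfl, hT, -, h⟩
    refine ⟨?_, h⟩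
    rw [length_seg]; omega

theorem runs_adjacencyProg {W n : ℕ} {s : State} (h : Generated n s)
    (hW : n * n + 2 * n ≤ W) :
    Runs W adjacencyProg s fun s' t =>
      t ≤ 8 * (∑ i ∈ Finset.range n,
        (neighborList n (segment (s.arr 1) (s.arr 2)) (s.arr 15) i).length) + 80 * s.arr 1 n ∧
      ∃ e, Stored (s'.arr 6) (s'.arr 7)
        (neighborList n (segment (s.arr 1) (s.arr 2)) (s.arr 15)) n e := by
  have hn := h.fam.pos
  have htot := h.le_total
  set A := neighborList n (segment (s.arr 1) (s.arr 2)) (s.arr 15) with hAdef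
  have hAle : ∀ i < n, (A i).length ≤ n := fun i hi =>
    h.fam.length_neighborList_le hi (h.nodup i hi)
  refine Runs.of_wp ?_
  simp only [adjacencyProg, block, wp, State.setReg_reg]
  refine ⟨by omega, by omega, ?_⟩
  refine (Runs.loop n (fun i s' T => s'.reg 54 = i ∧
      s'.reg 43 = ∑ j ∈ Finset.range i, (A j).length ∧
      T ≤ 8 * s'.reg 43 + 25 * s.arr 1 i + 40 * i ∧
      Stored (s'.arr 6) (s'.arr 7) A i (s'.reg 43)) ?_ ?_ ?_).mono ?_
  · simp [Stored, h.reg_zero]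
  · rintro i s' T hi hA ⟨h54, h43, hT, hst⟩
    have hg₀ : Generated n (((s.setReg 43 0).setReg 54 0).setArr 6 (s.reg 30) (s.reg 30)) :=
      ⟨h.reg_n, h.reg_zero, h.reg_one, h.fam, h.nodup, h.off_zero, h.off_le, h.base, h.bag, h.tops⟩
    have hg : Generated n s' := hg₀.of_agree hA rfl rfl
    have a1 : s'.arr 1 = s.arr 1 := hA.2 1 rfl
    have a2 : s'.arr 2 = s.arr 2 := hA.2 2 rfl
    have a13 : s'.arr 13 = s.arr 13 := hA.2 13 rfl
    have a14 : s'.arr 14 = s.arr 14 := hA.2 14 rfl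
    have a15 : s'.arr 15 = s.arr 15 := hA.2 15 rfl
    have a20 : s'.arr 20 = s.arr 20 := hA.2 20 rfl
    have hE : s'.reg 43 ≤ i * n := by
      rw [h43]
      refine (Finset.sum_le_card_nsmul _ _ n fun j hj => hAle j ?_).trans (by simp)
      simp at hj; omega
    have hEn := mul_add_le hi le_rfl
    set x := s.arr 15 i with hx
    have hxn : x < n := h.fam.lt i hi _ (h.fam.top_mem hi)
    have hsz := h.size_le hxn
    have hb := mul_add_le hxn hsz
    have hup := h.fam.length_upperNeighbors (L := segment (s.arr 1) (s.arr 2)) hi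
    have hbag := h.bag x hxn
    have hlenbag := congrArg List.length hbag
    rw [length_seg] at hlenbag
    rw [← hx] at hup
    have hAi : A i = upperNeighbors n (segment (s.arr 1) (s.arr 2)) (s.arr 15) i ++
        (segment (s.arr 1) (s.arr 2) i).flatMap (lowerNeighbors n (s.arr 15) i) := rfl
    have hAlen := hAle i hi
    have hAlen' := congrArg List.length hAi
    rw [List.length_append] at hAlen'
    refine ⟨by simp only [Test.Holds, h54, hg.reg_n]; exact hi, Runs.of_wp ?_⟩
    simp only [wp, State.setReg_reg, State.setReg_arr, h54, a13, a15, a20, hg.reg_zero, ← hx]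
    simp only [reduceIte, Nat.reduceEqDiff, h.base _ hxn]
    refine ⟨by omega, by omega, (runs_copyExcept (W := W) (by decide) (β := x * n)
      (k := s.arr 13 x) (ε := s'.reg 43) (u := i) ?_ ?_ ?_ ?_ ?_ (by omega)
      (by omega)).mono ?_⟩
    · simp [hg.reg_one]
    · simp
    · simp
    · simp
    · simp
    · simp only [State.setReg_arr, a14, hbag]
      rintro s₁ t₁ hA₁ ⟨ht₁, h43₁, happ₁⟩
      have hg₁ : Generated n s₁ := by
        refine Generated.of_agree ?_ hA₁ rfl rfl
        exact ⟨hg.reg_n, hg.reg_zero, hg.reg_one, hg.fam, hg.nodup, hg.off_zero, hg.off_le,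
          hg.base, hg.bag, hg.tops⟩
      have e54₁ : s₁.reg 54 = i := (hA₁.1 54 rfl).trans (by simpa using h54)
      have e55₁ : s₁.reg 55 = x := (hA₁.1 55 rfl).trans (by simp)
      have a1₁ : s₁.arr 1 = s.arr 1 := (hA₁.2 1 rfl).trans a1
      have a2₁ : s₁.arr 2 = s.arr 2 := (hA₁.2 2 rfl).trans a2
      have a15₁ : s₁.arr 15 = s.arr 15 := (hA₁.2 15 rfl).trans a15
      have a6₁ : s₁.arr 6 = s'.arr 6 := hA₁.2 6 rfl
      simp only [e54₁, hg₁.reg_n, hg₁.reg_zero, hg₁.reg_one, a1₁]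
      have hinit : Generated n ((((s₁.setReg 44 (n + 0)).setReg 56 (s.arr 1 i)).setReg 57
          (i + 1)).setReg 57 (s.arr 1 (i + 1))) :=
        ⟨hg₁.reg_n, hg₁.reg_zero, hg₁.reg_one, hg₁.fam, hg₁.nodup, hg₁.off_zero, hg₁.off_le,
          hg₁.base, hg₁.bag, hg₁.tops⟩
      have hlow := runs_lowerProg (W := W) hinit hi (by omega) (ε := s₁.reg 43) (by simp)
        (by simp [e55₁, a15₁, hx]) (by simp [a1₁]) (by simp [a1₁]) (by simp)
      simp only [State.setReg_arr, a1₁, a2₁, a15₁] at hlow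
      have hlen₁ : s₁.reg 43 = s'.reg 43 +
        (upperNeighbors n (segment (s.arr 1) (s.arr 2)) (s.arr 15) i).length := h43₁
      refine ⟨by omega, by omega, (hlow (by omega)).mono ?_⟩
      rintro s₂ t₂ hA₂ ⟨ht₂, h43₂, happ₂⟩
      have e54₂ : s₂.reg 54 = i := (hA₂.1 54 rfl).trans (by simpa using e54₁)
      have e31₂ : s₂.reg 31 = 1 := (hA₂.1 31 rfl).trans (by simpa using hg₁.reg_one)
      have a6₂ : s₂.arr 6 = s'.arr 6 := (hA₂.2 6 rfl).trans a6₁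
      have happ : Appended (s'.arr 7) (s₂.arr 7) (s'.reg 43) (A i) := by
        rw [hAi]
        rw [h43₁] at happ₂
        exact Appended.trans happ₁ happ₂
      have h43' : s₂.reg 43 = s'.reg 43 + (A i).length := by omega
      have hseglen : (segment (s.arr 1) (s.arr 2) i).length + s.arr 1 i = s.arr 1 (i + 1) := by
        have := h.off_le i hi
        rw [segment_eq, length_seg]; omega
      have hst' := hst.succ happ
      rw [← h43'] at hst'
      simp only [State.setReg_reg, State.setReg_arr, State.setArr_reg, State.setArr_arr, e54₂, e31₂,
        a6₂, reduceIte, Nat.reduceEqDiff]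
      refine ⟨by omega, trivial, ?_, by omega, hst'⟩
      rw [Finset.sum_range_succ, ← h43, h43']
  · rintro s' T hA ⟨h54, -⟩
    have e2 : s'.reg 2 = n := (hA.1 2 rfl).trans (by simpa using h.reg_n)
    simp only [Test.Holds]; omega
  · rintro s' t - ⟨T, rfl, h54, h43, hT, hst⟩
    exact ⟨by rw [← h43]; omega, _, hst⟩

/-! ### Lists of neighbours -/

theorem row_inj {n y j y' j' : ℕ} (hj : j < n) (hj' : j' < n) :
    y' * n + j' = y * n + j ↔ y' = y ∧ j' = j := by
  constructor
  · intro h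
    have key : ∀ a b i k : ℕ, i < n → k < n → a * n + i = b * n + k → a ≤ b := by
      intro a b i k hi hk hab
      by_contra hlt
      have : (b + 1) * n ≤ a * n := Nat.mul_le_mul_right n (by omega)
      rw [Nat.add_one_mul] at this
      omega
    have h1 := key _ _ _ _ hj' hj h
    have h2 := key _ _ _ _ hj hj' h.symm
    obtain rfl := le_antisymm h1 h2
    exact ⟨rfl, by omega⟩
  · rintro ⟨rfl, rfl⟩; rfl

theorem update_row {n y j y' j' : ℕ} (f : ℕ → ℕ) (w : ℕ) (hj : j < n) (hj' : j' < n) :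
    Function.update f (y * n + j) w (y' * n + j') =
      if y' = y ∧ j' = j then w else f (y' * n + j') := by
  rw [Function.update_apply]
  simp only [row_inj hj hj']

theorem seg_update_row {n y j y' k : ℕ} (f : ℕ → ℕ) (w : ℕ) (hj : j < n) (hk : k ≤ n)
    (hne : y' ≠ y) : seg (Function.update f (y * n + j) w) (y' * n) k = seg f (y' * n) k :=
  seg_congr fun i hi => by
    rw [update_row f w hj (by omega), if_neg fun h => hne h.1]

/-- The first `deg y` cells of row `y` of the array `nbr` list the nodes that `y` is joined to by
the relation `A`, and cell `z` of row `y` of the array `pos` holds the place of `z` in this list. -/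
structure Rows (n : ℕ) (A : ℕ → ℕ → Prop) (deg nbr pos : ℕ → ℕ) : Prop where
  deg_lt : ∀ y < n, deg y < n
  fwd : ∀ y < n, ∀ z < n, A y z → pos (y * n + z) < deg y ∧ nbr (y * n + pos (y * n + z)) = z
  bwd : ∀ y < n, ∀ j < deg y,
    nbr (y * n + j) < n ∧ A y (nbr (y * n + j)) ∧ pos (y * n + nbr (y * n + j)) = j

/-- The neighbour `z` is moved from its place `j` in row `y` to the place `c`. -/
theorem Rows.swap {n : ℕ} {A : ℕ → ℕ → Prop} {deg nbr pos : ℕ → ℕ} (h : Rows n A deg nbr pos)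
    {y z c : ℕ} (hy : y < n) (hz : z < n) (hA : A y z) (hc : c < deg y)
    (hlive : pos (y * n + z) ≤ c) {nbr' pos' : ℕ → ℕ}
    (hnbr : nbr' = Function.update
      (Function.update nbr (y * n + pos (y * n + z)) (nbr (y * n + c))) (y * n + c) z)
    (hpos : pos' = Function.update
      (Function.update pos (y * n + nbr (y * n + c)) (pos (y * n + z))) (y * n + z) c) :
    Rows n A deg nbr' pos' ∧
      (∀ u < n, A y u → (pos' (y * n + u) < c ↔ pos (y * n + u) < c + 1 ∧ u ≠ z)) ∧
      ∀ y' ≠ y, ∀ u < n, pos' (y' * n + u) = pos (y' * n + u) := by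
  have hdn := h.deg_lt y hy
  obtain ⟨hj, hjz⟩ := h.fwd y hy z hz hA
  obtain ⟨hw, hAw, hwc⟩ := h.bwd y hy c hc
  set j := pos (y * n + z) with hjdef
  set w := nbr (y * n + c) with hwdef
  have enbr : ∀ y' k, k < n → nbr' (y' * n + k) = if y' = y ∧ k = c then z else
      if y' = y ∧ k = j then w else nbr (y' * n + k) := fun y' k hk => by
    rw [hnbr, update_row _ _ (by omega) hk, update_row _ _ (by omega) hk]
  have epos : ∀ y' u, u < n → pos' (y' * n + u) = if y' = y ∧ u = z then c else
      if y' = y ∧ u = w then j else pos (y' * n + u) := fun y' u hu => by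
    rw [hpos, update_row _ _ hz hu, update_row _ _ hw hu]
  refine ⟨⟨h.deg_lt, ?_, ?_⟩, ?_, ?_⟩
  · intro y' hy' u hu hAu
    obtain ⟨h1, h2⟩ := h.fwd y' hy' u hu hAu
    have hd' := h.deg_lt y' hy'
    rw [epos _ _ hu]
    split_ifs with c1 c2
    · obtain ⟨rfl, rfl⟩ := c1
      exact ⟨hc, by rw [enbr _ _ (by omega)]; simp⟩
    · obtain ⟨rfl, rfl⟩ := c2
      refine ⟨hj, ?_⟩
      rw [enbr _ _ (by omega)]
      by_cases hjc : j = c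
      · exact absurd ⟨rfl, by rw [hwdef, ← hjc, hjz]⟩ c1
      · simp [hjc]
    · refine ⟨h1, ?_⟩
      rw [enbr _ _ (by omega)]
      split_ifs with c3 c4
      · obtain ⟨rfl, h3⟩ := c3
        exact absurd ⟨rfl, by rw [hwdef, ← h3, h2]⟩ c2
      · obtain ⟨rfl, h3⟩ := c4
        exact absurd ⟨rfl, by rw [← hjz, ← h3, h2]⟩ c1
      · exact h2
  · intro y' hy' k hk
    have hd' := h.deg_lt y' hy'
    obtain ⟨h1, h2, h3⟩ := h.bwd y' hy' k hk
    rw [enbr _ _ (by omega)]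
    split_ifs with c1 c2
    · obtain ⟨rfl, rfl⟩ := c1
      exact ⟨hz, hA, by rw [epos _ _ hz]; simp⟩
    · obtain ⟨rfl, rfl⟩ := c2
      refine ⟨hw, hAw, ?_⟩
      rw [epos _ _ hw]
      by_cases hwz : w = z
      · exact absurd ⟨rfl, by rw [hjdef, ← hwz, hwc]⟩ c1
      · simp [hwz]
    · refine ⟨h1, h2, ?_⟩
      rw [epos _ _ h1]
      split_ifs with c3 c4
      · obtain ⟨rfl, h4⟩ := c3
        exact absurd ⟨rfl, by rw [hjdef, ← h4, h3]⟩ c2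
      · obtain ⟨rfl, h4⟩ := c4
        exact absurd ⟨rfl, by rw [← hwc, ← h4, h3]⟩ c1
      · exact h3
  · intro u hu hAu
    rw [epos _ _ hu]
    by_cases huz : u = z
    · simp [huz]
    · simp only [huz, and_false, if_false, true_and, ne_eq, not_false_eq_true, and_true]
      split_ifs with huw
      · subst huw
        have hjc : j ≠ c := fun hjc => huz (by rw [← hjz, hjc])
        omega
      · have : pos (y * n + u) ≠ c := fun hc' => by
          have := (h.fwd y hy u hu hAu).2
          rw [hc'] at this
          exact huw this.symm
        omega
  · intro y' hne u hu
    rw [epos _ _ hu]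
    simp [hne]

/-! ### The host tree -/

/-- The lists of neighbours when the nodes `0, …, v - 1` of the host tree exist. -/
structure HostRows (n v : ℕ) (par deg nbr pos : ℕ → ℕ) : Prop where
  isParent : IsParent v par
  rows : Rows n (fun y z => y < v ∧ z < v ∧ Joined par y z) deg nbr pos
  deg_lt : ∀ y < v, deg y < v
  deg_eq : ∀ y, v ≤ y → deg y = 0

theorem HostRows.start {n : ℕ} (hn : 0 < n) {deg : ℕ → ℕ} (par nbr pos : ℕ → ℕ)
    (hdeg : ∀ y, deg y = 0) : HostRows n 1 par deg nbr pos where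
  isParent v h0 h1 := by omega
  rows := by
    refine ⟨fun y hy => by rw [hdeg]; exact hn, ?_, fun y _ j hj => by rw [hdeg] at hj; omega⟩
    rintro y - z - ⟨hy, hz, hj⟩
    rcases hj with hj | hj <;> omega
  deg_lt y _ := by rw [hdeg]; exact one_pos
  deg_eq y _ := hdeg y

theorem HostRows.step {n v x : ℕ} {par deg nbr pos : ℕ → ℕ} (h : HostRows n v par deg nbr pos)
    (hv : v < n) (hx : x < v) :
    HostRows n (v + 1) (Function.update par v x)
      (Function.update (Function.update deg x (deg x + 1)) v 1)
      (Function.update (Function.update nbr (x * n + deg x) v) (v * n) x)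
      (Function.update (Function.update pos (x * n + v) (deg x)) (v * n + x) 0) := by
  have hdx := h.deg_lt x hx
  have hdv := h.deg_eq v le_rfl
  have edeg : ∀ y, Function.update (Function.update deg x (deg x + 1)) v 1 y =
      if y = v then 1 else if y = x then deg x + 1 else deg y := fun y => by
    rw [Function.update_apply, Function.update_apply]
  have enbr : ∀ y j, j < n → Function.update (Function.update nbr (x * n + deg x) v) (v * n) x
      (y * n + j) = if y = v ∧ j = 0 then x else if y = x ∧ j = deg x then v else
        nbr (y * n + j) := fun y j hj => by
    have := update_row (n := n) (y := v) (j := 0) (y' := y)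
      (Function.update nbr (x * n + deg x) v) x (by omega) hj
    rw [Nat.add_zero] at this
    rw [this, update_row _ _ (by omega) hj]
  have epos : ∀ y u, u < n → Function.update (Function.update pos (x * n + v) (deg x)) (v * n + x) 0
      (y * n + u) = if y = v ∧ u = x then 0 else if y = x ∧ u = v then deg x else
        pos (y * n + u) := fun y u hu => by
    rw [update_row _ _ (by omega) hu, update_row _ _ hv hu]
  have hjoin : ∀ y z, (y < v + 1 ∧ z < v + 1 ∧ Joined (Function.update par v x) y z) ↔
      (y = x ∧ z = v) ∨ (y = v ∧ z = x) ∨ (y < v ∧ z < v ∧ Joined par y z) := by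
    intro y z
    by_cases hy : y = v <;> by_cases hz : z = v
    · subst hy; subst hz
      simp only [Joined, Function.update_self]
      omega
    · subst hy
      simp only [Joined, Function.update_self, Function.update_of_ne hz]
      have := h.isParent z
      grind
    · subst hz
      simp only [Joined, Function.update_self, Function.update_of_ne hy]
      have := h.isParent y
      grind
    · simp only [Joined, Function.update_of_ne hy, Function.update_of_ne hz]
      omega
  refine ⟨?_, ⟨?_, ?_, ?_⟩, ?_, ?_⟩
  · intro u h0 hu
    rw [Function.update_apply]
    split_ifs with h1
    · omega
    · exact h.isParent u h0 (by omega)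
  · intro y hy
    rw [edeg]
    have := h.rows.deg_lt y hy
    split_ifs <;> omega
  · intro y hy z hz hA
    rw [hjoin] at hA
    have hp := epos y z hz
    have hd := edeg y
    rcases hA with ⟨rfl, rfl⟩ | ⟨rfl, rfl⟩ | hA
    · rw [if_neg (by omega), if_pos ⟨rfl, rfl⟩] at hp
      rw [if_neg (by omega), if_pos rfl] at hd
      rw [hp, hd]
      refine ⟨by omega, ?_⟩
      rw [enbr _ _ (by omega), if_neg (by omega), if_pos ⟨rfl, rfl⟩]
    · rw [if_pos ⟨rfl, rfl⟩] at hp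
      rw [if_pos rfl] at hd
      rw [hp, hd]
      refine ⟨by omega, ?_⟩
      rw [enbr _ _ (by omega), if_pos ⟨rfl, rfl⟩]
    · obtain ⟨h1, h2⟩ := h.rows.fwd y hy z hz hA
      have hdy := h.rows.deg_lt y hy
      rw [if_neg (by omega), if_neg (by omega)] at hp
      rw [if_neg (by omega)] at hd
      rw [hp, hd]
      refine ⟨by split_ifs <;> (try subst y) <;> omega, ?_⟩
      rw [enbr _ _ (by omega), if_neg (by omega), if_neg, h2]
      rintro ⟨rfl, h3⟩
      omega
  · intro y hy j hj
    rw [edeg] at hj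
    rw [hjoin]
    have hdy := h.rows.deg_lt y hy
    by_cases hyv : y = v
    · subst hyv
      rw [if_pos rfl] at hj
      obtain rfl : j = 0 := by omega
      rw [enbr _ _ (by omega), if_pos ⟨rfl, rfl⟩]
      refine ⟨by omega, by simp, ?_⟩
      rw [epos _ _ (by omega), if_pos ⟨rfl, rfl⟩]
    · rw [if_neg hyv] at hj
      have hjn : j < n := by split_ifs at hj <;> omega
      rw [enbr _ _ hjn, if_neg (by omega)]
      by_cases hyx : y = x ∧ j = deg x
      · obtain ⟨rfl, rfl⟩ := hyx
        rw [if_pos ⟨rfl, rfl⟩]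
        refine ⟨hv, by simp, ?_⟩
        rw [epos _ _ hv, if_neg (by omega), if_pos ⟨rfl, rfl⟩]
      · rw [if_neg hyx]
        obtain ⟨h1, h2, h3⟩ := h.rows.bwd y hy j (by split_ifs at hj <;> (try subst y) <;> omega)
        refine ⟨h1, Or.inr (Or.inr h2), ?_⟩
        rw [epos _ _ h1, if_neg (by omega), if_neg (by omega), h3]
  · intro y hy
    rw [edeg]
    split_ifs
    · omega
    · omega
    · have := h.deg_lt y (by omega); omega
  · intro y hy
    rw [edeg, if_neg (by omega), if_neg (by omega)]
    exact h.deg_eq y (by omega)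

/-! ### Growing a subtree -/

/-- The first `a` cells of an array list the elements of a set, each of them once. -/
def Lists (f : ℕ → ℕ) (a : ℕ) (X : ℕ → Prop) : Prop :=
  (∀ v, X v ↔ ∃ r < a, f r = v) ∧ ∀ r < a, ∀ r' < a, f r = f r' → r = r'

theorem Lists.congr {f : ℕ → ℕ} {a : ℕ} {X Y : ℕ → Prop} (h : Lists f a X)
    (hXY : ∀ v, Y v ↔ X v) : Lists f a Y :=
  ⟨fun v => (hXY v).trans (h.1 v), h.2⟩

theorem Lists.remove {f : ℕ → ℕ} {a r : ℕ} {X : ℕ → Prop} (h : Lists f a X) (hr : r < a) :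
    Lists (Function.update f r (f (a - 1))) (a - 1) fun v => X v ∧ v ≠ f r := by
  have hinj := h.2
  refine ⟨fun v => ?_, ?_⟩
  · show X v ∧ v ≠ f r ↔ _
    rw [h.1]
    constructor
    · rintro ⟨⟨q, hq, rfl⟩, hne⟩
      by_cases hqa : q = a - 1
      · subst hqa
        exact ⟨r, by by_contra hc; exact hne (by congr 1; omega), by simp⟩
      · exact ⟨q, by omega, by rw [Function.update_of_ne]; rintro rfl; exact hne rfl⟩
    · rintro ⟨q, hq, rfl⟩
      rw [Function.update_apply]
      split_ifs with h1
      · exact ⟨⟨a - 1, by omega, rfl⟩, fun hc => by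
          have := hinj _ (by omega) _ hr hc; omega⟩
      · exact ⟨⟨q, by omega, rfl⟩, fun hc => h1 (hinj _ (by omega) _ hr hc)⟩
  · intro q hq q' hq' heq
    rw [Function.update_apply, Function.update_apply] at heq
    split_ifs at heq with h1 h2 h2
    · omega
    · have := hinj _ (by omega) _ (by omega) heq; omega
    · have := hinj _ (by omega) _ (by omega) heq; omega
    · exact hinj _ (by omega) _ (by omega) heq

theorem Lists.add {f : ℕ → ℕ} {a z : ℕ} {X : ℕ → Prop} (h : Lists f a X) (hz : ¬ X z) :
    Lists (Function.update f a z) (a + 1) fun v => X v ∨ v = z := by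
  rw [h.1] at hz
  have hne : ∀ q < a, f q ≠ z := fun q hq hc => hz ⟨q, hq, hc⟩
  refine ⟨fun v => ?_, ?_⟩
  · show X v ∨ v = z ↔ _
    rw [h.1]
    constructor
    · rintro (⟨q, hq, rfl⟩ | rfl)
      · exact ⟨q, by omega, Function.update_of_ne (by omega) _ _⟩
      · exact ⟨a, by omega, by simp⟩
    · rintro ⟨q, hq, rfl⟩
      by_cases hqa : q = a
      · subst hqa; simp
      · exact Or.inl ⟨q, by omega, (Function.update_of_ne hqa _ _).symm⟩
  · intro q hq q' hq' heq
    rw [Function.update_apply, Function.update_apply] at heq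
    split_ifs at heq with h1 h2 h2
    · omega
    · exact absurd heq.symm (hne q' (by omega))
    · exact absurd heq (hne q (by omega))
    · exact h.2 _ (by omega) _ (by omega) heq

/-- The data structure for a growing subtree `S`. The first `cnt y` cells of the list of neighbours
of `y` hold those outside of `S` if `y` is in `S`, and all of them if `y` is not in `S`; the first
`a` cells of the array `act` list the nodes of `S` with neighbours outside of `S`. -/
structure Growth (n : ℕ) (par deg cnt nbr pos act : ℕ → ℕ) (a : ℕ) (S : Set ℕ) : Prop where
  isParent : IsParent n par
  rows : Rows n (Joined par) deg nbr pos
  lt : ∀ y ∈ S, y < n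
  rooted : ∃ t, RootedAt par S t
  cnt_le : ∀ y < n, cnt y ≤ deg y
  cnt_eq : ∀ y < n, y ∉ S → cnt y = deg y
  live : ∀ y ∈ S, ∀ u < n, Joined par y u → (pos (y * n + u) < cnt y ↔ u ∉ S)
  act : Lists act a fun v => v ∈ S ∧ 0 < cnt v

theorem not_joined_self {n : ℕ} {par : ℕ → ℕ} (hp : IsParent n par) {y : ℕ} (hy : y < n) :
    ¬ Joined par y y := by
  rintro (⟨h0, h1⟩ | ⟨h0, h1⟩) <;> have := hp y h0 hy <;> omega

theorem Growth.start {n : ℕ} {par deg cnt nbr pos act : ℕ → ℕ} {a x : ℕ}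
    (hp : IsParent n par) (hR : Rows n (Joined par) deg nbr pos) (hx : x < n)
    (hcnt : ∀ y < n, cnt y = deg y) (hact : Lists act a fun v => v = x ∧ 0 < cnt v) :
    Growth n par deg cnt nbr pos act a {x} where
  isParent := hp
  rows := hR
  lt y hy := by obtain rfl := hy; exact hx
  rooted := ⟨x, rfl, fun a ha hax => absurd ha hax⟩
  cnt_le y hy := (hcnt y hy).le
  cnt_eq y hy _ := hcnt y hy
  live := by
    rintro y rfl u hu hj
    rw [hcnt y hx]
    refine iff_of_true (hR.fwd y hx u hu hj).1 ?_
    rintro rfl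
    exact not_joined_self hp hx hj
  act := hact

theorem Growth.pos_of_joined {n : ℕ} {par deg cnt nbr pos act : ℕ → ℕ} {a : ℕ} {S : Set ℕ}
    (h : Growth n par deg cnt nbr pos act a S) {y z : ℕ} (hy : y ∈ S) (hz : z < n) (hzS : z ∉ S)
    (hj : Joined par y z) :
    pos (y * n + z) < cnt y ∧ nbr (y * n + pos (y * n + z)) = z :=
  ⟨(h.live y hy z hz hj).2 hzS, (h.rows.fwd y (h.lt y hy) z hz hj).2⟩

theorem Growth.of_lt_cnt {n : ℕ} {par deg cnt nbr pos act : ℕ → ℕ} {a : ℕ} {S : Set ℕ}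
    (h : Growth n par deg cnt nbr pos act a S) {y j : ℕ} (hy : y ∈ S) (hj : j < cnt y) :
    nbr (y * n + j) < n ∧ nbr (y * n + j) ∉ S ∧ Joined par y (nbr (y * n + j)) ∧
      pos (y * n + nbr (y * n + j)) = j := by
  have hyn := h.lt y hy
  obtain ⟨h1, h2, h3⟩ := h.rows.bwd y hyn j (hj.trans_le (h.cnt_le y hyn))
  exact ⟨h1, (h.live y hy _ h1 h2).1 (by omega), h2, h3⟩

/-- Adding the node `z` at place `j` in the list of neighbours of `y ∈ S`: first `z` is removed from
the live part of row `y`, which turns `nbr, pos` into `nbr₁, pos₁`, and then `y` from that of row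
`z`. It is essential that `y` is the only neighbour of `z` in `S`. -/
theorem Growth.step {n : ℕ} {par deg cnt nbr pos act : ℕ → ℕ} {a : ℕ} {S : Set ℕ}
    (h : Growth n par deg cnt nbr pos act a S) {y j z : ℕ} (hy : y ∈ S) (hj : j < cnt y)
    (hz : nbr (y * n + j) = z) {nbr₁ pos₁ nbr₂ pos₂ act' cnt' : ℕ → ℕ} {a' : ℕ}
    (hnbr₁ : nbr₁ = Function.update
      (Function.update nbr (y * n + j) (nbr (y * n + (cnt y - 1)))) (y * n + (cnt y - 1)) z)
    (hpos₁ : pos₁ = Function.update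
      (Function.update pos (y * n + nbr (y * n + (cnt y - 1))) j) (y * n + z) (cnt y - 1))
    (hnbr₂ : nbr₂ = Function.update
      (Function.update nbr₁ (z * n + pos₁ (z * n + y)) (nbr₁ (z * n + (cnt z - 1))))
        (z * n + (cnt z - 1)) y)
    (hpos₂ : pos₂ = Function.update
      (Function.update pos₁ (z * n + nbr₁ (z * n + (cnt z - 1))) (pos₁ (z * n + y)))
        (z * n + y) (cnt z - 1))
    (hcnt : cnt' = Function.update (Function.update cnt y (cnt y - 1)) z (cnt z - 1))
    (hact : Lists act' a' fun v => v ∈ insert z S ∧ 0 < cnt' v) :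
    Growth n par deg cnt' nbr₂ pos₂ act' a' (insert z S) := by
  have hyn := h.lt y hy
  obtain ⟨hzn, hzS, hyz, hposz⟩ := h.of_lt_cnt hy hj
  rw [hz] at hzn hzS hyz hposz
  have hzy : z ≠ y := by rintro rfl; exact hzS hy
  have hcy := h.cnt_le y hyn
  have hcz := h.cnt_eq z hzn hzS
  obtain ⟨hR₁, hlive₁, hother₁⟩ := h.rows.swap hyn hzn hyz (c := cnt y - 1) (by omega)
    (by omega) (nbr' := nbr₁) (pos' := pos₁) (by rw [hposz]; exact hnbr₁)
    (by rw [hposz]; exact hpos₁)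
  obtain ⟨hlt₁, -⟩ := hR₁.fwd z hzn y hyn hyz.symm
  obtain ⟨hR₂, hlive₂, hother₂⟩ := hR₁.swap hzn hyn hyz.symm (c := cnt z - 1) (by omega)
    (by omega) hnbr₂ hpos₂
  obtain ⟨t, ht⟩ := h.rooted
  have ecnt : ∀ v, cnt' v = if v = z then cnt z - 1 else if v = y then cnt y - 1 else cnt v :=
    fun v => by rw [hcnt, Function.update_apply, Function.update_apply]
  refine ⟨h.isParent, hR₂, ?_, ht.insert hy hzS hyz, ?_, ?_, ?_, hact⟩
  · rintro v (rfl | hv)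
    · exact hzn
    · exact h.lt v hv
  · intro v hv
    have := h.cnt_le v hv
    rw [ecnt]
    split_ifs with h1 h2
    · subst h1; omega
    · subst h2; omega
    · exact this
  · intro v hv hvS
    rw [ecnt, if_neg fun hc => hvS (Or.inl hc), if_neg (by rintro rfl; exact hvS (Or.inr hy))]
    exact h.cnt_eq v hv fun hc => hvS (Or.inr hc)
  · rintro v hvS u hu hvu
    rw [ecnt]
    by_cases hvz : v = z
    · subst hvz
      rw [if_pos rfl, hlive₂ u hu hvu, Nat.sub_add_cancel (by omega)]
      have h1 : pos₁ (v * n + u) < cnt v := by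
        rw [hcz]; exact (hR₁.fwd v hzn u hu hvu).1
      have h2 : u ≠ v := by rintro rfl; exact not_joined_self h.isParent hu hvu
      constructor
      · rintro ⟨-, h3⟩ (h4 | h4)
        · exact h2 h4
        · exact h3 (ht.joined_unique h.isParent h.lt hzn h4 hy hzS hvu.symm hyz)
      · exact fun h3 => ⟨h1, fun hc => h3 (Or.inr (hc ▸ hy))⟩
    · have hv : v ∈ S := hvS.resolve_left hvz
      rw [if_neg hvz, hother₂ v hvz u hu]
      by_cases hvy : v = y
      · subst hvy
        rw [if_pos rfl, hlive₁ u hu hvu, Nat.sub_add_cancel (by omega), h.live v hv u hu hvu]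
        simp only [Set.mem_insert_iff, not_or]
        tauto
      · rw [if_neg hvy, hother₁ v hvy u hu, h.live v hv u hu hvu, Set.mem_insert_iff, not_or]
        refine ⟨fun h1 => ⟨?_, h1⟩, fun h1 => h1.2⟩
        rintro rfl
        exact hvy (ht.joined_unique h.isParent h.lt hzn hv hy hzS hvu hyz)

/-! ### The program for the host tree -/

/-- Generate the host tree with the lists of neighbours of its nodes. -/
def hostProg : Cmd := block
  [.const 31 1, .add 2 0 30, .const 3 1,
   .loop (.lt 3 2) (.seq (block [.sub 5 3 31]) (.seq (.rand 6 30 5) (block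
    [.store 0 3 6, .add 4 4 2, .store 20 3 4,
     .load 7 20 6, .load 8 8 6, .add 9 7 8, .store 10 9 3, .add 9 7 3, .store 11 9 8,
     .add 8 8 31, .store 8 6 8, .store 9 6 8,
     .store 10 4 6, .add 9 4 6, .store 11 9 30, .store 8 3 31, .store 9 3 31,
     .add 3 3 31])))]

/-- One step of the growth of the host tree. -/
noncomputable def hostStep (j : ℕ) (T : SimpleGraph ℕ) : PMF (SimpleGraph ℕ) :=
  (PMF.uniformOfFinset (Finset.range (j + 1)) Finset.nonempty_range_add_one).map fun x =>
    T ⊔ SimpleGraph.edge x (j + 1)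

theorem growHost_eq (m : ℕ) : ChordalGen.growHost m = iterLaw hostStep 0 m ⊥ := by
  induction m with
  | zero => rfl
  | succ m ih => rw [iterLaw_succ, ← ih, Nat.zero_add]; rfl

/-- The data that is available when the host tree has been generated. -/
structure HostReady (n k : ℕ) (s : State) : Prop where
  reg_k : s.reg 1 = k
  reg_n : s.reg 2 = n
  reg_zero : s.reg 30 = 0
  reg_one : s.reg 31 = 1
  isParent : IsParent n (s.arr 0)
  rows : Rows n (Joined (s.arr 0)) (s.arr 8) (s.arr 10) (s.arr 11)
  cnt_eq : ∀ y < n, s.arr 9 y = s.arr 8 y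
  base : ∀ x < n, s.arr 20 x = x * n

/-- The invariant of the loop of `hostProg` when the nodes `0, …, j` exist. -/
structure HostInv (n j : ℕ) (T : SimpleGraph ℕ) (s : State) : Prop where
  reg_v : s.reg 3 = j + 1
  reg_base : s.reg 4 = j * n
  rows : HostRows n (j + 1) (s.arr 0) (s.arr 8) (s.arr 10) (s.arr 11)
  cnt_eq : s.arr 9 = s.arr 8
  base : ∀ x < j + 1, s.arr 20 x = x * n
  adj : ∀ u w, T.Adj u w ↔ u < j + 1 ∧ w < j + 1 ∧ Joined (s.arr 0) u w

theorem HostInv.adj_step {j x : ℕ} {T : SimpleGraph ℕ} {par : ℕ → ℕ}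
    (hp : IsParent (j + 1) par)
    (hT : ∀ u w, T.Adj u w ↔ u < j + 1 ∧ w < j + 1 ∧ Joined par u w) (hx : x < j + 1) (u w : ℕ) :
    (T ⊔ SimpleGraph.edge x (j + 1)).Adj u w ↔
      u < j + 1 + 1 ∧ w < j + 1 + 1 ∧ Joined (Function.update par (j + 1) x) u w := by
  have h1 := hp u
  have h2 := hp w
  rw [SimpleGraph.sup_adj, hT, SimpleGraph.edge_adj]
  simp only [Joined, Function.update_apply]
  grind

theorem runs_hostBody {W n j x : ℕ} {T : SimpleGraph ℕ} {s : State} (h : HostInv n j T s)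
    (hn : s.reg 2 = n) (h0 : s.reg 30 = 0) (h1 : s.reg 31 = 1) (h6 : s.reg 6 = x) (hx : x < j + 1)
    (hj : j + 1 < n) (hW : n * n + n ≤ W) :
    Runs W (block
      [.store 0 3 6, .add 4 4 2, .store 20 3 4,
       .load 7 20 6, .load 8 8 6, .add 9 7 8, .store 10 9 3, .add 9 7 3, .store 11 9 8,
       .add 8 8 31, .store 8 6 8, .store 9 6 8,
       .store 10 4 6, .add 9 4 6, .store 11 9 30, .store 8 3 31, .store 9 3 31,
       .add 3 3 31]) s fun s' t =>
      t ≤ 19 ∧ HostInv n (j + 1) (T ⊔ SimpleGraph.edge x (j + 1)) s' := by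
  have hstep := h.rows.step hj hx
  have hdeg := h.rows.deg_lt x hx
  have hb := h.base x hx
  have hxn := mul_add_le (n := n) (x := x) (k := s.arr 8 x) (by omega) (by omega)
  have hxv := mul_add_le (n := n) (x := x) (k := j + 1) (by omega) (by omega)
  have hjn := mul_add_le (n := n) (x := j + 1) (k := x) hj (by omega)
  have hmul : (j + 1) * n = j * n + n := Nat.add_one_mul _ _
  have hne : x ≠ j + 1 := by omega
  refine Runs.of_wp ?_
  simp [block, wp, h.reg_v, h.reg_base, hn, h0, h1, h6, Function.update_of_ne hne, hb]
  refine ⟨by omega, by omega, by omega, by omega, by omega, by omega, ?_⟩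
  refine ⟨by simp, by simp [hmul], ?_, by simp [h.cnt_eq], ?_, ?_⟩
  · simpa [hmul] using hstep
  · intro y hy
    simp only [State.setReg_arr, State.setArr_arr, reduceIte, Nat.reduceEqDiff]
    rw [Function.update_apply]
    split_ifs with hyj
    · rw [hyj, hmul]
    · exact h.base y (by omega)
  · simpa using HostInv.adj_step h.rows.isParent h.adj hx

theorem sim_hostProg {W n k : ℕ} [NeZero n] (hk : k ≤ n) (hW : n * n + n + 1 ≤ W) :
    Sim W hostProg (State.input n k) (ChordalGen.hostTreeLaw n) fun T s t =>
      t ≤ 30 * n ∧ T = parentGraph n (s.arr 0) ∧ HostReady n k s := by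
  have hn : 0 < n := Nat.pos_of_ne_zero (NeZero.ne n)
  rw [ChordalGen.hostTreeLaw, growHost_eq]
  refine Sim.map (Q := fun T s t => t ≤ 30 * n ∧ HostInv n (n - 1) T s ∧ s.reg 2 = n ∧
    s.reg 31 = 1) _ ?_ ?_
  · refine Runs.seq_sim (Runs.of_wp ⟨by omega, ?_⟩)
    refine Runs.seq_sim (Runs.of_wp ⟨by simp [State.input]; omega, ?_⟩)
    refine Runs.seq_sim (Runs.of_wp ⟨by omega, ?_⟩)
    refine Sim.seq_runs ((Sim.loop hostStep (n - 1) ⊥ (fun j T s' t => t ≤ 24 * j ∧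
      HostInv n j T s') ?_ ?_ ?_).mono ?_)
    · refine ⟨by simp, by simp, by simp [State.input], ?_, rfl, ?_, ?_⟩
      · exact .start hn _ _ _ fun y => rfl
      · intro x hx
        obtain rfl : x = 0 := by omega
        simp [State.input]
      · intro u w
        simp [Joined]
        omega
    · rintro j T s' t hj hA ⟨ht, hI⟩
      have e2 : s'.reg 2 = n := (hA.1 2 rfl).trans (by simp [State.input])
      have e30 : s'.reg 30 = 0 := (hA.1 30 rfl).trans (by simp [State.input])
      have e31 : s'.reg 31 = 1 := (hA.1 31 rfl).trans (by simp)
      refine ⟨by simp only [Test.Holds, hI.reg_v, e2]; omega, ?_⟩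
      refine Runs.seq_sim (Runs.of_wp ?_)
      simp only [block, wp]
      refine Sim.map (Q := fun x s'' t' => t' ≤ 20 ∧
        HostInv n (j + 1) (T ⊔ SimpleGraph.edge x (j + 1)) s'') _ (Sim.seq_runs
          ((Sim.rand _ id (by simp [e30]) ?_).mono ?_)) ?_
      · convert Set.bijOn_id _ using 1
        ext v
        simp [e30, hI.reg_v, e31]
      · rintro x s'' t' hx - ⟨rfl, v, -, hv, rfl, rfl⟩
        simp [e31, hI.reg_v] at hv
        refine (runs_hostBody (W := W) (n := n) (j := j) (x := id v) (T := T) ?_ ?_ ?_ ?_ ?_ ?_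
          (by omega)
          (by omega)).mono ?_
        · exact ⟨hI.reg_v, hI.reg_base, hI.rows, hI.cnt_eq, hI.base, hI.adj⟩
        · simpa using e2
        · simpa using e30
        · simpa using e31
        · simp
        · simp; omega
        · rintro s3 t3 - ⟨h1, h2⟩
          exact ⟨by omega, h2⟩
      · rintro x s'' t' - ⟨h1, h2⟩
        exact ⟨by omega, h2⟩
    · rintro T s' t hA ⟨-, hI⟩
      have e2 : s'.reg 2 = n := (hA.1 2 rfl).trans (by simp [State.input])
      simp only [Test.Holds, hI.reg_v, e2]; omega
    · rintro T s' t - hA ⟨t', rfl, ht, hI⟩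
      have e2 : s'.reg 2 = n := (hA.1 2 rfl).trans (by simp [State.input])
      have e31 : s'.reg 31 = 1 := (hA.1 31 rfl).trans (by simp)
      refine Runs.of_wp ⟨by omega, hI, e2, e31⟩
  · rintro T s t hA ⟨ht, hI, h2, h31⟩
    have hsub : n - 1 + 1 = n := by omega
    have hrows := hI.rows
    have hbase := hI.base
    have hadj := hI.adj
    rw [hsub] at hrows hbase hadj
    refine ⟨ht, ?_, (hA.1 1 rfl).trans rfl, h2, (hA.1 30 rfl).trans rfl, h31, hrows.isParent, ?_,
      fun y _ => congrFun hI.cnt_eq y, hbase⟩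
    · ext u w
      rw [SimpleGraph.comap_adj, hadj, parentGraph_adj hrows.isParent]
      simp
    · obtain ⟨h1, h2, h3⟩ := hrows.rows
      exact ⟨h1, fun y hy z hz hj => h2 y hy z hz ⟨hy, hz, hj⟩, fun y hy j hj => by
        obtain ⟨h4, h5, h6⟩ := h3 y hy j hj
        exact ⟨h4, h5.2.2, h6⟩⟩

/-! ### The program for growing a subtree -/

/-- With a node in register `y`, one of its neighbours in register `z` and the place of that in row
`y` in register `j`, remove the neighbour from the live part of row `y`. The new length of the live
part is left in register `23`. -/
def removeProg (y j z : ℕ) : Cmd := block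
  [.load 21 20 y, .load 23 9 y, .sub 23 23 31, .add 22 21 j, .add 24 21 23, .load 25 10 24,
   .store 10 22 25, .store 10 24 z, .add 26 21 25, .store 11 26 j, .add 26 21 z, .store 11 26 23,
   .store 9 y 23]

theorem runs_removeProg {W n y j z : ℕ} {s : State} (hy : y < 21) (hj : j < 21) (hz : z < 21)
    {y' j' z' : ℕ} (hy' : s.reg y = y') (hj' : s.reg j = j') (hz' : s.reg z = z')
    (h1 : s.reg 31 = 1) (hb : s.arr 20 y' = y' * n) (hyn : y' < n) (hzn : z' < n)
    (hc : s.arr 9 y' < n) (hjc : j' < s.arr 9 y')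
    (hw : s.arr 10 (y' * n + (s.arr 9 y' - 1)) < n) (hW : n * n ≤ W) :
    Runs W (removeProg y j z) s fun s' t => t ≤ 14 ∧ s'.reg 23 = s.arr 9 y' - 1 ∧
      s'.arr 9 = Function.update (s.arr 9) y' (s.arr 9 y' - 1) ∧
      s'.arr 10 = Function.update (Function.update (s.arr 10) (y' * n + j')
        (s.arr 10 (y' * n + (s.arr 9 y' - 1)))) (y' * n + (s.arr 9 y' - 1)) z' ∧
      s'.arr 11 = Function.update (Function.update (s.arr 11)
        (y' * n + s.arr 10 (y' * n + (s.arr 9 y' - 1))) j') (y' * n + z') (s.arr 9 y' - 1) := by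
  have b1 := mul_add_le (n := n) (x := y') (k := j') hyn (by omega)
  have b2 := mul_add_le (n := n) (x := y') (k := s.arr 9 y' - 1) hyn (by omega)
  have b3 := mul_add_le (n := n) (x := y') (k := z') hyn (by omega)
  have b4 := mul_add_le hyn hw.le
  have ne : ∀ a < 21, a ≠ 21 ∧ a ≠ 22 ∧ a ≠ 23 ∧ a ≠ 24 ∧ a ≠ 25 ∧ a ≠ 26 := by omega
  obtain ⟨y1, y2, y3, y4, y5, y6⟩ := ne y hy
  obtain ⟨j1, j2, j3, j4, j5, j6⟩ := ne j hj
  obtain ⟨z1, z2, z3, z4, z5, z6⟩ := ne z hz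
  refine Runs.of_wp ?_
  simp [removeProg, block, wp, *]
  omega

/-- Part of `growProg`: add the neighbour at place `reg 20` in the list of node `reg 18`. -/
def addNodeProg : Cmd := .seq (block [.load 21 20 18, .add 22 21 20, .load 19 10 22])
  (.seq (removeProg 18 20 19) (.seq
    (block [.add 29 23 30, .load 21 20 19, .add 22 21 18, .load 20 11 22])
    (.seq (removeProg 19 20 18) (block [.store 2 11 19, .add 11 11 31]))))

/-- Part of `growProg`: bring the list of the nodes with outside neighbours up to date. -/
def boundaryProg : Cmd := block
  [.branch (.eq 29 30) (block [.sub 16 16 31, .load 33 12 16, .store 12 17 33]) .skip,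
   .branch (.lt 30 23) (block [.store 12 16 19, .add 16 16 31]) .skip]

/-- One growing step: draw a node with outside neighbours, draw one of these, and add it. -/
def growProg : Cmd := .seq (.sub 27 16 31) (.seq (.rand 17 30 27)
  (.seq (block [.load 18 12 17, .load 28 9 18, .sub 28 28 31]) (.seq (.rand 20 30 28)
    (.seq addNodeProg boundaryProg))))

/-- The data structure of a growing subtree, as it is stored in a state. -/
def Growing (n : ℕ) (s : State) (S : Set ℕ) : Prop :=
  Growth n (s.arr 0) (s.arr 8) (s.arr 9) (s.arr 10) (s.arr 11) (s.arr 12) (s.reg 16) S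

theorem Growth.lists_remove {n : ℕ} {par deg cnt nbr pos act : ℕ → ℕ} {a r z c : ℕ} {S : Set ℕ}
    (h : Growth n par deg cnt nbr pos act a S) (hr : r < a) (hz : z ∉ S) {act' : ℕ → ℕ} {a' : ℕ}
    (hact : cnt (act r) - 1 = 0 ∧ a' = a - 1 ∧ act' = Function.update act r (act (a - 1)) ∨
      cnt (act r) - 1 ≠ 0 ∧ a' = a ∧ act' = act) :
    Lists act' a' fun v => v ∈ S ∧
      0 < Function.update (Function.update cnt (act r) (cnt (act r) - 1)) z c v := by
  have hmem := (h.act.1 (act r)).2 ⟨r, hr, rfl⟩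
  have hne : ∀ v ∈ S, v ≠ z := fun v hv hc => hz (hc ▸ hv)
  rcases hact with ⟨h0, rfl, rfl⟩ | ⟨h0, rfl, rfl⟩
  · refine (h.act.remove hr).congr fun v => ?_
    rw [Function.update_apply, Function.update_apply]
    grind
  · refine h.act.congr fun v => ?_
    rw [Function.update_apply, Function.update_apply]
    grind

theorem Growth.lists_add {act cnt : ℕ → ℕ} {a z : ℕ} {S : Set ℕ}
    (h : Lists act a fun v => v ∈ S ∧ 0 < cnt v) (hz : z ∉ S) {act' : ℕ → ℕ} {a' : ℕ}
    (hact : 0 < cnt z ∧ a' = a + 1 ∧ act' = Function.update act a z ∨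
      ¬ 0 < cnt z ∧ a' = a ∧ act' = act) :
    Lists act' a' fun v => v ∈ insert z S ∧ 0 < cnt v := by
  rcases hact with ⟨h0, rfl, rfl⟩ | ⟨h0, rfl, rfl⟩
  · refine (h.add (z := z) fun hc => hz hc.1).congr fun v => ?_
    rw [Set.mem_insert_iff]
    grind
  · refine h.congr fun v => ?_
    rw [Set.mem_insert_iff]
    grind

theorem Lists.le {f : ℕ → ℕ} {a n : ℕ} {X : ℕ → Prop} (h : Lists f a X) (hX : ∀ v, X v → v < n) :
    a ≤ n := by
  have := Finset.card_le_card_of_injOn (s := Finset.range a) (t := Finset.range n) f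
    (fun r hr => by simpa using hX _ ((h.1 _).2 ⟨r, by simpa using hr, rfl⟩))
    (fun r hr r' hr' heq => h.2 r (by simpa using hr) r' (by simpa using hr') heq)
  simpa using this

theorem runs_addNode {W n r y j e : ℕ} {s : State} {S : Set ℕ} (h : Growing n s S)
    (hbase : ∀ x < n, s.arr 20 x = x * n) (h0 : s.reg 30 = 0) (h1 : s.reg 31 = 1)
    (h17 : s.reg 17 = r) (hr : r < s.reg 16) (hract : s.arr 12 r = y) (h18 : s.reg 18 = y)
    (h20 : s.reg 20 = j) (hj : j < s.arr 9 y) (h11 : s.reg 11 = e) (hW : n * n + n ≤ W)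
    (he : e < n * n) :
    Runs W (.seq addNodeProg boundaryProg) s fun s' t => t ≤ 60 ∧
      Growing n s' (insert (s.arr 10 (y * n + j)) S) ∧
      s'.arr 2 = Function.update (s.arr 2) e (s.arr 10 (y * n + j)) ∧ s'.reg 11 = e + 1 := by
  have hyS : y ∈ S := ((h.act.1 y).2 ⟨r, hr, hract⟩).1
  have hyn := h.lt y hyS
  obtain ⟨hzn, hzS, hyz, hposz⟩ := h.of_lt_cnt hyS hj
  set z := s.arr 10 (y * n + j) with hzdef
  have hzy : z ≠ y := by rintro hc; exact hzS (hc ▸ hyS)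
  have hcy := h.cnt_le y hyn
  have hdy := h.rows.deg_lt y hyn
  have hcz := h.cnt_eq z hzn hzS
  have hdz := h.rows.deg_lt z hzn
  have hb1 := mul_add_le (n := n) (x := y) (k := j) hyn (by omega)
  have hb2 := mul_add_le (n := n) (x := z) (k := y) hzn hyn.le
  have hwy := (h.rows.bwd y hyn (s.arr 9 y - 1) (by omega)).1
  have hzlive := (h.rows.fwd z hzn y hyn hyz.symm).1
  have hwz := (h.rows.bwd z hzn (s.arr 9 z - 1) (by omega)).1
  obtain ⟨nbr₁, hn₁⟩ : ∃ f, f = Function.update (Function.update (s.arr 10) (y * n + j)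
    (s.arr 10 (y * n + (s.arr 9 y - 1)))) (y * n + (s.arr 9 y - 1)) z := ⟨_, rfl⟩
  obtain ⟨pos₁, hp₁⟩ : ∃ f, f = Function.update (Function.update (s.arr 11)
    (y * n + s.arr 10 (y * n + (s.arr 9 y - 1))) j) (y * n + z) (s.arr 9 y - 1) := ⟨_, rfl⟩
  obtain ⟨hR₁, -, -⟩ := h.rows.swap hyn hzn hyz (c := s.arr 9 y - 1) (by omega)
    (by omega) (nbr' := nbr₁) (pos' := pos₁) (by rw [hposz]; exact hn₁) (by rw [hposz]; exact hp₁)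
  have hz1 := (hR₁.fwd z hzn y hyn hyz.symm).1
  have hz2 := (hR₁.bwd z hzn (s.arr 9 z - 1) (by omega)).1
  refine Runs.seq ((?_ : Runs W addNodeProg s fun s' t => t ≤ 45 ∧ s'.reg 29 = s.arr 9 y - 1 ∧
    s'.reg 23 = s.arr 9 z - 1 ∧ s'.reg 19 = z ∧ s'.reg 11 = e + 1 ∧
    s'.arr 2 = Function.update (s.arr 2) e z ∧
      s'.arr 10 = Function.update
        (Function.update nbr₁ (z * n + pos₁ (z * n + y)) (nbr₁ (z * n + (s.arr 9 z - 1))))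
          (z * n + (s.arr 9 z - 1)) y ∧
      s'.arr 11 = Function.update
        (Function.update pos₁ (z * n + nbr₁ (z * n + (s.arr 9 z - 1))) (pos₁ (z * n + y)))
          (z * n + y) (s.arr 9 z - 1) ∧
      s'.arr 9 = Function.update (Function.update (s.arr 9) y (s.arr 9 y - 1)) z
        (s.arr 9 z - 1)).mono ?_)
  · refine Runs.seq (Runs.of_wp ?_)
    simp only [block, wp, State.setReg_reg, State.setReg_arr, h18, h20, hbase y hyn, reduceIte,
      Nat.reduceEqDiff, ← hzdef]
    refine ⟨by omega, Runs.seq ((runs_removeProg (n := n) (y := 18) (j := 20) (z := 19)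
      (s := ((s.setReg 21 (y * n)).setReg 22 (y * n + j)).setReg 19 z) (y' := y) (j' := j) (z' := z)
      (by omega) (by omega) (by omega) (by simpa using h18) (by simpa using h20) (by simp)
      (by simpa using h1) (hbase y hyn) hyn hzn (by simp; omega) (by simpa using hj)
      (by simpa using hwy) (by omega)).mono ?_)⟩
    simp only [State.setReg_arr, ← hn₁, ← hp₁]
    rintro s₁ t₁ hA₁ ⟨ht₁, h23₁, h9₁, h10₁, h11₁⟩
    have e11 : s₁.reg 11 = e := (hA₁.1 11 rfl).trans (by simpa using h11)
    have e18 : s₁.reg 18 = y := (hA₁.1 18 rfl).trans (by simpa using h18)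
    have e19 : s₁.reg 19 = z := (hA₁.1 19 rfl).trans (by simp)
    have e30 : s₁.reg 30 = 0 := (hA₁.1 30 rfl).trans (by simpa using h0)
    have e31 : s₁.reg 31 = 1 := (hA₁.1 31 rfl).trans (by simpa using h1)
    have a20 : s₁.arr 20 = s.arr 20 := hA₁.2 20 rfl
    have a2 : s₁.arr 2 = s.arr 2 := hA₁.2 2 rfl
    have h9z : s₁.arr 9 z = s.arr 9 z := by rw [h9₁, Function.update_of_ne hzy]
    refine Runs.seq (Runs.of_wp ?_)
    simp only [wp, State.setReg_reg, State.setReg_arr, e18, e19, e30, h23₁, a20,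
      hbase z hzn, reduceIte, Nat.reduceEqDiff, h11₁]
    refine ⟨by omega, by omega, Runs.seq ((runs_removeProg (n := n) (y := 19) (j := 20) (z := 18)
      (s := (((s₁.setReg 29 (s.arr 9 y - 1 + 0)).setReg 21 (z * n)).setReg 22 (z * n + y)).setReg 20
        (pos₁ (z * n + y))) (y' := z)
      (j' := pos₁ (z * n + y)) (z' := y)
      (by omega) (by omega) (by omega) (by simpa using e19) (by simp) (by simpa using e18)
      (by simpa using e31) (by simpa [a20] using hbase z hzn) hzn hyn (by simp [h9z]; omega)
      (by simp only [State.setReg_arr, h9z]; omega)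
      (by simpa [h9z, h10₁] using hz2) (by omega)).mono ?_)⟩
    simp only [State.setReg_arr, h9z, h10₁, h11₁]
    rintro s₂ t₂ hA₂ ⟨ht₂, h23₂, h9₂, h10₂, h11₂⟩
    have e11' : s₂.reg 11 = e := (hA₂.1 11 rfl).trans (by simpa using e11)
    have e19' : s₂.reg 19 = z := (hA₂.1 19 rfl).trans (by simpa using e19)
    have e31' : s₂.reg 31 = 1 := (hA₂.1 31 rfl).trans (by simpa using e31)
    have e29' : s₂.reg 29 = s.arr 9 y - 1 := (hA₂.1 29 rfl).trans (by simp)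
    have a2' : s₂.arr 2 = s.arr 2 := (hA₂.2 2 rfl).trans a2
    refine Runs.of_wp ?_
    simp only [wp, State.setReg_reg, State.setReg_arr, State.setArr_reg, State.setArr_arr,
      e11', e19', e31', e29', a2', h23₂, h9₂, h10₂, h11₂, h9₁, reduceIte, Nat.reduceEqDiff]
    refine ⟨by omega, by omega, ?_⟩
    simp
  · rintro s₁ t₁ hA ⟨ht₁, h29, h23, h19, h11', h2', h10', h11a, h9'⟩
    have f30 : s₁.reg 30 = 0 := (hA.1 30 rfl).trans h0
    have f31 : s₁.reg 31 = 1 := (hA.1 31 rfl).trans h1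
    have f16 : s₁.reg 16 = s.reg 16 := hA.1 16 rfl
    have f17 : s₁.reg 17 = r := (hA.1 17 rfl).trans h17
    have g0 : s₁.arr 0 = s.arr 0 := hA.2 0 rfl
    have g8 : s₁.arr 8 = s.arr 8 := hA.2 8 rfl
    have g12 : s₁.arr 12 = s.arr 12 := hA.2 12 rfl
    have hrem := @Growth.lists_remove _ _ _ _ _ _ _ _ _ z (s.arr 9 z - 1) _ h hr hzS
    rw [hract, ← h9'] at hrem
    have hcz' : s₁.arr 9 z = s.arr 9 z - 1 := by rw [h9']; simp
    have hadd : ∀ {act a}, Lists act a (fun v => v ∈ S ∧ 0 < s₁.arr 9 v) → _ := fun h =>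
      @Growth.lists_add _ _ _ z S h hzS
    have hstep : ∀ {act a}, _ → _ := fun {act a} => h.step (act' := act) (a' := a) hyS hj rfl hn₁
      (by rw [hp₁]) h10' h11a h9'
    have ha16 : s.reg 16 ≤ n := h.act.le fun v hv => h.lt v hv.1
    refine Runs.of_wp ?_
    simp [boundaryProg, block, wp, Test.Holds, f30, f31, h29, f16, f17, g12, h23, h19, h11', h2',
      Growing, g0, g8]
    refine ⟨fun hc => ⟨fun hc' => ⟨by omega, by omega, ?_⟩, fun hc' => ⟨by omega, ?_⟩⟩,
      fun hc => ⟨fun hc' => ⟨by omega, by omega, ?_⟩, fun hc' => ⟨by omega, ?_⟩⟩⟩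
    · exact hstep (hadd (hrem (Or.inl ⟨hc, rfl, rfl⟩)) (Or.inl ⟨by omega, rfl, rfl⟩))
    · exact hstep (hadd (hrem (Or.inl ⟨hc, rfl, rfl⟩)) (Or.inr ⟨by omega, rfl, rfl⟩))
    · exact hstep (hadd (hrem (Or.inr ⟨hc, rfl, rfl⟩)) (Or.inl ⟨by omega, rfl, rfl⟩))
    · exact hstep (hadd (hrem (Or.inr ⟨hc, rfl, rfl⟩)) (Or.inr ⟨by omega, rfl, rfl⟩))

theorem val_ofNat_of_lt {n : ℕ} [NeZero n] {a : ℕ} (h : a < n) : (Fin.ofNat n a : ℕ) = a := by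
  simp [Nat.mod_eq_of_lt h]

theorem sim_growProg {W n e : ℕ} [NeZero n] {s : State} {S : Finset (Fin n)}
    (h : Growing n s (Fin.val '' (S : Set (Fin n)))) (hcard : S.card < n)
    (hbase : ∀ x < n, s.arr 20 x = x * n) (h0 : s.reg 30 = 0) (h1 : s.reg 31 = 1)
    (h11 : s.reg 11 = e) (hW : n * n + n ≤ W) (he : e < n * n) :
    Sim W growProg s (ChordalGen.growStep (parentGraph n (s.arr 0)) S) fun S' s' t =>
      t ≤ 70 ∧ ∃ z, z ∉ S ∧ (S' : Set (Fin n)) = insert z (S : Set (Fin n)) ∧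
        Growing n s' (Fin.val '' (S' : Set (Fin n))) ∧
        s'.arr 2 = Function.update (s.arr 2) e z ∧ s'.reg 11 = e + 1 := by
  classical
  have hp : IsParent n (s.arr 0) := h.isParent
  have hmem : ∀ x : Fin n, (x : ℕ) ∈ Fin.val '' (S : Set (Fin n)) ↔ x ∈ S := fun x =>
    ⟨fun ⟨y, hy, hyx⟩ => Fin.ext hyx ▸ hy, fun hx => ⟨x, hx, rfl⟩⟩
  have hout : ∀ y z, z ∈ ChordalGen.outside (parentGraph n (s.arr 0)) S y ↔
      Joined (s.arr 0) y z ∧ z ∉ S := fun y z => by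
    simp [ChordalGen.outside, parentGraph_adj hp]
  have hbd : ∀ y, y ∈ ChordalGen.boundary (parentGraph n (s.arr 0)) S ↔
      y ∈ S ∧ 0 < s.arr 9 y := by
    intro y
    simp only [ChordalGen.boundary, Finset.mem_filter, Finset.Nonempty, hout]
    refine and_congr_right fun hy => ⟨fun ⟨z, hz, hzS⟩ => ?_, fun hpos => ?_⟩
    · have := (h.pos_of_joined ((hmem y).2 hy) z.2 (fun hc => hzS ((hmem z).1 hc)) hz).1
      omega
    · obtain ⟨h2, h3, h4, -⟩ := h.of_lt_cnt ((hmem y).2 hy) hpos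
      exact ⟨⟨_, h2⟩, h4, fun hc => h3 ((hmem ⟨_, h2⟩).2 hc)⟩
  have hbne : (ChordalGen.boundary (parentGraph n (s.arr 0)) S).Nonempty := by
    obtain ⟨t, ht⟩ := h.rooted
    obtain ⟨x, hx⟩ : ∃ x, x ∉ S := by
      by_contra hc; push Not at hc
      rw [Finset.eq_univ_iff_forall.2 hc] at hcard
      simp at hcard
    obtain ⟨y, hy, z, hz, hzS, hyz⟩ := ht.exists_joined hp h.lt
      ⟨x, x.2, fun hc => hx ((hmem x).1 hc)⟩
    have hpos := (h.pos_of_joined hy hz hzS hyz).1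
    obtain ⟨y, hyS, rfl⟩ := hy
    exact ⟨y, (hbd y).2 ⟨hyS, by omega⟩⟩
  have ha : 0 < s.reg 16 := by
    obtain ⟨y, hy⟩ := hbne
    obtain ⟨hyS, hy0⟩ := (hbd y).1 hy
    obtain ⟨r, hr, -⟩ := (h.act.1 y).1 ⟨(hmem y).2 hyS, hy0⟩
    omega
  have hactn : ∀ r < s.reg 16, s.arr 12 r < n := fun r hr =>
    h.lt _ ((h.act.1 _).2 ⟨r, hr, rfl⟩).1
  rw [ChordalGen.growStep, dif_pos hbne]
  refine Runs.seq_sim (Runs.of_wp ?_)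
  simp only [wp, h1]
  refine Sim.seq (Sim.rand hbne (fun r => Fin.ofNat n (s.arr 12 r)) (by simp [h0]) ?_) ?_
  · simp only [State.setReg_reg, h0, reduceIte, Nat.reduceEqDiff]
    refine ⟨fun r hr => ?_, fun r hr r' hr' heq => ?_, fun y hy => ?_⟩
    · simp only [Set.mem_Icc] at hr
      have hrn := hactn r (by omega)
      obtain ⟨h2, h3⟩ := (h.act.1 _).2 ⟨r, by omega, rfl⟩
      rw [← val_ofNat_of_lt hrn] at h2 h3
      exact (hbd _).2 ⟨(hmem _).1 h2, h3⟩
    · simp only [Set.mem_Icc] at hr hr'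
      have h2 := congrArg Fin.val heq
      rw [val_ofNat_of_lt (hactn r (by omega)), val_ofNat_of_lt (hactn r' (by omega))] at h2
      exact h.act.2 r (by omega) r' (by omega) h2
    · obtain ⟨hyS, hy0⟩ := (hbd y).1 hy
      obtain ⟨r, hr, hry⟩ := (h.act.1 y).1 ⟨(hmem y).2 hyS, hy0⟩
      refine ⟨r, ⟨by omega, by omega⟩, Fin.ext ?_⟩
      show (Fin.ofNat n (s.arr 12 r) : ℕ) = y
      rw [val_ofNat_of_lt (hactn r hr), hry]
  · rintro y s₁ t₁ ⟨rfl, r, -, hr, hry, rfl⟩ -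
    simp only [State.setReg_reg, reduceIte] at hr
    have hr' : r < s.reg 16 := by omega
    have hry' : s.arr 12 r = y := by rw [← hry, val_ofNat_of_lt (hactn r hr')]
    have hyX := (h.act.1 y).2 ⟨r, hr', hry'⟩
    have hyS := (hmem y).1 hyX.1
    have hone : (ChordalGen.outside (parentGraph n (s.arr 0)) S y).Nonempty :=
      (Finset.mem_filter.1 ((hbd y).2 ⟨hyS, hyX.2⟩)).2
    have hnbr : ∀ j < s.arr 9 y, s.arr 10 (y * n + j) < n := fun j hj =>
      (h.of_lt_cnt hyX.1 hj).1
    rw [dif_pos hone]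
    refine Runs.seq_sim (Runs.of_wp ?_)
    simp only [block, wp, State.setReg_reg, State.setReg_arr, hry', h1, reduceIte, Nat.reduceEqDiff]
    refine Sim.map (Q := fun z s' t => t ≤ 61 ∧ z ∉ S ∧
        Growing n s' (Fin.val '' (insert z S : Set (Fin n))) ∧
        s'.arr 2 = Function.update (s.arr 2) e z ∧ s'.reg 11 = e + 1) _ (Sim.seq_runs
      ((Sim.rand hone (fun j => Fin.ofNat n (s.arr 10 (y * n + j))) ?_ ?_).mono ?_)) ?_
    · simp [h0]
    · simp only [State.setReg_reg, h0, reduceIte, Nat.reduceEqDiff]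
      refine ⟨fun j hj => ?_, fun j hj j' hj' heq => ?_, fun z hz => ?_⟩
      · simp only [Set.mem_Icc] at hj
        obtain ⟨h2, h3, h4, -⟩ := h.of_lt_cnt hyX.1 (j := j) (by omega)
        rw [← val_ofNat_of_lt h2] at h3 h4
        exact (hout _ _).2 ⟨h4, fun hc => h3 ((hmem _).2 hc)⟩
      · simp only [Set.mem_Icc] at hj hj'
        have h2 := congrArg Fin.val heq
        rw [val_ofNat_of_lt (hnbr j (by omega)), val_ofNat_of_lt (hnbr j' (by omega))] at h2
        rw [← (h.of_lt_cnt hyX.1 (j := j) (by omega)).2.2.2, h2,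
          (h.of_lt_cnt hyX.1 (j := j') (by omega)).2.2.2]
      · obtain ⟨hyz, hzS⟩ := (hout _ _).1 hz
        obtain ⟨h2, h3⟩ := h.pos_of_joined hyX.1 z.2 (fun hc => hzS ((hmem z).1 hc)) hyz
        refine ⟨_, ⟨Nat.zero_le _, Nat.le_sub_one_of_lt h2⟩, Fin.ext ?_⟩
        show (Fin.ofNat n _ : ℕ) = z
        rw [val_ofNat_of_lt (hnbr _ h2), h3]
    · rintro z s₂ t₂ - - ⟨rfl, j, -, hj, hjz, rfl⟩
      simp only [State.setReg_reg, reduceIte] at hj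
      have hj' : j < s.arr 9 y := by omega
      have hjz' : s.arr 10 (y * n + j) = z := by rw [← hjz, val_ofNat_of_lt (hnbr j hj')]
      refine (runs_addNode (n := n) (r := r) (y := y) (j := j) (e := e)
        (S := Fin.val '' (S : Set (Fin n))) ?_ ?_ ?_ ?_ ?_ ?_ ?_ ?_ ?_ ?_ ?_ hW he).mono ?_
      · exact h
      · exact hbase
      · simpa using h0
      · simpa using h1
      · simp
      · simpa using hr'
      · simpa using hry'
      · simp
      · simp
      · simpa using hj'
      · simpa using h11
      · simp only [State.setReg_arr, hjz']
        rintro s' t - ⟨ht, hG, h2, h11'⟩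
        refine ⟨by omega, ?_, ?_, h2, h11'⟩
        · intro hc
          have := (h.of_lt_cnt hyX.1 hj').2.1
          rw [hjz'] at this
          exact this ((hmem z).2 hc)
        · rwa [Set.image_insert_eq]
    · rintro z s' t - ⟨ht, hz, hG, h2, h11'⟩
      refine ⟨by omega, z, hz, by simp, ?_, h2, h11'⟩
      rwa [Finset.coe_insert]

/-! ### The program for the family of subtrees -/

/-- Start a subtree with the node in register `12`; the number of nodes that it is to have is in
register `13`. -/
def startProg : Cmd := block
  [.store 2 11 12, .add 14 11 13, .add 11 11 31, .load 28 9 12, .const 16 0,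
   .branch (.lt 30 28) (block [.store 12 16 12, .add 16 16 31]) .skip]

/-- For each node of the subtree number `reg 10`, restore its list of neighbours and add the subtree
to its bag; and find the topmost node of the subtree. -/
def bagProg : Cmd := .loop (.lt 35 11) (block
  [.load 37 2 35, .load 38 8 37, .store 9 37 38, .load 21 20 37, .load 38 13 37, .add 22 21 38,
   .store 14 22 10, .add 38 38 31, .store 13 37 38, .branch (.lt 37 36) (.add 36 37 30) .skip,
   .add 35 35 31])

/-- The bookkeeping for a complete subtree: besides what `bagProg` does, record the subtree at its
topmost node, and close its list of nodes. -/
def recordProg : Cmd := .seq (block [.load 35 1 10, .add 36 12 30]) (.seq bagProg (block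
  [.store 15 10 36, .load 21 20 36, .load 38 16 36, .add 22 21 38, .store 17 22 10,
   .add 38 38 31, .store 16 36 38, .add 10 10 31, .store 1 10 11]))

/-- Draw the first node and the number of nodes of a subtree, and grow it. -/
def growthProg : Cmd := .seq (.sub 34 2 31) (.seq (.rand 12 30 34) (.seq (.rand 13 31 1)
  (.seq startProg (.loop (.lt 11 14) growProg))))

/-- Generate one subtree. -/
def subtreeProg : Cmd := .seq growthProg recordProg

/-- The data that is available when the first `i` subtrees have been generated, with the lists of
nodes `L 0, …, L (i - 1)`; compare `Generated`. -/
structure Stage (n k i : ℕ) (s : State) (L : ℕ → List ℕ) : Prop where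
  ready : HostReady n k s
  reg_i : s.reg 10 = i
  stored : Stored (s.arr 1) (s.arr 2) L i (s.reg 11)
  off_zero : s.arr 1 0 = 0
  le : s.reg 11 ≤ i * n
  nodup : ∀ b < i, (L b).Nodup
  lt : ∀ b < i, ∀ x ∈ L b, x < n
  rooted : ∀ b < i, RootedAt (s.arr 0) {x | x ∈ L b} (s.arr 15 b)
  bag : ∀ x < n, seg (s.arr 14) (x * n) (s.arr 13 x) = (List.range i).filter fun b => x ∈ L b
  tops : ∀ x < n, seg (s.arr 17) (x * n) (s.arr 16 x) =
    (List.range i).filter fun b => s.arr 15 b = x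

theorem runs_bagProg {W n i e x₀ : ℕ} {s : State} {L' : List ℕ} {B : ℕ → List ℕ}
    (h0 : s.reg 30 = 0) (h1 : s.reg 31 = 1) (h10 : s.reg 10 = i) (hi : i < n)
    (h11 : s.reg 11 = e + L'.length) (h35 : s.reg 35 = e) (h36 : s.reg 36 = x₀) (hx₀ : x₀ ∈ L')
    (hseg : seg (s.arr 2) e L'.length = L') (hnd : L'.Nodup) (hlt : ∀ x ∈ L', x < n)
    (hcnt : ∀ y < n, y ∉ L' → s.arr 9 y = s.arr 8 y) (hbase : ∀ x < n, s.arr 20 x = x * n)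
    (hbag : ∀ x < n, seg (s.arr 14) (x * n) (s.arr 13 x) = B x) (hB : ∀ x < n, (B x).length ≤ i)
    (hW : n * n + n ≤ W) (he : e + L'.length ≤ n * n) :
    Runs W bagProg s fun s' t => t ≤ 15 * L'.length + 1 ∧
      (∀ y < n, s'.arr 9 y = s.arr 8 y) ∧ s'.reg 36 ∈ L' ∧ (∀ y ∈ L', s'.reg 36 ≤ y) ∧
      ∀ x < n, seg (s'.arr 14) (x * n) (s'.arr 13 x) = B x ++ if x ∈ L' then [i] else [] := by
  refine (Runs.loop L'.length (fun j s' T => T ≤ 15 * j ∧ s'.reg 35 = e + j ∧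
      (∀ y < n, (y ∈ seg (s.arr 2) e j ∨ y ∉ L') → s'.arr 9 y = s.arr 8 y) ∧
      s'.reg 36 ∈ L' ∧ (∀ y ∈ seg (s.arr 2) e j, s'.reg 36 ≤ y) ∧
      ∀ x < n, seg (s'.arr 14) (x * n) (s'.arr 13 x) =
        B x ++ if x ∈ seg (s.arr 2) e j then [i] else []) ?_ ?_ ?_).mono ?_
  · refine ⟨by simp, by simpa using h35, fun y hy hyL => ?_, h36 ▸ hx₀, by simp, fun x hx => ?_⟩
    · exact hcnt y hy (hyL.resolve_left (by simp))
    · simpa using hbag x hx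
  · rintro j s' T hj hA ⟨hT, h35', hcnt', h36', hmin, hbag'⟩
    have e30 : s'.reg 30 = 0 := (hA.1 30 rfl).trans h0
    have e31 : s'.reg 31 = 1 := (hA.1 31 rfl).trans h1
    have e10 : s'.reg 10 = i := (hA.1 10 rfl).trans h10
    have e11 : s'.reg 11 = e + L'.length := (hA.1 11 rfl).trans h11
    have a2 : s'.arr 2 = s.arr 2 := hA.2 2 rfl
    have a8 : s'.arr 8 = s.arr 8 := hA.2 8 rfl
    have a20 : s'.arr 20 = s.arr 20 := hA.2 20 rfl
    set y := s.arr 2 (e + j) with hy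
    have hyL : y ∈ L' := by rw [← hseg, mem_seg]; exact ⟨j, hj, rfl⟩
    have hyn := hlt y hyL
    have hyD : y ∉ seg (s.arr 2) e j := by
      have hsplit : L' = seg (s.arr 2) e j ++ seg (s.arr 2) (e + j) (L'.length - j) := by
        rw [← seg_add]; conv_lhs => rw [← hseg]
        congr 1; omega
      rw [hsplit] at hnd
      intro hc
      refine (List.nodup_append.1 hnd).2.2 y hc y ?_ rfl
      rw [mem_seg]
      exact ⟨0, by omega, rfl⟩
    have hbagy := hbag' y hyn
    rw [if_neg hyD, List.append_nil] at hbagy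
    have hlen := congrArg List.length hbagy
    rw [length_seg] at hlen
    have hBy := hB y hyn
    have hsz : s'.arr 13 y < n := by omega
    have hb := mul_add_le hyn hsz.le
    have hmem : ∀ x, x ∈ seg (s.arr 2) e (j + 1) ↔ x ∈ seg (s.arr 2) e j ∨ x = y := fun x => by
      rw [seg_succ, List.mem_append, List.mem_singleton]
    have hbagnew : ∀ x < n, seg (Function.update (s'.arr 14) (y * n + s'.arr 13 y) i) (x * n)
        (Function.update (s'.arr 13) y (s'.arr 13 y + 1) x) =
        B x ++ if x ∈ seg (s.arr 2) e (j + 1) then [i] else [] := by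
      intro x hx
      by_cases hxy : x = y
      · rw [hxy, Function.update_self, seg_update_succ, hbagy, if_pos ((hmem y).2 (Or.inr rfl))]
      · have hlenx := congrArg List.length (hbag' x hx)
        rw [length_seg, List.length_append] at hlenx
        have hBx := hB x hx
        have hle : (if x ∈ seg (s.arr 2) e j then [i] else []).length ≤ 1 := by
          split_ifs <;> simp
        rw [Function.update_of_ne hxy, seg_update_row _ _ hsz (by omega) hxy, hbag' x hx]
        simp only [hmem, hxy, or_false]
    have hcntnew : ∀ x < n, (x ∈ seg (s.arr 2) e (j + 1) ∨ x ∉ L') →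
        Function.update (s'.arr 9) y (s.arr 8 y) x = s.arr 8 x := by
      intro x hx hxL
      by_cases hxy : x = y
      · rw [hxy, Function.update_self]
      · rw [Function.update_of_ne hxy]
        refine hcnt' x hx ?_
        rw [hmem] at hxL
        tauto
    refine ⟨by simp only [Test.Holds]; omega, Runs.of_wp ?_⟩
    simp only [block, wp, State.setReg_reg, State.setReg_arr, State.setArr_reg, State.setArr_arr,
      Test.Holds, h35', a2, a8, a20, e10, e30, e31, reduceIte, Nat.reduceEqDiff, ← hy,
      hbase y hyn]
    refine ⟨by omega, by omega, fun hlt' => ⟨by omega, by omega, by omega, by omega, hcntnew,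
      hyL, ?_, hbagnew⟩, fun hlt' => ⟨by omega, by omega, by omega, hcntnew, h36', ?_, hbagnew⟩⟩
    · intro x hx
      rcases (hmem x).1 hx with hx | rfl
      · have := hmin x hx; omega
      · omega
    · intro x hx
      rcases (hmem x).1 hx with hx | rfl
      · exact hmin x hx
      · omega
  · rintro s' T hA ⟨hT, h35', -⟩
    have e11 : s'.reg 11 = e + L'.length := (hA.1 11 rfl).trans h11
    simp only [Test.Holds]; omega
  · rintro s' t - ⟨T, rfl, hT, h35', hcnt', h36', hmin, hbag'⟩
    rw [hseg] at hcnt' hmin hbag'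
    exact ⟨by omega, fun y hy => hcnt' y hy (em _), h36', hmin, hbag'⟩

theorem runs_recordProg {W n k i x₀ : ℕ} {s₀ s : State} {L : ℕ → List ℕ} {L' : List ℕ}
    (h : Stage n k i s₀ L) (hA : Agree growthProg s₀ s) (hi : i < n)
    (hG : Growing n s {x | x ∈ L'}) (happ : Appended (s₀.arr 2) (s.arr 2) (s₀.reg 11) L')
    (hnd : L'.Nodup) (hx₀ : x₀ ∈ L') (h12 : s.reg 12 = x₀)
    (h11 : s.reg 11 = s₀.reg 11 + L'.length) (hW : n * n + n ≤ W) :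
    Runs W recordProg s fun s' t => t ≤ 15 * L'.length + 20 ∧ s'.reg 11 = s₀.reg 11 + L'.length ∧
      Stage n k (i + 1) s' (Function.update L i L') := by
  have e1 : s.reg 1 = k := (hA.1 1 rfl).trans h.ready.reg_k
  have e2 : s.reg 2 = n := (hA.1 2 rfl).trans h.ready.reg_n
  have e30 : s.reg 30 = 0 := (hA.1 30 rfl).trans h.ready.reg_zero
  have e31 : s.reg 31 = 1 := (hA.1 31 rfl).trans h.ready.reg_one
  have e10 : s.reg 10 = i := (hA.1 10 rfl).trans h.reg_i
  have a0 : s.arr 0 = s₀.arr 0 := hA.2 0 rfl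
  have a1 : s.arr 1 = s₀.arr 1 := hA.2 1 rfl
  have a8 : s.arr 8 = s₀.arr 8 := hA.2 8 rfl
  have a13 : s.arr 13 = s₀.arr 13 := hA.2 13 rfl
  have a14 : s.arr 14 = s₀.arr 14 := hA.2 14 rfl
  have a15 : s.arr 15 = s₀.arr 15 := hA.2 15 rfl
  have a16 : s.arr 16 = s₀.arr 16 := hA.2 16 rfl
  have a17 : s.arr 17 = s₀.arr 17 := hA.2 17 rfl
  have a20 : s.arr 20 = s₀.arr 20 := hA.2 20 rfl
  have hlt : ∀ x ∈ L', x < n := fun x hx => hG.lt x hx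
  have hL'n : L'.length ≤ n := by
    rw [← List.toFinset_card_of_nodup hnd]
    refine (Finset.card_le_card (t := Finset.range n) fun j hj => ?_).trans (by simp)
    simpa using hlt j (by simpa using hj)
  have hle := h.le
  have hb := mul_add_le hi hL'n
  have hx₀n := hlt x₀ hx₀
  have hfl : ∀ p : ℕ → Bool, ((List.range i).filter p).length ≤ i := fun p =>
    (List.length_filter_le _ _).trans (by simp)
  refine Runs.seq (Runs.of_wp ?_)
  simp only [block, wp, State.setReg_reg, h12, e10, e30, a1, h.stored.1,
    reduceIte, Nat.reduceEqDiff]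
  refine ⟨by omega, Runs.seq ((runs_bagProg (W := W) (n := n) (i := i) (e := s₀.reg 11) (x₀ := x₀)
    (L' := L') (s := (s.setReg 35 (s₀.reg 11)).setReg 36 (x₀ + 0))
    (B := fun x => (List.range i).filter fun b => x ∈ L b) (by simpa using e30)
    (by simpa using e31) (by simpa using e10) hi (by simpa using h11) (by simp) (by simp)
    hx₀ (by simpa using happ.1) hnd hlt ?_ ?_ ?_ (fun x _ => hfl _) hW (by omega)).mono ?_)⟩
  · simpa using hG.cnt_eq
  · intro x hx
    simpa [a20] using h.ready.base x hx
  · simpa [a13, a14] using h.bag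
  simp only [State.setReg_arr]
  rintro s₁ t₁ hA₁ ⟨ht₁, hcnt₁, h36, hmin, hbag₁⟩
  have f1 : s₁.reg 1 = k := (hA₁.1 1 rfl).trans (by simpa using e1)
  have f2 : s₁.reg 2 = n := (hA₁.1 2 rfl).trans (by simpa using e2)
  have f10 : s₁.reg 10 = i := (hA₁.1 10 rfl).trans (by simpa using e10)
  have f11 : s₁.reg 11 = s₀.reg 11 + L'.length := (hA₁.1 11 rfl).trans (by simpa using h11)
  have f30 : s₁.reg 30 = 0 := (hA₁.1 30 rfl).trans (by simpa using e30)
  have f31 : s₁.reg 31 = 1 := (hA₁.1 31 rfl).trans (by simpa using e31)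
  have g0 : s₁.arr 0 = s₀.arr 0 := (hA₁.2 0 rfl).trans a0
  have g1 : s₁.arr 1 = s₀.arr 1 := (hA₁.2 1 rfl).trans a1
  have g2 : s₁.arr 2 = s.arr 2 := hA₁.2 2 rfl
  have g8 : s₁.arr 8 = s.arr 8 := hA₁.2 8 rfl
  have g10 : s₁.arr 10 = s.arr 10 := hA₁.2 10 rfl
  have g11 : s₁.arr 11 = s.arr 11 := hA₁.2 11 rfl
  have g15 : s₁.arr 15 = s₀.arr 15 := (hA₁.2 15 rfl).trans a15
  have g16 : s₁.arr 16 = s₀.arr 16 := (hA₁.2 16 rfl).trans a16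
  have g17 : s₁.arr 17 = s₀.arr 17 := (hA₁.2 17 rfl).trans a17
  have g20 : s₁.arr 20 = s₀.arr 20 := (hA₁.2 20 rfl).trans a20
  set top := s₁.reg 36 with htop
  have htn := hlt top h36
  have hroot : RootedAt (s₀.arr 0) {x | x ∈ L'} top := by
    obtain ⟨t, ht⟩ := hG.rooted
    have h2 := ht.le hG.isParent hlt top h36
    have h3 := hmin t ht.1
    obtain rfl : t = top := by omega
    rwa [← a0]
  have htops := h.tops top htn
  have hlen := congrArg List.length htops
  rw [length_seg] at hlen
  have hfi := hfl fun b => s₀.arr 15 b = top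
  have hsz : s₀.arr 16 top < n := by omega
  have hbt := mul_add_le htn hsz.le
  have hmul : (i + 1) * n = i * n + n := Nat.add_one_mul _ _
  have hrange : ∀ p q : ℕ → Bool, (∀ b < i, p b = q b) →
      (List.range i).filter p = (List.range i).filter q := fun p q hpq =>
    List.filter_congr fun b hb => hpq b (List.mem_range.1 hb)
  have hupd : ∀ b < i, Function.update L i L' b = L b := fun b hb =>
    Function.update_of_ne (by omega) _ _
  have hupd15 : ∀ b < i, Function.update (s₀.arr 15) i top b = s₀.arr 15 b := fun b hb =>
    Function.update_of_ne (by omega) _ _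
  refine Runs.of_wp ?_
  simp only [wp, State.setReg_reg, State.setReg_arr, State.setArr_reg, State.setArr_arr,
    f10, f11, f31, g15, g16, g20, ← htop, h.ready.base top htn, reduceIte,
    Nat.reduceEqDiff]
  refine ⟨by omega, by omega, by omega, by omega, trivial, ?_⟩
  constructor
  · constructor <;> simp only [State.setReg_reg, State.setReg_arr, State.setArr_reg,
      State.setArr_arr, reduceIte, Nat.reduceEqDiff, f1, f2, f30, f31, g0, g8, g10, g11, g20]
    · exact h.ready.isParent
    · rw [← a0]; exact hG.rows
    · exact hcnt₁
    · exact h.ready.base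
  · simp
  · simp only [State.setReg_reg, State.setReg_arr, State.setArr_reg, State.setArr_arr, reduceIte,
      Nat.reduceEqDiff, f11, g1, g2]
    have hst : Stored (s₀.arr 1) (s₀.arr 2) (Function.update L i L') i (s₀.reg 11) :=
      ⟨h.stored.1, fun b hb => by rw [hupd b hb]; exact h.stored.2 b hb⟩
    have := hst.succ (dat' := s.arr 2) (by rw [Function.update_self]; exact happ)
    rwa [Function.update_self] at this
  · simp only [State.setReg_arr, State.setArr_arr, reduceIte, Nat.reduceEqDiff, g1]
    rw [Function.update_of_ne (by omega)]
    exact h.off_zero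
  · simp only [State.setReg_reg, State.setArr_reg, reduceIte, Nat.reduceEqDiff, f11]
    omega
  · intro b hb
    rw [Function.update_apply]
    split_ifs with hbi
    · exact hnd
    · exact h.nodup b (by omega)
  · intro b hb
    rw [Function.update_apply]
    split_ifs with hbi
    · exact hlt
    · exact h.lt b (by omega)
  · intro b hb
    simp only [State.setReg_arr, State.setArr_arr, reduceIte, Nat.reduceEqDiff, g0, g15]
    by_cases hbi : b = i
    · rw [hbi, Function.update_self, Function.update_self]
      exact hroot
    · rw [Function.update_of_ne hbi, Function.update_of_ne hbi]
      exact h.rooted b (by omega)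
  · intro x hx
    simp only [State.setReg_arr, State.setArr_arr, reduceIte, Nat.reduceEqDiff]
    rw [hbag₁ x hx, List.range_succ, List.filter_append]
    congr 1
    · exact hrange _ _ fun b hb => by rw [hupd b hb]
    · rw [List.filter_singleton, Function.update_self]
      simp
  · intro x hx
    simp only [State.setReg_arr, State.setArr_arr, reduceIte, Nat.reduceEqDiff, g15, g16, g17]
    rw [List.range_succ, List.filter_append, List.filter_singleton, Function.update_self,
      hrange _ _ fun b hb => by rw [hupd15 b hb]]
    by_cases hxt : x = top
    · rw [hxt, Function.update_self, seg_update_succ, htops]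
      simp
    · have hlenx := congrArg List.length (h.tops x hx)
      rw [length_seg] at hlenx
      have hfx := hfl fun b => s₀.arr 15 b = x
      rw [Function.update_of_ne hxt, seg_update_row _ _ hsz (by omega) hxt, h.tops x hx]
      simp [Ne.symm hxt]

/-! ### The law of a single subtree -/

theorem growSteps_eq {n : ℕ} (T : SimpleGraph (Fin n)) (j d : ℕ) (S : Finset (Fin n)) :
    ChordalGen.growSteps T d S = iterLaw (fun _ => ChordalGen.growStep T) j d S := by
  induction d generalizing j S with
  | zero => rfl
  | succ d ih => rw [ChordalGen.growSteps, iterLaw, funext (ih (j + 1))]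

theorem runs_startProg {W n e k x : ℕ} {s : State} (hp : IsParent n (s.arr 0))
    (hR : Rows n (Joined (s.arr 0)) (s.arr 8) (s.arr 10) (s.arr 11))
    (hcnt : ∀ y < n, s.arr 9 y = s.arr 8 y) (h0 : s.reg 30 = 0) (h1 : s.reg 31 = 1)
    (h11 : s.reg 11 = e) (h12 : s.reg 12 = x) (h13 : s.reg 13 = k) (hx : x < n)
    (hk : 1 ≤ k) (hW : e + k ≤ W) :
    Runs W startProg s fun s' t => t ≤ 11 ∧ Growing n s' {x} ∧
      s'.arr 2 = Function.update (s.arr 2) e x ∧ s'.reg 11 = e + 1 ∧ s'.reg 14 = e + k := by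
  refine Runs.of_wp ?_
  simp only [startProg, block, wp, State.setReg_reg, State.setReg_arr, State.setArr_reg,
    State.setArr_arr, Test.Holds, h0, h1, h11, h12, h13, reduceIte, Nat.reduceEqDiff, Growing]
  have hnil : Lists (s.arr 12) 0 fun _ => False := ⟨by simp, by simp⟩
  refine ⟨by omega, by omega, by omega, fun hlt => ⟨by omega, by omega, ?_, trivial, trivial,
    trivial⟩, fun hlt => ⟨by omega, ?_, trivial, trivial, trivial⟩⟩
  · refine Growth.start hp hR hx hcnt ((hnil.add (z := x) (by simp)).congr fun v => ?_)
    grind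
  · refine Growth.start hp hR hx hcnt (hnil.congr fun v => ?_)
    grind

theorem sim_growthProg {W n k i : ℕ} [NeZero n] {s : State} {L : ℕ → List ℕ}
    (h : Stage n k i s L) (hi : i < n) (hk : 1 ≤ k) (hkn : k ≤ n) (hW : n * n + n ≤ W) :
    Sim W growthProg s (ChordalGen.oneSubtree (parentGraph n (s.arr 0)) k hk) fun S s' t =>
      ∃ L' : List ℕ, t ≤ 72 * L'.length + 20 ∧ Growing n s' {x | x ∈ L'} ∧
        Appended (s.arr 2) (s'.arr 2) (s.reg 11) L' ∧ L'.Nodup ∧ s'.reg 12 ∈ L' ∧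
        s'.reg 11 = s.reg 11 + L'.length ∧ ∀ x : Fin n, x ∈ S ↔ (x : ℕ) ∈ L' := by
  classical
  have hn : 0 < n := NeZero.pos n
  have hR := h.ready
  have hle := h.le
  have hb := mul_add_le hi le_rfl
  refine Runs.seq_sim (Runs.of_wp ?_)
  simp only [wp, hR.reg_n, hR.reg_one]
  have hlaw : PMF.uniformOfFintype (Fin n) =
      PMF.uniformOfFinset Finset.univ ⟨0, Finset.mem_univ _⟩ := rfl
  rw [ChordalGen.oneSubtree, hlaw]
  refine Sim.seq (Sim.rand _ (Fin.ofNat n) (by simp [hR.reg_zero]) ?_) ?_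
  · simp only [State.setReg_reg, reduceIte, Nat.reduceEqDiff, hR.reg_zero]
    refine ⟨fun v _ => by simp, fun v hv w hw hvw => ?_, fun y _ => ⟨y, ?_, ?_⟩⟩
    · have hv2 := hv.2
      have hw2 := hw.2
      rw [← val_ofNat_of_lt (n := n) (a := v) (by omega), hvw, val_ofNat_of_lt (by omega)]
    · have := y.2
      exact ⟨by omega, by omega⟩
    · exact Fin.ext (val_ofNat_of_lt y.2)
  rintro x s₁ t₁ ⟨rfl, x', -, hx', rfl, rfl⟩ -
  simp only [State.setReg_reg, reduceIte] at hx'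
  have hx'n : x' < n := by omega
  refine Sim.seq (Sim.rand _ id (by simpa [hR.reg_one, hR.reg_k] using hk) ?_) ?_
  · simp [hR.reg_one, hR.reg_k, Set.bijOn_id]
  rintro k' s₂ t₂ ⟨rfl, k'', hk1, hkk, rfl, rfl⟩ -
  simp only [State.setReg_reg, reduceIte, Nat.reduceEqDiff, hR.reg_one, hR.reg_k] at hk1 hkk
  simp only [id]
  refine Runs.seq_sim ((runs_startProg (n := n)
    (s := ((s.setReg 34 (n - 1)).setReg 12 x').setReg 13 k'') (e := s.reg 11) (k := k'') (x := x')
    hR.isParent hR.rows hR.cnt_eq ?_ ?_ ?_ ?_ ?_ hx'n hk1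
    (show s.reg 11 + k'' ≤ W by omega)).mono ?_)
  · simp [hR.reg_zero]
  · simp [hR.reg_one]
  · simp
  · simp
  · simp
  simp only [State.setReg_arr]
  rintro s₃ t₃ hA₃ ⟨ht₃, hG₃, h2₃, h11₃, h14₃⟩
  have f30 : s₃.reg 30 = 0 := (hA₃.1 30 rfl).trans (by simp [hR.reg_zero])
  have f31 : s₃.reg 31 = 1 := (hA₃.1 31 rfl).trans (by simp [hR.reg_one])
  have f12 : s₃.reg 12 = x' := (hA₃.1 12 rfl).trans (by simp)
  have f0 : s₃.arr 0 = s.arr 0 := hA₃.2 0 rfl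
  have f20 : s₃.arr 20 = s.arr 20 := hA₃.2 20 rfl
  rw [growSteps_eq _ 0]
  refine (Sim.loop _ (k'' - 1) _ (fun j (S : Finset (Fin n)) s' T =>
    T ≤ 72 * j ∧ s'.reg 11 = s.reg 11 + (j + 1) ∧
    S.card = j + 1 ∧ ∃ L' : List ℕ, L'.length = j + 1 ∧
      Fin.val '' (S : Set (Fin n)) = {x | x ∈ L'} ∧
      Growing n s' (Fin.val '' (S : Set (Fin n))) ∧
      Appended (s.arr 2) (s'.arr 2) (s.reg 11) L' ∧ L'.Nodup ∧ x' ∈ L') ?_ ?_ ?_).mono ?_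
  · have himg : Fin.val '' (({Fin.ofNat n x'} : Finset (Fin n)) : Set (Fin n)) = {x'} := by
      rw [Finset.coe_singleton, Set.image_singleton, val_ofNat_of_lt hx'n]
    refine ⟨by omega, h11₃, by simp, [x'], rfl, ?_, ?_, ?_, by simp, by simp⟩
    · rw [himg]; ext; simp
    · rw [himg]; exact hG₃
    · rw [h2₃]; simpa using (Appended.nil (s.arr 2) (s.reg 11)).snoc x'
  · rintro j S s' T hj hA ⟨hT, h11', hcard, L', hlen, hSL, hG, happ, hnd, hx'L⟩
    have e14 : s'.reg 14 = s.reg 11 + k'' := (hA.1 14 rfl).trans h14₃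
    refine ⟨by simp only [Test.Holds]; omega, ?_⟩
    have e0 : s'.arr 0 = s.arr 0 := (hA.2 0 rfl).trans f0
    rw [← e0]
    refine (sim_growProg (W := W) (e := s.reg 11 + (j + 1)) hG (by omega) ?_
      ((hA.1 30 rfl).trans f30) ((hA.1 31 rfl).trans f31) h11' hW (by omega)).mono ?_
    · intro x hx
      rw [hA.2 20 rfl, f20]
      exact hR.base x hx
    · rintro S' s'' t - - ⟨ht, z, hz, hS', hG', h2', h11''⟩
      have hS'' : S' = insert z S := by
        rw [← Finset.coe_inj, hS', Finset.coe_insert]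
      have hzL : (z : ℕ) ∉ L' := by
        intro hc
        have : (z : ℕ) ∈ Fin.val '' (S : Set (Fin n)) := by rw [hSL]; exact hc
        obtain ⟨y, hy, hyz⟩ := this
        exact hz (Fin.ext hyz ▸ hy)
      refine ⟨by omega, by omega, ?_, L' ++ [(z : ℕ)], by simp [hlen], ?_, hG', ?_, ?_,
        by simp [hx'L]⟩
      · rw [hS'', Finset.card_insert_of_notMem hz, hcard]
      · rw [hS', Set.image_insert_eq, hSL]
        ext v
        simp only [Set.mem_insert_iff, Set.mem_ofPred_eq, List.mem_append, List.mem_singleton]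
        tauto
      · rw [h2', ← hlen]
        exact happ.snoc _
      · rw [List.nodup_append]
        exact ⟨hnd, by simp, fun a ha b hb => by grind⟩
  · rintro S s' T hA ⟨-, h11', -⟩
    have e14 : s'.reg 14 = s.reg 11 + k'' := (hA.1 14 rfl).trans h14₃
    simp only [Test.Holds]; omega
  · rintro S s' t - hA ⟨T, rfl, hT, h11', -, L', hlen, hSL, hG, happ, hnd, hx'L⟩
    refine ⟨L', by omega, hSL ▸ hG, happ, hnd, ?_, by omega, fun x => ?_⟩
    · rw [hA.1 12 rfl, f12]; exact hx'L
    · change x ∈ S ↔ (x : ℕ) ∈ {v | v ∈ L'}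
      rw [← hSL]
      exact ⟨fun hx => ⟨x, hx, rfl⟩, fun ⟨y, hy, hyx⟩ => Fin.ext hyx ▸ hy⟩

theorem sim_subtreeProg {W n k i : ℕ} [NeZero n] {s : State} {L : ℕ → List ℕ}
    (h : Stage n k i s L) (hi : i < n) (hk : 1 ≤ k) (hkn : k ≤ n) (hW : n * n + n ≤ W) :
    Sim W subtreeProg s (ChordalGen.oneSubtree (parentGraph n (s.arr 0)) k hk) fun S s' t =>
      ∃ L' : List ℕ, t ≤ 87 * L'.length + 40 ∧ s'.reg 11 = s.reg 11 + L'.length ∧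
        (∀ x : Fin n, x ∈ S ↔ (x : ℕ) ∈ L') ∧
        Stage n k (i + 1) s' (Function.update L i L') := by
  refine Sim.seq_runs ((sim_growthProg h hi hk hkn hW).mono ?_)
  rintro S s' t - hA ⟨L', ht, hG, happ, hnd, hx, h11, hS⟩
  refine (runs_recordProg h hA hi hG happ hnd hx rfl h11 hW).mono ?_
  rintro s'' t' - ⟨ht', h11', hst⟩
  exact ⟨L', by omega, h11', hS, hst⟩

/-! ### The law of the family of subtrees -/

/-- Generate all subtrees. -/
def familyProg : Cmd := .loop (.lt 10 2) subtreeProg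

/-- Choose the member number `i` of a family of sets to be a random subtree. -/
noncomputable def familyStep {n : ℕ} [NeZero n] (T : SimpleGraph (Fin n)) (k : ℕ) (hk : 1 ≤ k)
    (i : ℕ) (F : Fin n → Finset (Fin n)) : PMF (Fin n → Finset (Fin n)) :=
  (ChordalGen.oneSubtree T k hk).map fun S b => if (b : ℕ) = i then S else F b

/-- Choosing the members of a family one after the other; the members from number `m` on are still
empty. -/
theorem iterLaw_familyStep {n : ℕ} [NeZero n] (T : SimpleGraph (Fin n)) (k : ℕ) (hk : 1 ≤ k)
    (m : ℕ) : iterLaw (familyStep T k hk) 0 m (fun _ => ∅) =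
      (ChordalGen.growingSubtree T k hk m).map
        fun F (b : Fin n) => if h : (b : ℕ) < m then F ⟨b, h⟩ else ∅ := by
  induction m with
  | zero => simp [iterLaw, ChordalGen.growingSubtree, PMF.pure_map]
  | succ m ih =>
    rw [iterLaw_succ, ih, ChordalGen.growingSubtree, PMF.map_bind, PMF.bind_map]
    congr 1
    funext F
    rw [Function.comp_apply, familyStep, PMF.map_comp]
    congr 1
    funext S b
    simp only [Function.comp_apply, Fin.snoc, Nat.zero_add]
    by_cases h1 : (b : ℕ) = m
    · simp [h1]
    · by_cases h2 : (b : ℕ) < m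
      · simp [h1, h2, Nat.lt_succ_of_lt h2]
      · rw [if_neg h1, dif_neg h2, dif_neg (by omega)]

theorem growingSubtree_eq {n : ℕ} [NeZero n] (T : SimpleGraph (Fin n)) (k : ℕ) (hk : 1 ≤ k) :
    ChordalGen.growingSubtree T k hk n = iterLaw (familyStep T k hk) 0 n (fun _ => ∅) := by
  rw [iterLaw_familyStep]
  simp only [Fin.is_lt, dite_true, Fin.eta]
  exact (PMF.map_id _).symm

theorem Stage.zero {n k : ℕ} {s : State} (h : HostReady n k s) (h10 : s.reg 10 = 0)
    (h11 : s.reg 11 = 0) (a1 : s.arr 1 0 = 0) (a13 : ∀ x, s.arr 13 x = 0)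
    (a16 : ∀ x, s.arr 16 x = 0) : Stage n k 0 s fun _ => [] where
  ready := h
  reg_i := h10
  stored := ⟨by rw [a1, h11], by simp⟩
  off_zero := a1
  le := by simp [h11]
  nodup := by simp
  lt := by simp
  rooted := by simp
  bag x _ := by simp [a13]
  tops x _ := by simp [a16]

/-- The family of lists `L` has the sets `F 0`, …, `F (i - 1)` as its members. -/
def Represents {n : ℕ} (L : ℕ → List ℕ) (F : Fin n → Finset (Fin n)) (i : ℕ) : Prop :=
  ∀ b : Fin n, (b : ℕ) < i → ∀ x : Fin n, x ∈ F b ↔ (x : ℕ) ∈ L b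

theorem sim_familyProg {W n k : ℕ} [NeZero n] {s : State}
    (h : Stage n k 0 s fun _ => []) (hk : 1 ≤ k) (hkn : k ≤ n) (hW : n * n + n ≤ W) :
    Sim W familyProg s (ChordalGen.growingSubtree (parentGraph n (s.arr 0)) k hk n) fun F s' t =>
      ∃ L, t ≤ 87 * s'.reg 11 + 41 * n + 1 ∧ Stage n k n s' L ∧ Represents L F n := by
  rw [growingSubtree_eq]
  refine (Sim.loop _ n _ (fun i F s' T => s'.arr 0 = s.arr 0 ∧ ∃ L,
    T ≤ 87 * s'.reg 11 + 41 * i ∧ Stage n k i s' L ∧ Represents L F i)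
    ⟨rfl, _, by omega, h, fun b hb => by omega⟩ ?_ ?_).mono ?_
  · rintro i F s' T hi hA ⟨h0, L, hT, hst, hL⟩
    refine ⟨by simp only [Test.Holds, hst.reg_i, hst.ready.reg_n]; exact hi, ?_⟩
    have hsim := sim_subtreeProg (W := W) hst hi hk hkn hW
    rw [h0] at hsim
    refine Sim.map _ hsim ?_
    rintro S s'' t hA' ⟨L', ht, h11, hS, hst'⟩
    refine ⟨(hA'.2 0 rfl).trans h0, _, by omega, hst', fun b hb x => ?_⟩
    dsimp only
    by_cases hbi : (b : ℕ) = i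
    · rw [if_pos hbi, hbi, Function.update_self]
      exact hS x
    · rw [if_neg hbi, Function.update_of_ne hbi]
      exact hL b (by omega) x
  · rintro F s' T - ⟨-, L, -, hst, -⟩
    simp [Test.Holds, hst.reg_i, hst.ready.reg_n]
  · rintro F s' t - - ⟨T, rfl, -, L, hT, hst, hL⟩
    exact ⟨L, by omega, hst, hL⟩

theorem Stage.segment_eq {n k i : ℕ} {s : State} {L : ℕ → List ℕ} (h : Stage n k i s L) {b : ℕ}
    (hb : b < i) : segment (s.arr 1) (s.arr 2) b = L b := (h.stored.2 b hb).1

theorem Stage.generated {n k : ℕ} {s : State} {L : ℕ → List ℕ} (hn : 0 < n)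
    (h : Stage n k n s L) : Generated n s where
  reg_n := h.ready.reg_n
  reg_zero := h.ready.reg_zero
  reg_one := h.ready.reg_one
  fam :=
    { pos := hn
      isParent := h.ready.isParent
      lt := fun b hb => by rw [h.segment_eq hb]; exact h.lt b hb
      rooted := fun b hb => by rw [h.segment_eq hb]; exact h.rooted b hb }
  nodup b hb := by rw [h.segment_eq hb]; exact h.nodup b hb
  off_zero := h.off_zero
  off_le b hb := by
    -- a list with an element occupies a nonempty range of cells
    have hmem := (h.rooted b hb).1
    rw [Set.mem_ofPred_eq, ← h.segment_eq hb, segment] at hmem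
    by_contra hlt
    rw [Nat.sub_eq_zero_of_le (by omega)] at hmem
    simp at hmem
  base := h.ready.base
  bag x hx := by
    rw [h.bag x hx]
    exact List.filter_congr fun b hb => by rw [h.segment_eq (List.mem_range.1 hb)]
  tops := h.tops

/-! ### The main program and its output -/

/-- Generate the host tree and the subtrees, and compute the maximal cliques of their intersection
graph with a clique tree. -/
def chordalProg : Cmd := .seq hostProg (.seq familyProg (.seq contractProg emitProg))

/-- The final state of `chordalProg` with the number of steps `t`: what is stored there, besides the
data of `Generated`, is the list of the bags of the nodes that survive the contraction, which are
`s.arr 19 0`, `s.arr 19 1`, …. -/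
structure Output (n : ℕ) (s : State) (t : ℕ) : Prop where
  generated : Generated n s
  time : t ≤ 300 * s.arr 1 n
  contraction : Contraction n (fun i x => x ∈ segment (s.arr 1) (s.arr 2) i) n (s.reg 0)
    (s.arr 18) (s.arr 19) (s.arr 5)
  cliques : ∃ e, Stored (s.arr 3) (s.arr 4) (fun a => (List.range n).filter fun i =>
    s.arr 19 a ∈ segment (s.arr 1) (s.arr 2) i) (s.reg 0) e

theorem runs_finish {W n k t₀ : ℕ} {s : State} {L : ℕ → List ℕ} (hn : 0 < n)
    (h : Stage n k n s L) (h18 : s.arr 18 0 = 0) (h19 : s.arr 19 0 = 0) (hW : n * n + n ≤ W)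
    (ht₀ : t₀ ≤ 87 * s.reg 11 + 71 * n + 1) :
    Runs W (.seq contractProg emitProg) s fun s' t => Output n s' (t₀ + t) := by
  have hg := h.generated hn
  have htot := hg.le_total
  have h11 : s.arr 1 n = s.reg 11 := h.stored.1
  have hnn := Nat.le_mul_self n
  refine Runs.seq ((runs_contractProg (W := W) hg (by omega) h18 h19).mono ?_)
  rintro s₁ t₁ hA₁ ⟨ht₁, hc⟩
  have hg₁ := hg.of_agree hA₁ rfl rfl
  have b1 : s₁.arr 1 = s.arr 1 := hA₁.2 1 rfl
  have b2 : s₁.arr 2 = s.arr 2 := hA₁.2 2 rfl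
  rw [← b1, ← b2] at hc
  refine (runs_emitProg hg₁ hW rfl hc).mono ?_
  rintro s₂ t₂ hA₂ ⟨ht₂, h0, hst⟩
  have hg₂ := hg₁.of_agree hA₂ rfl rfl
  have c1 : s₂.arr 1 = s₁.arr 1 := hA₂.2 1 rfl
  have c2 : s₂.arr 2 = s₁.arr 2 := hA₂.2 2 rfl
  have c5 : s₂.arr 5 = s₁.arr 5 := hA₂.2 5 rfl
  have c18 : s₂.arr 18 = s₁.arr 18 := hA₂.2 18 rfl
  have c19 : s₂.arr 19 = s₁.arr 19 := hA₂.2 19 rfl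
  refine ⟨hg₂, ?_, ?_, ?_⟩
  · rw [c1, b1]
    rw [b1] at ht₂
    omega
  · rw [h0, c1, c2, c5, c18, c19]
    exact hc
  · rw [h0, c1, c2, c19]
    exact hst

theorem sim_chordalProg {W n k : ℕ} [NeZero n] (hk : 1 ≤ k) (hkn : k ≤ n)
    (hW : n * n + n + 1 ≤ W) :
    Sim W chordalProg (State.input n k) (ChordalGen.law n k hk) fun p s t =>
      p = (s.host n, s.subtrees n) ∧ Output n s t := by
  have hn : 0 < n := NeZero.pos n
  refine Sim.seq (sim_hostProg hkn hW) ?_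
  rintro T s₀ t₀ ⟨ht₀, rfl, hR⟩ hA₀
  have hst : Stage n k 0 s₀ fun _ => [] := by
    refine Stage.zero hR ((hA₀.1 10 rfl).trans ?_) ((hA₀.1 11 rfl).trans ?_) ?_ ?_ ?_
    · simp [State.input]
    · simp [State.input]
    · rw [hA₀.2 1 rfl]; rfl
    · rw [hA₀.2 13 rfl]; exact fun _ => rfl
    · rw [hA₀.2 16 rfl]; exact fun _ => rfl
  refine Sim.map (Q := fun F s t => F = s.subtrees n ∧ s.arr 0 = s₀.arr 0 ∧ Output n s (t₀ + t))
    _ (Sim.seq_runs ((sim_familyProg (W := W) hst hk hkn (by omega)).mono ?_)) ?_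
  · rintro F s₁ t₁ - hA₁ ⟨L, ht₁, hst₁, hL⟩
    refine (runs_finish (W := W) (t₀ := t₀ + t₁) hn hst₁ ?_ ?_ (by omega) (by omega)).mono ?_
    · rw [hA₁.2 18 rfl, hA₀.2 18 rfl]; rfl
    · rw [hA₁.2 19 rfl, hA₀.2 19 rfl]; rfl
    · rintro s₂ t₂ hA₂ hO
      refine ⟨?_, (hA₂.2 0 rfl).trans (hA₁.2 0 rfl), by rwa [← Nat.add_assoc]⟩
      funext b
      ext x
      rw [hL b b.2 x, ← hst₁.segment_eq b.2, State.subtrees, segmentSet, hA₂.2 1 rfl, hA₂.2 2 rfl]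
      simp
  · rintro F s₁ t₁ - ⟨hF, h0, hO⟩
    refine ⟨?_, hO⟩
    rw [hF, State.host, h0]

theorem mem_segmentSet {n : ℕ} {off dat : ℕ → ℕ} {i : ℕ} {x : Fin n} :
    x ∈ segmentSet n off dat i ↔ (x : ℕ) ∈ segment off dat i := by
  simp [segmentSet]

theorem storesSets_segmentSet {m n : ℕ} {off dat : ℕ → ℕ}
    (hnd : ∀ i < m, (segment off dat i).Nodup) (hlt : ∀ i < m, ∀ x ∈ segment off dat i, x < n) :
    StoresSets off dat fun i : Fin m => (segmentSet n off dat i : Set (Fin n)) := fun i =>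
  ⟨hnd i i.2, fun v => ⟨fun hv => ⟨⟨v, hlt i i.2 v hv⟩, mem_segmentSet.2 hv, rfl⟩,
    fun ⟨_, hx, hxv⟩ => hxv ▸ mem_segmentSet.1 hx⟩⟩

theorem Generated.sum_card {n : ℕ} {s : State} (h : Generated n s) :
    ∑ i, (s.subtrees n i).card = s.arr 1 n := by
  rw [h.off_eq_sum le_rfl, Finset.sum_range]
  refine Finset.sum_congr rfl fun i _ => ?_
  rw [← List.toFinset_card_of_nodup (h.nodup i i.2), ← Finset.card_map Fin.valEmbedding]
  congr 1
  ext v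
  simp only [Finset.mem_map, List.mem_toFinset, State.subtrees, mem_segmentSet,
    Fin.valEmbedding_apply]
  exact ⟨fun ⟨x, hx, hxv⟩ => hxv ▸ hx, fun hv => ⟨⟨v, h.fam.lt i i.2 v hv⟩, hv, rfl⟩⟩

theorem Generated.sum_length_neighborList {n : ℕ} {s : State} (h : Generated n s) :
    ∑ i ∈ Finset.range n, (neighborList n (segment (s.arr 1) (s.arr 2)) (s.arr 15) i).length =
      2 * (ChordalGen.intersectionGraph (s.subtrees n)).edgeSet.ncard := by
  classical
  rw [← SimpleGraph.coe_edgeFinset, Set.ncard_coe_finset,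
    ← SimpleGraph.sum_degrees_eq_twice_card_edges, Finset.sum_range]
  refine Finset.sum_congr rfl fun i _ => ?_
  rw [h.fam.length_neighborList (F := s.subtrees n) (fun _ _ => mem_segmentSet) i (h.nodup i i.2),
    Set.ncard_eq_toFinset_card']
  rfl

theorem Output.time_le {n t : ℕ} {s : State} (h : Output n s t) :
    t ≤ 300 * ∑ i, (s.subtrees n i).card := by
  rw [h.generated.sum_card]; exact h.time

theorem Generated.connected {n : ℕ} {s : State} (h : Generated n s) (i : Fin n) :
    ((s.host n).induce (s.subtrees n i : Set (Fin n))).Connected := by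
  refine RootedAt.connected (t := s.arr 15 i) h.fam.isParent ?_
  convert h.fam.rooted i i.2 using 1
  ext v
  simp only [Set.mem_image, Finset.mem_coe, Set.mem_ofPred_eq, State.subtrees, mem_segmentSet]
  exact ⟨fun ⟨x, hx, hxv⟩ => hxv ▸ hx, fun hv => ⟨⟨v, h.fam.lt i i.2 v hv⟩, hv, rfl⟩⟩

theorem Output.mem_cliques {n t : ℕ} {s : State} (h : Output n s t) (a : Fin (s.reg 0))
    (i : Fin n) :
    i ∈ s.cliques n a ↔ s.arr 19 a ∈ segment (s.arr 1) (s.arr 2) i := by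
  obtain ⟨e, hst⟩ := h.cliques
  rw [State.cliques, mem_segmentSet, (hst.2 a a.2).1]
  simp

theorem Output.storesSets_cliques {n t : ℕ} {s : State} (h : Output n s t) :
    StoresSets (s.arr 3) (s.arr 4) fun a => (s.cliques n a : Set (Fin n)) := by
  obtain ⟨e, hst⟩ := h.cliques
  refine storesSets_segmentSet (fun a ha => ?_) fun a ha x hx => ?_
  · rw [(hst.2 a ha).1]
    exact List.nodup_range.filter _
  · rw [(hst.2 a ha).1] at hx
    exact List.mem_range.1 (List.mem_of_mem_filter hx)

theorem Generated.exists_adjacency {W n : ℕ} {s : State} (h : Generated n s)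
    (hW : n * n + 2 * n ≤ W) : ∃ s' t, Exec W adjacencyProg s (PMF.pure (s', t)) ∧
      t ≤ 80 * (∑ i, (s.subtrees n i).card +
        (ChordalGen.intersectionGraph (s.subtrees n)).edgeSet.ncard) ∧
      StoresSets (s'.arr 6) (s'.arr 7)
        (ChordalGen.intersectionGraph (s.subtrees n)).neighborSet := by
  obtain ⟨s', t, hE, ht, e, hst⟩ := runs_adjacencyProg h hW
  refine ⟨s', t, hE, ?_, fun i => ?_⟩
  · rw [h.sum_length_neighborList] at ht
    rw [h.sum_card]
    omega
  · rw [(hst.2 i i.2).1]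
    refine ⟨h.fam.nodup_neighborList i.2 (h.nodup i i.2), fun v => ?_⟩
    rw [h.fam.mem_neighborList]
    have hadj : ∀ j : Fin n, _ := fun j =>
      h.fam.adj_iff_top (F := s.subtrees n) (fun _ _ => mem_segmentSet) (i := i) (j := j)
    constructor
    · rintro ⟨hv, hne, hm⟩
      exact ⟨⟨v, hv⟩, (hadj _).2 ⟨fun hc => hne (hc ▸ rfl), hm⟩, rfl⟩
    · rintro ⟨j, hj, rfl⟩
      obtain ⟨hne, hm⟩ := (hadj _).1 hj
      exact ⟨j.2, fun hc => hne (Fin.ext hc.symm), hm⟩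

end RAM

open ChordalGen RAM in
theorem corollary7 :
    ∃ (P Q : Cmd) (C : ℕ), ∀ (n k : ℕ) [NeZero n] (hk : 1 ≤ k), k ≤ n →
      ∃ μ : PMF (State × ℕ),
        Exec (C * n ^ 2) P (State.input n k) μ ∧
        μ.map (fun p => (p.1.host n, p.1.subtrees n)) = law n k hk ∧
        ∀ (s : State) (t : ℕ), (s, t) ∈ μ.support →
          t ≤ C * ∑ i, (s.subtrees n i).card ∧
          (s.host n).IsTree ∧
          (∀ i, ((s.host n).induce (s.subtrees n i : Set (Fin n))).Connected) ∧
          IsChordal (intersectionGraph (s.subtrees n)) ∧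
          StoresSets (s.arr 1) (s.arr 2) (fun i => (s.subtrees n i : Set (Fin n))) ∧
          IsCliqueTree (intersectionGraph (s.subtrees n)) s.cliqueTree
            (fun a => (s.cliques n a : Set (Fin n))) ∧
          StoresSets (s.arr 3) (s.arr 4) (fun a => (s.cliques n a : Set (Fin n))) ∧
          ∃ (s' : State) (t' : ℕ),
            Exec (C * n ^ 2) Q s (PMF.pure (s', t')) ∧
            t' ≤ C * (∑ i, (s.subtrees n i).card +
              (intersectionGraph (s.subtrees n)).edgeSet.ncard) ∧
            StoresSets (s'.arr 6) (s'.arr 7) (intersectionGraph (s.subtrees n)).neighborSet := by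
  refine ⟨chordalProg, adjacencyProg, 300, fun n k _ hk hkn => ?_⟩
  have hn : 0 < n := NeZero.pos n
  have hW : n * n + 2 * n + 1 ≤ 300 * n ^ 2 := by nlinarith
  obtain ⟨κ, hE, hlaw, hκ⟩ := sim_chordalProg hk hkn (by omega : n * n + n + 1 ≤ 300 * n ^ 2)
  refine ⟨_, hE, ?_, fun s t hst => ?_⟩
  · rw [← hlaw, PMF.map_comp, PMF.map, PMF.map]
    exact bind_congr_support fun p hp => congrArg PMF.pure (hκ p hp).1.symm
  · rw [PMF.support_map] at hst
    obtain ⟨⟨p, _, _⟩, hp, hpst⟩ := hst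
    cases hpst
    obtain ⟨-, hO⟩ := hκ _ hp
    have hg := hO.generated
    obtain ⟨s', t', hQ, ht', hadj⟩ := hg.exists_adjacency (by omega : n * n + 2 * n ≤ 300 * n ^ 2)
    refine ⟨hO.time_le, parentGraph_isTree hn hg.fam.isParent, hg.connected,
      hg.fam.isChordal fun _ _ => mem_segmentSet, storesSets_segmentSet hg.nodup hg.fam.lt,
      hO.contraction.isCliqueTree hg.fam (fun _ _ => mem_segmentSet) hO.mem_cliques,
      hO.storesSets_cliques, s', t', hQ, ht'.trans (Nat.mul_le_mul_right _ (by norm_num)), hadj⟩
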